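/- Let $T$ be a semi-homogeneous tree with vertex set $V$: for integers $q_+,q_->1$ and a reference vertex $v_0$, every vertex at even distance from $v_0$ (the class $V_+$) has $q_++1$ neighbours and every vertex at odd distance (the class $V_-$) has $q_-+1$ neighbours. Let $\mu_1f(v)$ be the average of $f$ over the neighbours of $v$; a $\gamma$-eigenfunction is an $f:V\to\mathbb C$ with $\mu_1f=\gamma f$. Let $\sigma$ and $\rho$ be the spectrum and the spectral radius of $\mu_1$ on $\ell^2(V)$. Let $\Omega$ be the boundary of $T$ (equivalence classes of rays), with the topology generated by the arcs $\Omega(u,v)=\{\omega: v\in[u,\omega)\}$; a distribution on $\Omega$ is a finitely additive complex measure on its clopen sets; $\nu_{v_0}$ is the Borel measure with $\nu_{v_0}(\Omega(v_0,v))=1/|\{w:d(w,v_0)=d(v,v_0)\}|$ for all $v$. For $\gamma\ne0$ put $\Gamma=(q_++1)(q_-+1)\gamma^2$ and let $R(\gamma)$ be the square root of $\Gamma^2-2(q_++q_-)\Gamma+(q_+-q_-)^2$ that is analytic where $\Gamma\notin[(\sqrt{q_+}-\sqrt{q_-})^2,(\sqrt{q_+}+\sqrt{q_-})^2]$ and positive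 for large real $\gamma$ (where $\Gamma$ lies in that interval, a fixed one of the two roots is taken). Put $$F^\pm(\gamma)=\frac{\Gamma\mp(q_+-q_-)-R(\gamma)}{2q_\mp(q_\pm+1)\gamma},\qquad \widetilde F^\pm(\gamma)=\frac{\Gamma\mp(q_+-q_-)+R(\gamma)}{2q_\mp(q_\pm+1)\gamma},$$ and let $F(u,v|\gamma)$ (respectively $\widetilde F(u,v|\gamma)$) be the product along the chain from $u$ to $v$ of the factors $F^\pm(\gamma)$ (respectively $\widetilde F^\pm(\gamma)$), one for each step, the sign being that of the class $V_\pm$ of the starting point of the step. Define $$P(v,v_0,\omega|\gamma)=\frac{F(v,j|\gamma)}{F(v_0,j|\gamma)},\qquad \widetilde P(v,v_0,\omega|\gamma)=\frac{\widetilde F(v,j|\gamma)}{\widetilde F(v_0,j|\gamma)},\qquad j\in[v,\omega)\cap[v_0,\omega).$$ Then: 1. $F$ is the generalized hitting probability: if $|\gamma|>\rho$, then $F(u,v|\gamma)=\sum_n f^{(n)}(u,v)\gamma^{-n}$, where $f^{(n)}(u,v)$ is the probability that the random walk generated by $\mu_1$ and started at $u$ first visits $v$ at time $n$. If $\gamma\notin\sigma$,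 then $\gamma\neq0$ and $F(u,v|\gamma)=G(u,v|\gamma)/G(v,v|\gamma)$, where $G(\cdot,\cdot|\gamma)$ is the kernel of $(\gamma-\mu_1)^{-1}$ on $\ell^2(V)$ and $G(v,v|\gamma)\ne0$. 2. For every $\gamma\ne0$ both kernels are well defined (such $j$ exist, the denominators are non-zero and the quotient does not depend on $j$) and, for each $v$, locally constant in $\omega$ with finitely many values. 3. For every $\gamma\ne0$, every $\omega\in\Omega$ and every distribution $\mu$ on $\Omega$, the functions $P(\cdot,v_0,\omega|\gamma)$, $\widetilde P(\cdot,v_0,\omega|\gamma)$, $\int_\Omega P(\cdot,v_0,\omega|\gamma)\,d\mu(\omega)$ and $\int_\Omega\widetilde P(\cdot,v_0,\omega|\gamma)\,d\mu(\omega)$ are $\gamma$-eigenfunctions of $\mu_1$. 4. The measure $\nu_{v_0}$ exists and is unique. For every $\gamma\notin\sigma$ there is exactly one $\gamma$-eigenfunction $\phi(\cdot,v_0|\gamma)$ that is radial around $v_0$ and has value $1$ at $v_0$ (the spherical function), and $$\phi(\cdot,v_0|\gamma)=\int_\Omega P(\cdot,v_0,\omega|\gamma)\,d\nu_{v_0}(\omega)=\int_\Omega\widetilde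 P(\cdot,v_0,\omega|\gamma)\,d\nu_{v_0}(\omega).$$ 5. For every real $\gamma>\rho$ and every $\omega$, both $P(\cdot,v_0,\omega|\gamma)$ and $\widetilde P(\cdot,v_0,\omega|\gamma)$ are positive; $P(\cdot,v_0,\omega|\gamma)$ is a minimal $\gamma$-eigenfunction (every $\gamma$-eigenfunction $h$ with $0\le h\le P(\cdot,v_0,\omega|\gamma)$ is a constant multiple of it), whereas $\widetilde P(\cdot,v_0,\omega|\gamma)$ is not minimal. 6. Let $\gamma\ne0$, let $A^\pm\in\mathbb C\setminus\{0\}$, let $A(u,v)$ be the product along the chain from $u$ to $v$ of the factors $A^\pm$ chosen as above, and let $K(v,\omega)=A(v,j)/A(v_0,j)$ for $j\in[v,\omega)\cap[v_0,\omega)$. If $K(\cdot,\omega)$ is a $\gamma$-eigenfunction for every $\omega$, then $K=P(\cdot,v_0,\cdot|\gamma)$ or $K=\widetilde P(\cdot,v_0,\cdot|\gamma)$. 7. Let $q_+=q_-=q$ and $\gamma\notin\sigma$. There is $z\in\mathbb C$ with $\operatorname{Re}z>\frac12$ and $\gamma=(q^z+q^{1-z})/(q+1)$, and for every such $z$ one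 has $P(v,v_0,\omega|\gamma)=P(v,v_0,\omega|1)^z$ and $\widetilde P(v,v_0,\omega|\gamma)=P(v,v_0,\omega|1)^{1-z}$ for all $v$ and $\omega$ (where $P(v,v_0,\omega|1)>0$ is the harmonic Poisson kernel). -/

import Mathlib

open scoped ENNReal

noncomputable section

namespace SemihomTree

variable {V : Type*}

/-- `G` is the semi-homogeneous tree with homogeneity degrees `qp` on the vertices at even
distance from the reference vertex `v₀` (the class `V₊`, containing `v₀`) and `qm` on those at odd
distance (the class `V₋`): a vertex of homogeneity degree `q` has `q + 1` neighbours. -/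
structure IsSemihomogeneous (G : SimpleGraph V) [G.LocallyFinite] (v₀ : V) (qp qm : ℕ) :
    Prop where
  isTree : G.IsTree
  one_lt_plus : 1 < qp
  one_lt_minus : 1 < qm
  degree_even : ∀ v, Even (G.dist v₀ v) → G.degree v = qp + 1
  degree_odd : ∀ v, ¬ Even (G.dist v₀ v) → G.degree v = qm + 1

/-! ### The Laplace operator -/

/-- The Laplace operator `μ₁`: the average over the neighbours. -/
def laplacian (G : SimpleGraph V) [G.LocallyFinite] (f : V → ℂ) (v : V) : ℂ :=
  (G.degree v : ℂ)⁻¹ * ∑ w ∈ G.neighborFinset v, f w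

/-- `f` is a `γ`-eigenfunction of `μ₁`, i.e. `μ₁ f = γ f` on all of `V`. -/
def IsEigenfunction (G : SimpleGraph V) [G.LocallyFinite] (γ : ℂ) (f : V → ℂ) : Prop :=
  ∀ v, laplacian G f v = γ * f v

/-- `f` is the spherical function with eigenvalue `γ`: it is radial around `v₀`, has value `1`
at `v₀`, and is a `γ`-eigenfunction. -/
structure IsSphericalFunction (G : SimpleGraph V) [G.LocallyFinite] (v₀ : V) (γ : ℂ)
    (f : V → ℂ) : Prop where
  radial : ∀ v w, G.dist v₀ v = G.dist v₀ w → f v = f w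
  normalized : f v₀ = 1
  eigenfunction : IsEigenfunction G γ f

/-- A strictly positive `γ`-eigenfunction (`γ` real). -/
def IsPositiveEigenfunction (G : SimpleGraph V) [G.LocallyFinite] (γ : ℝ) (f : V → ℂ) : Prop :=
  IsEigenfunction G (γ : ℂ) f ∧ ∃ u : V → ℝ, (∀ v, 0 < u v) ∧ ∀ v, f v = (u v : ℂ)

/-- A minimal `γ`-eigenfunction: a positive one such that every non-negative `γ`-eigenfunction
below it is a constant multiple of it. -/
def IsMinimalEigenfunction (G : SimpleGraph V) [G.LocallyFinite] (γ : ℝ) (f : V → ℂ) : Prop :=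
  IsPositiveEigenfunction G γ f ∧
    ∀ h : V → ℝ, (∀ v, 0 ≤ h v) → IsEigenfunction G (γ : ℂ) (fun v => (h v : ℂ)) →
      (∀ v, h v ≤ (f v).re) → ∃ c : ℝ, ∀ v, (h v : ℂ) = (c : ℂ) * f v

/-! ### The Laplace operator on `ℓ²(V)` -/

theorem norm_laplacian_sq_le (G : SimpleGraph V) [G.LocallyFinite] (f : V → ℂ) (v : V) :
    ‖laplacian G f v‖ ^ 2 ≤ ∑ w ∈ G.neighborFinset v, ‖f w‖ ^ 2 := by
  have h1 : ‖∑ w ∈ G.neighborFinset v, f w‖ ^ 2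
      ≤ (G.degree v : ℝ) * ∑ w ∈ G.neighborFinset v, ‖f w‖ ^ 2 := by
    calc _ ≤ (∑ w ∈ G.neighborFinset v, ‖f w‖) ^ 2 := by
          gcongr; exact norm_sum_le _ _
      _ ≤ _ := by
          have := sq_sum_le_card_mul_sum_sq (s := G.neighborFinset v) (f := fun w => ‖f w‖)
          rwa [G.card_neighborFinset_eq_degree] at this
  have h0 : 0 ≤ ∑ w ∈ G.neighborFinset v, ‖f w‖ ^ 2 := Finset.sum_nonneg fun _ _ => by positivity
  rw [laplacian, norm_mul, norm_inv, Complex.norm_natCast, mul_pow]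
  rcases Nat.eq_zero_or_pos (G.degree v) with hd | hd
  · simpa [hd] using h0
  · have hd' : (1 : ℝ) ≤ G.degree v := by exact_mod_cast hd
    calc _ ≤ ((G.degree v : ℝ)⁻¹) ^ 2 * ((G.degree v : ℝ) *
            ∑ w ∈ G.neighborFinset v, ‖f w‖ ^ 2) := by gcongr
      _ = (G.degree v : ℝ)⁻¹ * ∑ w ∈ G.neighborFinset v, ‖f w‖ ^ 2 := by
          field_simp
      _ ≤ 1 * _ := by
          gcongr
          exact inv_le_one_of_one_le₀ hd'
      _ = _ := one_mul _

theorem tsum_norm_laplacian_sq_le (G : SimpleGraph V) [G.LocallyFinite] (D : ℕ)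
    (hD : ∀ v, G.degree v ≤ D) (f : V → ℂ) :
    ∑' v, ENNReal.ofReal (‖laplacian G f v‖ ^ 2) ≤ D * ∑' v, ENNReal.ofReal (‖f v‖ ^ 2) := by
  classical
  have hsum : ∀ (g : V → ℝ≥0∞) (v : V), ∑ w ∈ G.neighborFinset v, g w
      = ∑' w, if G.Adj v w then g w else 0 := by
    intro g v
    rw [tsum_eq_sum (s := G.neighborFinset v)]
    · refine Finset.sum_congr rfl fun w hw => ?_
      rw [if_pos (by simpa using hw)]
    · intro w hw
      rw [if_neg (by simpa using hw)]
  calc _ ≤ ∑' v, ∑' w, (if G.Adj v w then ENNReal.ofReal (‖f w‖ ^ 2) else 0) := by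
        refine ENNReal.tsum_le_tsum fun v => ?_
        rw [← hsum (fun w => ENNReal.ofReal (‖f w‖ ^ 2)),
          ← ENNReal.ofReal_sum_of_nonneg fun _ _ => by positivity]
        exact ENNReal.ofReal_le_ofReal (norm_laplacian_sq_le G f v)
    _ = ∑' w, ∑' v, (if G.Adj w v then ENNReal.ofReal (‖f w‖ ^ 2) else 0) := by
        rw [ENNReal.tsum_comm]
        simp only [G.adj_comm]
    _ ≤ ∑' w, D * ENNReal.ofReal (‖f w‖ ^ 2) := by
        refine ENNReal.tsum_le_tsum fun w => ?_
        rw [← hsum (fun _ => ENNReal.ofReal (‖f w‖ ^ 2)), Finset.sum_const, nsmul_eq_mul,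
          G.card_neighborFinset_eq_degree]
        gcongr
        exact_mod_cast hD w
    _ = _ := ENNReal.tsum_mul_left

theorem summable_norm_laplacian_sq (G : SimpleGraph V) [G.LocallyFinite] (D : ℕ)
    (hD : ∀ v, G.degree v ≤ D) (f : V → ℂ) (hf : Summable fun v => ‖f v‖ ^ 2) :
    (Summable fun v => ‖laplacian G f v‖ ^ 2) ∧
      ∑' v, ‖laplacian G f v‖ ^ 2 ≤ D * ∑' v, ‖f v‖ ^ 2 := by
  have hfin : ∑' v, ENNReal.ofReal (‖f v‖ ^ 2) = ENNReal.ofReal (∑' v, ‖f v‖ ^ 2) :=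
    (ENNReal.ofReal_tsum_of_nonneg (fun _ => by positivity) hf).symm
  have hle := tsum_norm_laplacian_sq_le G D hD f
  rw [hfin] at hle
  have hs : Summable fun v => ‖laplacian G f v‖ ^ 2 := by
    have hne : ∑' v, ENNReal.ofReal (‖laplacian G f v‖ ^ 2) ≠ ∞ :=
      ne_top_of_le_ne_top (ENNReal.mul_ne_top (by simp) (by simp)) hle
    have := ENNReal.summable_toReal hne
    simpa [ENNReal.toReal_ofReal, sq_nonneg] using this
  refine ⟨hs, ?_⟩
  rw [← ENNReal.ofReal_tsum_of_nonneg (fun _ => by positivity) hs,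
    ← ENNReal.ofReal_natCast, ← ENNReal.ofReal_mul (by positivity)] at hle
  exact (ENNReal.ofReal_le_ofReal_iff
    (mul_nonneg (by positivity) (tsum_nonneg fun _ => by positivity))).1 hle

theorem summable_sq_of_lp (f : lp (fun _ : V => ℂ) 2) : Summable fun v => ‖f v‖ ^ 2 := by
  have := (lp.memℓp f).summable (by norm_num)
  simpa using this

theorem norm_sq_lp (f : lp (fun _ : V => ℂ) 2) : ‖f‖ ^ 2 = ∑' v, ‖f v‖ ^ 2 := by
  have := lp.norm_rpow_eq_tsum (p := 2) (by norm_num) f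
  simpa using this

/-- A uniform bound for the degrees. -/
theorem IsSemihomogeneous.degree_le {G : SimpleGraph V} [G.LocallyFinite] {v₀ : V} {qp qm : ℕ}
    (hT : IsSemihomogeneous G v₀ qp qm) (v : V) : G.degree v ≤ qp + qm + 1 := by
  by_cases h : Even (G.dist v₀ v)
  · rw [hT.degree_even v h]; omega
  · rw [hT.degree_odd v h]; omega

/-- The Laplace operator `μ₁` as a bounded operator on `ℓ²(V)`. -/
def laplacianL2 {G : SimpleGraph V} [G.LocallyFinite] {v₀ : V} {qp qm : ℕ}
    (hT : IsSemihomogeneous G v₀ qp qm) :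
    lp (fun _ : V => ℂ) 2 →L[ℂ] lp (fun _ : V => ℂ) 2 :=
  LinearMap.mkContinuous
    { toFun := fun f => ⟨laplacian G f, memℓp_gen (by
        simpa using (summable_norm_laplacian_sq G _ hT.degree_le f (summable_sq_of_lp f)).1)⟩
      map_add' := fun f g => by
        ext v
        change laplacian G (fun w => f w + g w) v = laplacian G f v + laplacian G g v
        simp [laplacian, Finset.sum_add_distrib, mul_add]
      map_smul' := fun c f => by
        ext v
        change laplacian G (fun w => c * f w) v = c * laplacian G f v
        simp [laplacian, ← Finset.mul_sum, mul_left_comm] }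
    (Real.sqrt (qp + qm + 1 : ℕ))
    (fun f => by
      rw [← Real.sqrt_sq (norm_nonneg f), ← Real.sqrt_mul (by positivity)]
      refine Real.le_sqrt_of_sq_le ?_
      rw [norm_sq_lp, norm_sq_lp]
      exact (summable_norm_laplacian_sq G _ hT.degree_le f (summable_sq_of_lp f)).2)

theorem laplacianL2_apply {G : SimpleGraph V} [G.LocallyFinite] {v₀ : V} {qp qm : ℕ}
    (hT : IsSemihomogeneous G v₀ qp qm) (f : lp (fun _ : V => ℂ) 2) (v : V) :
    laplacianL2 hT f v = laplacian G f v := rfl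

/-- The spectrum of `μ₁` on `ℓ²(V)`. -/
def spectrumL2 {G : SimpleGraph V} [G.LocallyFinite] {v₀ : V} {qp qm : ℕ}
    (hT : IsSemihomogeneous G v₀ qp qm) : Set ℂ :=
  spectrum ℂ (laplacianL2 hT)

/-- The spectral radius `ρ` of `μ₁` on `ℓ²(V)`. -/
def rho {G : SimpleGraph V} [G.LocallyFinite] {v₀ : V} {qp qm : ℕ}
    (hT : IsSemihomogeneous G v₀ qp qm) : ℝ≥0∞ :=
  spectralRadius ℂ (laplacianL2 hT)

open Classical in
/-- The generalized Green kernel `G(u, v | γ)`: the kernel of the resolvent `(γ - μ₁)⁻¹`. -/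
def green {G : SimpleGraph V} [G.LocallyFinite] {v₀ : V} {qp qm : ℕ}
    (hT : IsSemihomogeneous G v₀ qp qm) (γ : ℂ) (u v : V) : ℂ :=
  (resolvent (laplacianL2 hT) γ (lp.single 2 v (1 : ℂ))) u

open Classical in
/-- `firstVisit G n u v` is the probability that the random walk generated by `μ₁`, started at
`u`, visits `v` for the first time after `n` steps. -/
def firstVisit (G : SimpleGraph V) [G.LocallyFinite] : ℕ → V → V → ℝ
  | 0, u, v => if u = v then 1 else 0
  | n + 1, u, v =>
      if u = v then 0 else (G.degree u : ℝ)⁻¹ * ∑ w ∈ G.neighborFinset u, firstVisit G n w v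

/-! ### Generalized hitting probabilities -/

/-- `Γ = (q₊ + 1) (q₋ + 1) γ²`. -/
def bigGamma (qp qm : ℕ) (γ : ℂ) : ℂ := ((qp : ℂ) + 1) * ((qm : ℂ) + 1) * γ ^ 2

/-- The square root `R(γ)` of `Γ² - 2 (q₊ + q₋) Γ + (q₊ - q₋)² = (Γ - α) (Γ - β)`, where
`α = (√q₊ - √q₋)²` and `β = (√q₊ + √q₋)²`, in the determination that is analytic where `Γ` is not
in the real interval `[α, β]` and is positive for large real `γ`. (The principal square root below
is cut exactly where `(Γ - β) / (Γ - α)` is real and non-positive.) -/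
def rootR (qp qm : ℕ) (γ : ℂ) : ℂ :=
  (bigGamma qp qm γ - (((√qp - √qm) ^ 2 : ℝ) : ℂ)) *
    ((bigGamma qp qm γ - (((√qp + √qm) ^ 2 : ℝ) : ℂ)) /
      (bigGamma qp qm γ - (((√qp - √qm) ^ 2 : ℝ) : ℂ))) ^ (1 / 2 : ℂ)

/-- The common shape of the nearest-neighbour values: `qa` is the homogeneity degree of the
starting vertex, `qb` the other one, and `r` a square root as above. -/
def nearestValue (qa qb : ℕ) (γ r : ℂ) : ℂ :=
  (bigGamma qa qb γ - ((qa : ℂ) - (qb : ℂ)) - r) / (2 * (qb : ℂ) * ((qa : ℂ) + 1) * γ)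

/-- `F⁺(γ)`. -/
def Fplus (qp qm : ℕ) (γ : ℂ) : ℂ := nearestValue qp qm γ (rootR qp qm γ)

/-- `F⁻(γ)`. -/
def Fminus (qp qm : ℕ) (γ : ℂ) : ℂ := nearestValue qm qp γ (rootR qp qm γ)

/-- The other determination of `F⁺(γ)`. -/
def FtildePlus (qp qm : ℕ) (γ : ℂ) : ℂ := nearestValue qp qm γ (-rootR qp qm γ)

/-- The other determination of `F⁻(γ)`. -/
def FtildeMinus (qp qm : ℕ) (γ : ℂ) : ℂ := nearestValue qm qp γ (-rootR qp qm γ)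

/-- The function of two vertices that is multiplicative along chains and whose value at a pair
of neighbours `u ∼ v` is `Ap` if `u ∈ V₊` and `Am` if `u ∈ V₋`: along a chain with `n` edges the
two factors alternate, starting with that of `u`. -/
def multiplicative (G : SimpleGraph V) (v₀ : V) (Ap Am : ℂ) (u v : V) : ℂ :=
  open Classical in
  if Even (G.dist v₀ u) then Ap ^ ((G.dist u v + 1) / 2) * Am ^ (G.dist u v / 2)
  else Am ^ ((G.dist u v + 1) / 2) * Ap ^ (G.dist u v / 2)

/-- The generalized hitting probability `F(u, v | γ)`. -/
def F (G : SimpleGraph V) (v₀ : V) (qp qm : ℕ) (γ : ℂ) (u v : V) : ℂ :=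
  multiplicative G v₀ (Fplus qp qm γ) (Fminus qp qm γ) u v

/-- Its other determination. -/
def Ftilde (G : SimpleGraph V) (v₀ : V) (qp qm : ℕ) (γ : ℂ) (u v : V) : ℂ :=
  multiplicative G v₀ (FtildePlus qp qm γ) (FtildeMinus qp qm γ) u v

/-! ### The boundary -/

/-- A ray: a one-sided infinite chain of consecutive neighbours without backtracking. -/
structure Ray (G : SimpleGraph V) where
  toFun : ℕ → V
  adj : ∀ n, G.Adj (toFun n) (toFun (n + 1))
  no_backtrack : ∀ n, toFun n ≠ toFun (n + 2)

/-- Two rays are equivalent if they merge after finitely many steps and coincide thereafter. -/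
def raySetoid (G : SimpleGraph V) : Setoid (Ray G) where
  r x y := ∃ m n, ∀ k, x.toFun (m + k) = y.toFun (n + k)
  iseqv :=
    { refl := fun _ => ⟨0, 0, fun _ => rfl⟩
      symm := fun ⟨m, n, h⟩ => ⟨n, m, fun k => (h k).symm⟩
      trans := fun {x y z} ⟨m, n, h⟩ ⟨m', n', h'⟩ => ⟨m + m', n' + n, fun k => by
        rw [add_assoc, h, add_assoc, ← h']
        congr 1
        omega⟩ }

/-- The boundary `Ω` of the tree: the set of equivalence classes of rays. -/
def Boundary (G : SimpleGraph V) : Type _ := Quotient (raySetoid G)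

/-- `[u, ω)`: the set of vertices of the rays that start at `u` and represent `ω`. -/
def geodesic (G : SimpleGraph V) (u : V) (ω : Boundary G) : Set V :=
  {j | ∃ x : Ray G, x.toFun 0 = u ∧ (Quotient.mk (raySetoid G) x : Boundary G) = ω ∧
    ∃ n, x.toFun n = j}

/-- The boundary arc `Ω(u, v)`. -/
def arc (G : SimpleGraph V) (u v : V) : Set (Boundary G) := {ω | v ∈ geodesic G u ω}

instance (G : SimpleGraph V) : TopologicalSpace (Boundary G) :=
  TopologicalSpace.generateFrom {A | ∃ u v, A = arc G u v}

instance (G : SimpleGraph V) : MeasurableSpace (Boundary G) := borel _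

instance (G : SimpleGraph V) : BorelSpace (Boundary G) := ⟨rfl⟩

/-- `ν` is the equidistributed boundary measure with respect to `v₀`. -/
def IsEquidistributed (G : SimpleGraph V) (v₀ : V) (ν : MeasureTheory.Measure (Boundary G)) :
    Prop :=
  ∀ v, ν (arc G v₀ v) = ((Set.ncard {w | G.dist v₀ w = G.dist v₀ v} : ℕ) : ℝ≥0∞)⁻¹

/-- A distribution on `Ω`: a finitely additive complex measure on the algebra of the clopen
sets (the finite disjoint unions of boundary arcs). -/
structure Distribution (G : SimpleGraph V) where
  toFun : TopologicalSpace.Clopens (Boundary G) → ℂ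
  add : ∀ A B, Disjoint A B → toFun (A ⊔ B) = toFun A + toFun B

open Classical in
/-- The integral of a locally constant function with finitely many values against a
distribution: the sum, over the values `c`, of `c` times the mass of `{f = c}`. -/
def Distribution.integral {G : SimpleGraph V} (μ : Distribution G) (f : Boundary G → ℂ) : ℂ :=
  ∑ᶠ c : ℂ, if h : IsClopen (f ⁻¹' {c}) then c * μ.toFun ⟨f ⁻¹' {c}, h⟩ else 0

/-! ### The kernels -/

/-- The kernel `A(v, j) / A(v₀, j)`, where `j` is any vertex of `[v, ω) ∩ [v₀, ω)`. -/
def quotientKernel (G : SimpleGraph V) (v₀ : V) (A : V → V → ℂ) (v : V) (ω : Boundary G) : ℂ :=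
  haveI : Nonempty V := ⟨v₀⟩
  A v (Classical.epsilon fun j => j ∈ geodesic G v ω ∩ geodesic G v₀ ω) /
    A v₀ (Classical.epsilon fun j => j ∈ geodesic G v ω ∩ geodesic G v₀ ω)

/-- The generalized Poisson kernel `P(v, v₀, ω | γ)`. -/
def poisson (G : SimpleGraph V) (v₀ : V) (qp qm : ℕ) (γ : ℂ) (v : V) (ω : Boundary G) : ℂ :=
  quotientKernel G v₀ (F G v₀ qp qm γ) v ω

/-- The alternative generalized Poisson kernel. -/
def poissonTilde (G : SimpleGraph V) (v₀ : V) (qp qm : ℕ) (γ : ℂ) (v : V) (ω : Boundary G) : ℂ :=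
  quotientKernel G v₀ (Ftilde G v₀ qp qm γ) v ω

/-- `K` is the quotient kernel of `A`: `[v, ω)` and `[v₀, ω)` always meet, and
`K(v, ω) = A(v, j) / A(v₀, j)` with a non-zero denominator, whichever common vertex `j` is used.
Moreover `K(v, ·)` is locally constant with finitely many values, so that it can be integrated
against distributions. -/
structure IsWellDefinedKernel (G : SimpleGraph V) (v₀ : V) (A : V → V → ℂ)
    (K : V → Boundary G → ℂ) : Prop where
  meet : ∀ v ω, (geodesic G v ω ∩ geodesic G v₀ ω).Nonempty
  quotient : ∀ v ω, ∀ j ∈ geodesic G v ω ∩ geodesic G v₀ ω,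
    A v₀ j ≠ 0 ∧ K v ω = A v j / A v₀ j
  locallyConstant : ∀ v, IsLocallyConstant (K v)
  finite_range : ∀ v, (Set.range (K v)).Finite

end SemihomTree

end

/-!
Let `A` be multiplicative along chains, with non-zero one-step factors `A⁺`, `A⁻`, and let
`K(v, ω) = A(v, j) / A(v₀, j)` be its quotient kernel. The two geodesics to `ω` from `v` and from
the next vertex `v'` of `[v, ω)` merge, so `K(v, ω) = A^± K(v', ω)`, the sign being that of the
class of `v` (`quotientKernel_step`). One neighbour of `v` is the next vertex `v'`, and for each of
the `q_±` others the next vertex is `v`. Hence `K(·, ω)` is a `γ`-eigenfunction if and only if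
`(q₊ + 1) γ A⁺ = 1 + q₊ A⁺ A⁻` and `(q₋ + 1) γ A⁻ = 1 + q₋ A⁺ A⁻` (`IsHittingPair`,
`isEigenfunction_quotientKernel`, `isHittingPair_of_isEigenfunction`). Eliminating one unknown
leaves a quadratic equation, whose two solutions are `(F⁺, F⁻)` and `(F̃⁺, F̃⁻)`
(`IsHittingPair.eq_or_eq`). For fixed `v` the kernel depends only on the place where `[v, ω)` and
`[v₀, ω)` merge, which gives the local constancy and, by finite additivity, the eigenfunction
property of the integrals against distributions (`isEigenfunction_integral`).

The products `X = F⁺ F⁻` and `X̃ = F̃⁺ F̃⁻` satisfy `q₊ q₋ X X̃ = 1`. The principal square root in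
`R(γ)` has non-negative real part, which gives `|X| ≤ |X̃|` and thus `q₊ q₋ |X|² ≤ 1`
(`norm_FF_sq_le_one`). The sphere of radius `2n` has of the order of `(q₊ q₋)ⁿ` vertices, so
`F(·, v | γ)` is square-summable if `q₊ q₋ |X|² < 1`. In the case of equality its truncations to
large balls, and for `γ = 0` those of an explicit radial solution of `μ₁ f = 0`, are approximate
eigenvectors, because the error is of smaller order than the norm; so such `γ` belong to the
spectrum (`mem_spectrumL2_of_radial`, `norm_FF_sq_lt_one_of_notMem`). For `γ ∉ σ` therefore
`F(·, v | γ)` lies in `ℓ²` and `(γ - μ₁) F(·, v | γ)` is a multiple of the indicator of `v`: the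
Green kernel is a multiple of `F(·, v | γ)` (`green_eq`). For `|γ| > ρ` the series
`∑ f⁽ⁿ⁾(u, v) γ⁻ⁿ` satisfies the same equation off `v` and has the same value at `v`, and the two
coincide, as a square-summable solution that vanishes at `v` is zero (`eq_zero_of_laplacian_eq`,
`hasSum_firstVisit`).

The measure `ν_{v₀}` is the law of the end reached by choosing, independently and uniformly at
every vertex, a child (`exists_isEquidistributed`); it is unique since the arcs `Ω(v₀, v)` form a
π-system generating the Borel sets. A radial eigenfunction is determined, sphere after sphere, by
its value at `v₀`; the integrals of the two kernels are radial eigenfunctions with value `1` at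
`v₀`, and so coincide (`IsSphericalFunction.unique`, `isSphericalFunction_integral`).

For real `γ > ρ` one has `0 < F^± < F̃^±`. On a branch `{v | j ∈ [v, ω)}` the kernel
`P(·, v₀, ω | γ)` is a multiple of `F(·, j | γ)`. An eigenfunction `h` with `0 ≤ h ≤ P` is
therefore square-summable there, and uniqueness in `ℓ²` gives `h = h(j) F(·, j | γ)` on the branch;
since any vertex lies in a common branch with `v₀`, it is a multiple of `P`
(`eq_mul_of_le_quotientKernel`). The kernel `P̃` is not minimal: it dominates an explicit positive
eigenfunction, which is glued from `P̃` and the functions `F(·, j | γ)` for `j = v₀` and a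
neighbour `j` of `v₀` (`not_isMinimalEigenfunction_quotientKernel`). Finally, for `q₊ = q₋ = q` and
`γ = (q^z + q^{1 - z}) / (q + 1)` the two solutions are `q^{-z}` and `q^{z - 1}`; the condition
`Re z > 1/2` says that `q^{-z}` is the smaller one, so `F^± = q^{-z} = F^±(1)^z`
(`exists_cpow_and_forall`).
-/

/-! ### Distances and rays in a tree -/

namespace SemihomTree

variable {V : Type*} {G : SimpleGraph V}

theorem dist_adj_cases (hG : G.IsTree) {v w : V} (h : G.Adj v w) (j : V) :
    G.dist v j = G.dist w j + 1 ∨ G.dist w j = G.dist v j + 1 := by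
  simpa [G.dist_comm] using hG.dist_eq_dist_add_one_of_adj j h

theorem even_dist_adj (hG : G.IsTree) {v w : V} (h : G.Adj v w) (j : V) :
    Even (G.dist j w) ↔ ¬ Even (G.dist j v) := by
  rcases hG.dist_eq_dist_add_one_of_adj j h with h | h <;> rw [h] <;> simp [Nat.even_add_one]

theorem exists_adj_dist_eq_add_one (hG : G.IsTree) {v j : V} (h : v ≠ j) :
    ∃ w, G.Adj v w ∧ G.dist v j = G.dist w j + 1 := by
  obtain ⟨p, hp⟩ := hG.connected.exists_walk_length_eq_dist v j
  cases p with
  | nil => exact absurd rfl h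
  | cons hadj q =>
    refine ⟨_, hadj, ?_⟩
    have h1 := SimpleGraph.dist_le q
    rw [SimpleGraph.Walk.length_cons] at hp
    rcases dist_adj_cases hG hadj j with h2 | h2 <;> omega

/-- In a tree a vertex has at most one neighbour that is closer to a given vertex. -/
theorem eq_of_adj_of_dist_eq_add_one (hG : G.IsTree) {v w w' j : V} (h : G.Adj v w)
    (h' : G.Adj v w') (hd : G.dist v j = G.dist w j + 1) (hd' : G.dist v j = G.dist w' j + 1) :
    w = w' := by
  obtain ⟨p, hp⟩ := hG.connected.exists_walk_length_eq_dist w j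
  obtain ⟨p', hp'⟩ := hG.connected.exists_walk_length_eq_dist w' j
  have h1 : (SimpleGraph.Walk.cons h p).IsPath :=
    SimpleGraph.Walk.isPath_of_length_eq_dist _ (by simp [hp, hd])
  have h2 : (SimpleGraph.Walk.cons h' p').IsPath :=
    SimpleGraph.Walk.isPath_of_length_eq_dist _ (by simp [hp', hd'])
  have := (hG.isAcyclic.subsingleton_path v j).elim ⟨_, h1⟩ ⟨_, h2⟩
  simp only [Subtype.mk.injEq, SimpleGraph.Walk.cons.injEq] at this
  exact this.1

namespace Ray

/-- The ray obtained by deleting the first `m` vertices. -/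
def drop (x : Ray G) (m : ℕ) : Ray G where
  toFun n := x.toFun (m + n)
  adj n := x.adj (m + n)
  no_backtrack n := x.no_backtrack (m + n)

/-- The ray obtained by adding a vertex in front. -/
def cons (x : Ray G) (u : V) (h : G.Adj u (x.toFun 0)) (h' : u ≠ x.toFun 1) : Ray G where
  toFun n := Nat.casesOn n u x.toFun
  adj n := by cases n with
    | zero => exact h
    | succ n => exact x.adj n
  no_backtrack n := by cases n with
    | zero => exact h'
    | succ n => exact x.no_backtrack n

theorem mk_drop (x : Ray G) (m : ℕ) :
    (Quotient.mk (raySetoid G) (x.drop m) : Boundary G) = Quotient.mk (raySetoid G) x :=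
  Quotient.sound ⟨0, m, fun k => by simp [drop]⟩

theorem mk_cons (x : Ray G) (u : V) (h : G.Adj u (x.toFun 0)) (h' : u ≠ x.toFun 1) :
    (Quotient.mk (raySetoid G) (x.cons u h h') : Boundary G) = Quotient.mk (raySetoid G) x :=
  Quotient.sound ⟨1, 0, fun k => by simp [cons, add_comm 1 k]⟩

theorem dist_toFun_zero (hG : G.IsTree) (x : Ray G) (n : ℕ) :
    G.dist (x.toFun n) (x.toFun 0) = n := by
  induction n using Nat.strong_induction_on with
  | _ n ih =>
    match n, ih with
    | 0, _ => simp
    | 1, _ => simpa using (x.adj 0).symm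
    | n + 2, ih =>
      have h0 := ih n (by omega)
      have h1 := ih (n + 1) (by omega)
      rcases dist_adj_cases hG (x.adj (n + 1)) (x.toFun 0) with h | h
      · -- otherwise the vertex `n + 1` has two neighbours that are closer to the origin
        exact absurd (eq_of_adj_of_dist_eq_add_one hG (x.adj n).symm (x.adj (n + 1))
          (by omega) h) (x.no_backtrack n)
      · have : G.dist (x.toFun (n + 2)) (x.toFun 0) = G.dist (x.toFun (n + 1)) (x.toFun 0) + 1 := h
        omega

theorem toFun_eq_of_le (hG : G.IsTree) (x y : Ray G) (h0 : x.toFun 0 = y.toFun 0) {n : ℕ}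
    (hn : x.toFun n = y.toFun n) : ∀ k ≤ n, x.toFun k = y.toFun k := by
  induction n with
  | zero => intro k hk; obtain rfl : k = 0 := by omega
            exact h0
  | succ n ih =>
    have : x.toFun n = y.toFun n := by
      refine eq_of_adj_of_dist_eq_add_one hG (x.adj n).symm (hn ▸ (y.adj n).symm)
        (j := x.toFun 0) ?_ ?_
      · rw [dist_toFun_zero hG, dist_toFun_zero hG]
      · rw [dist_toFun_zero hG, h0, dist_toFun_zero hG]
    intro k hk
    rcases Nat.lt_or_ge k (n + 1) with h | h
    · exact ih this k (by omega)
    · obtain rfl : k = n + 1 := by omega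
      exact hn

theorem toFun_eq_of_equiv (hG : G.IsTree) (x y : Ray G) (h0 : x.toFun 0 = y.toFun 0)
    (h : (Quotient.mk (raySetoid G) x : Boundary G) = Quotient.mk (raySetoid G) y) :
    x.toFun = y.toFun := by
  obtain ⟨m, n, hmn⟩ := Quotient.exact h
  have hd : ∀ k, m + k = n + k := fun k => by
    rw [← dist_toFun_zero hG x (m + k), hmn k, h0, dist_toFun_zero hG y]
  obtain rfl : m = n := by simpa using hd 0
  funext k
  exact toFun_eq_of_le hG x y h0 (hmn k) k (by omega)

end Ray

/-- Every boundary point is represented by a ray from any given vertex. -/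
theorem exists_ray_from (hG : G.IsTree) (u : V) (ω : Boundary G) :
    ∃ x : Ray G, x.toFun 0 = u ∧ (Quotient.mk (raySetoid G) x : Boundary G) = ω := by
  induction ω using Quotient.inductionOn with
  | _ x =>
  obtain ⟨p⟩ := hG.connected.preconnected u (x.toFun 0)
  generalize hw : x.toFun 0 = w at p
  induction p with
  | nil => exact ⟨x, hw, rfl⟩
  | @cons u v w h p ih =>
    obtain ⟨y, hy0, hy⟩ := ih hw
    by_cases h1 : u = y.toFun 1
    · exact ⟨y.drop 1, by simp [Ray.drop, h1], by rw [Ray.mk_drop, hy]⟩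
    · exact ⟨y.cons u (hy0 ▸ h) h1, rfl, by rw [Ray.mk_cons, hy]⟩

/-- The `n`-th vertex of the ray from `u` to `ω`. -/
noncomputable def pt (hG : G.IsTree) (u : V) (ω : Boundary G) (n : ℕ) : V :=
  (exists_ray_from hG u ω).choose.toFun n

section pt

variable (hG : G.IsTree) (u v w : V) (ω ω' : Boundary G)

theorem pt_eq_of_ray {x : Ray G} (h : (Quotient.mk (raySetoid G) x : Boundary G) = ω) :
    pt hG (x.toFun 0) ω = x.toFun := by
  have := (exists_ray_from hG (x.toFun 0) ω).choose_spec
  exact Ray.toFun_eq_of_equiv hG _ _ this.1 (this.2.trans h.symm)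

theorem pt_zero : pt hG u ω 0 = u := (exists_ray_from hG u ω).choose_spec.1

theorem pt_adj (n : ℕ) : G.Adj (pt hG u ω n) (pt hG u ω (n + 1)) :=
  (exists_ray_from hG u ω).choose.adj n

theorem adj_pt_one : G.Adj u (pt hG u ω 1) := by
  simpa [pt_zero] using pt_adj hG u ω 0

theorem dist_pt (n : ℕ) : G.dist u (pt hG u ω n) = n := by
  have h := Ray.dist_toFun_zero hG (exists_ray_from hG u ω).choose n
  rwa [(exists_ray_from hG u ω).choose_spec.1, G.dist_comm] at h

theorem pt_add (m n : ℕ) : pt hG u ω (m + n) = pt hG (pt hG u ω m) ω n := by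
  have h := pt_eq_of_ray hG ω (x := (exists_ray_from hG u ω).choose.drop m)
    (by rw [Ray.mk_drop, (exists_ray_from hG u ω).choose_spec.2])
  exact (congrFun h n).symm

theorem pt_succ (n : ℕ) : pt hG u ω (n + 1) = pt hG (pt hG u ω 1) ω n := by
  rw [add_comm, pt_add]

theorem mem_geodesic_iff {j : V} : j ∈ geodesic G u ω ↔ ∃ n, pt hG u ω n = j := by
  constructor
  · rintro ⟨x, rfl, h, n, rfl⟩
    exact ⟨n, by rw [pt_eq_of_ray hG ω h]⟩
  · rintro ⟨n, rfl⟩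
    have h := (exists_ray_from hG u ω).choose_spec
    exact ⟨_, h.1, h.2, n, rfl⟩

theorem pt_mem_geodesic (n : ℕ) : pt hG u ω n ∈ geodesic G u ω :=
  (mem_geodesic_iff hG u ω).2 ⟨n, rfl⟩

theorem mem_geodesic_iff_pt_dist {j : V} : j ∈ geodesic G u ω ↔ pt hG u ω (G.dist u j) = j := by
  rw [mem_geodesic_iff hG]
  constructor
  · rintro ⟨n, rfl⟩
    rw [dist_pt]
  · exact fun h => ⟨_, h⟩

theorem pt_eq_of_le {u ω ω'} {n : ℕ} (h : pt hG u ω n = pt hG u ω' n) :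
    ∀ k ≤ n, pt hG u ω k = pt hG u ω' k :=
  Ray.toFun_eq_of_le hG _ _ ((pt_zero hG u ω).trans (pt_zero hG u ω').symm) h

/-- Of two neighbours, one is the next vertex after the other on its ray to `ω`. -/
theorem pt_one_of_adj {v w : V} (h : G.Adj v w) : pt hG v ω 1 = w ∨ pt hG w ω 1 = v := by
  by_cases h1 : pt hG v ω 1 = w
  · exact Or.inl h1
  · right
    obtain ⟨x, hx0, hx⟩ := exists_ray_from hG v ω
    have hx1 : x.toFun 1 ≠ w := by
      rw [← pt_eq_of_ray hG ω hx, hx0]; exact h1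
    have := pt_eq_of_ray hG ω (x := x.cons w (hx0 ▸ h.symm) hx1.symm) (by rw [Ray.mk_cons, hx])
    have h2 := congrFun this 1
    simpa [Ray.cons, hx0] using h2

/-- The ray from `v` to `ω` passes through all vertices of the ray from `u` to `ω` whose distance
from `u` is at least `d(u, v)`. -/
theorem pt_meet {n : ℕ} (hn : G.dist u v ≤ n) : ∃ m, pt hG v ω m = pt hG u ω n := by
  generalize hd : G.dist u v = d at hn
  induction d generalizing v with
  | zero =>
    rw [hG.connected.dist_eq_zero_iff] at hd
    exact ⟨n, by rw [hd]⟩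
  | succ d ih =>
    have hne : v ≠ u := by rintro rfl; simp at hd
    obtain ⟨w, hvw, hw⟩ := exists_adj_dist_eq_add_one hG hne
    rw [G.dist_comm, hd, G.dist_comm] at hw
    have hw' : G.dist u w = d := by omega
    obtain ⟨m, hm⟩ := ih w hw' (by omega)
    rcases pt_one_of_adj hG ω hvw with h | h
    · exact ⟨m + 1, by rw [pt_succ, h, hm]⟩
    · cases m with
      | zero =>
        rw [pt_zero] at hm
        have := dist_pt hG u ω n
        rw [← hm] at this
        omega
      | succ m => exact ⟨m, by rw [← hm, pt_succ, h]⟩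

theorem geodesic_inter_nonempty (hG : G.IsTree) (u v : V) (ω : Boundary G) :
    (geodesic G v ω ∩ geodesic G u ω).Nonempty := by
  obtain ⟨m, hm⟩ := pt_meet hG u v ω le_rfl
  exact ⟨_, hm ▸ pt_mem_geodesic hG v ω m, pt_mem_geodesic hG u ω _⟩

/-- The branch `{v | j ∈ [v, ω)}` contains the neighbours of each of its vertices
other than `j`. -/
theorem mem_geodesic_of_adj (hG : G.IsTree) {ω : Boundary G} {j v w : V} (h : G.Adj v w)
    (hv : j ∈ geodesic G v ω) (hne : v ≠ j) : j ∈ geodesic G w ω := by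
  rw [mem_geodesic_iff hG] at hv ⊢
  obtain ⟨n, hn⟩ := hv
  rcases pt_one_of_adj hG ω h with h | h
  · cases n with
    | zero => rw [pt_zero] at hn; exact absurd hn hne
    | succ n => exact ⟨n, by rw [← hn, pt_succ, h]⟩
  · exact ⟨n + 1, by rw [pt_succ, h, hn]⟩

/-- Boundary points with the same distant vertex on their rays from `v₀` lie in the same arcs
`Ω(u, v)`. -/
theorem mem_arc_of_pt_eq (hG : G.IsTree) {v₀ u v : V} {ω ω' : Boundary G}
    (h : pt hG v₀ ω (G.dist v₀ u + G.dist u v) = pt hG v₀ ω' (G.dist v₀ u + G.dist u v))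
    (hω : ω ∈ arc G u v) : ω' ∈ arc G u v := by
  obtain ⟨m, hm⟩ := pt_meet hG v₀ u ω (n := G.dist v₀ u + G.dist u v) (by omega)
  obtain ⟨m', hm'⟩ := pt_meet hG v₀ u ω' (n := G.dist v₀ u + G.dist u v) (by omega)
  have e : m = m' := by rw [← dist_pt hG u ω m, hm, h, ← hm', dist_pt]
  subst e
  have hle : G.dist u v ≤ m := by
    have h1 := dist_pt hG u ω m
    have h2 := dist_pt hG v₀ ω (G.dist v₀ u + G.dist u v)
    rw [hm] at h1
    have h3 := hG.connected.dist_triangle (u := v₀) (v := u)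
      (w := pt hG v₀ ω (G.dist v₀ u + G.dist u v))
    omega
  change v ∈ geodesic G u ω'
  change v ∈ geodesic G u ω at hω
  rw [mem_geodesic_iff_pt_dist hG] at hω ⊢
  rw [← pt_eq_of_le hG (hm.trans (h.trans hm'.symm)) _ hle, hω]

theorem preimage_pt_singleton (v₀ w : V) (n : ℕ) :
    (fun ω => pt hG v₀ ω n) ⁻¹' {w} = if G.dist v₀ w = n then arc G v₀ w else ∅ := by
  ext ω
  split_ifs with h
  · change pt hG v₀ ω n = w ↔ w ∈ geodesic G v₀ ω
    rw [mem_geodesic_iff_pt_dist hG, h]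
  · simp only [Set.mem_preimage, Set.mem_singleton_iff, Set.mem_empty_iff_false, iff_false]
    rintro rfl
    exact h (dist_pt hG v₀ ω n)

theorem isLocallyConstant_pt (v₀ : V) (n : ℕ) :
    IsLocallyConstant fun ω : Boundary G => pt hG v₀ ω n := by
  rw [IsLocallyConstant.iff_isOpen_fiber]
  intro w
  rw [preimage_pt_singleton]
  split_ifs
  · exact TopologicalSpace.isOpen_generateFrom_of_mem ⟨_, _, rfl⟩
  · exact isOpen_empty

end pt

theorem finite_sphere [G.LocallyFinite] (hG : G.IsTree) (v₀ : V) (n : ℕ) :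
    {w | G.dist v₀ w = n}.Finite := by
  induction n with
  | zero =>
    refine (Set.finite_singleton v₀).subset fun w hw => ?_
    exact (hG.connected.dist_eq_zero_iff.1 hw).symm
  | succ n ih =>
    refine (ih.biUnion fun v _ => (G.neighborFinset v).finite_toSet).subset fun w hw => ?_
    have hw' : G.dist v₀ w = n + 1 := hw
    have hne : w ≠ v₀ := by rintro rfl; simp at hw'
    obtain ⟨v, hwv, hv⟩ := exists_adj_dist_eq_add_one hG hne
    rw [G.dist_comm, hw', G.dist_comm] at hv
    simp only [Set.mem_iUnion]
    exact ⟨v, show G.dist v₀ v = n by omega, by simpa using hwv.symm⟩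

theorem finite_range_pt [G.LocallyFinite] (hG : G.IsTree) (v₀ : V) (n : ℕ) :
    (Set.range fun ω : Boundary G => pt hG v₀ ω n).Finite :=
  (finite_sphere hG v₀ n).subset (by rintro _ ⟨ω, rfl⟩; exact dist_pt hG v₀ ω n)

theorem countable_vertices [G.LocallyFinite] (hG : G.IsTree) : Countable V := by
  rcases isEmpty_or_nonempty V with h | ⟨⟨v₀⟩⟩
  · infer_instance
  · rw [← Set.countable_univ_iff]
    have : (Set.univ : Set V) = ⋃ n, {w | G.dist v₀ w = n} := by ext; simp
    rw [this]
    exact Set.countable_iUnion fun n => (finite_sphere hG v₀ n).countable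

end SemihomTree

/-! ### Multiplicative functions of two vertices and their quotient kernels -/

namespace SemihomTree

variable {V : Type*} {G : SimpleGraph V}

/-- The function with value `a` on the class `V₊` and `b` on the class `V₋`. -/
noncomputable def classValue {R : Type*} (G : SimpleGraph V) (v₀ : V) (a b : R) (v : V) : R :=
  if Even (G.dist v₀ v) then a else b

theorem classValue_base {R : Type*} (v₀ : V) (a b : R) : classValue G v₀ a b v₀ = a := by
  simp [classValue]

theorem classValue_adj {R : Type*} (hG : G.IsTree) {v₀ v w : V} (h : G.Adj v w) (a b : R) :
    classValue G v₀ a b w = classValue G v₀ b a v := by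
  simp only [classValue, even_dist_adj hG h v₀]
  split_ifs <;> rfl

theorem classValue_mul_adj {R : Type*} [CommSemiring R] (hG : G.IsTree) {v₀ v w : V}
    (h : G.Adj v w) (a b : R) : classValue G v₀ a b v * classValue G v₀ a b w = a * b := by
  rw [classValue_adj hG h]
  unfold classValue
  split_ifs
  · rfl
  · exact mul_comm _ _

theorem classValue_cases {R : Type*} {p : R → Prop} {a b : R} (ha : p a) (hb : p b) (v₀ v : V) :
    p (classValue G v₀ a b v) := by
  unfold classValue; split_ifs <;> assumption

section multiplicative

variable (v₀ : V) (Ap Am : ℂ)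

theorem multiplicative_self (v : V) : multiplicative G v₀ Ap Am v v = 1 := by
  simp [multiplicative]

theorem multiplicative_of_dist_eq_add_one (hG : G.IsTree) {v w j : V} (h : G.Adj v w)
    (hd : G.dist v j = G.dist w j + 1) :
    multiplicative G v₀ Ap Am v j =
      classValue G v₀ Ap Am v * multiplicative G v₀ Ap Am w j := by
  have h1 : (G.dist v j + 1) / 2 = G.dist w j / 2 + 1 := by omega
  have h2 : G.dist v j / 2 = (G.dist w j + 1) / 2 := by omega
  simp only [multiplicative, classValue, even_dist_adj hG h v₀, h1, h2]
  split_ifs <;> ring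

theorem multiplicative_adj (hG : G.IsTree) {v w : V} (h : G.Adj v w) :
    multiplicative G v₀ Ap Am v w = classValue G v₀ Ap Am v := by
  rw [multiplicative_of_dist_eq_add_one v₀ Ap Am hG h (by simpa using h), multiplicative_self,
    mul_one]

variable {Ap Am}

theorem multiplicative_ne_zero (hp : Ap ≠ 0) (hm : Am ≠ 0) (u v : V) :
    multiplicative G v₀ Ap Am u v ≠ 0 := by
  unfold multiplicative; split_ifs <;> positivity

variable (Ap Am)

theorem multiplicative_pt_add (hG : G.IsTree) (v : V) (ω : Boundary G) (m k : ℕ) :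
    multiplicative G v₀ Ap Am v (pt hG v ω (m + k)) =
      multiplicative G v₀ Ap Am v (pt hG v ω m) *
        multiplicative G v₀ Ap Am (pt hG v ω m) (pt hG v ω (m + k)) := by
  induction m generalizing v with
  | zero => simp [pt_zero, multiplicative_self]
  | succ m ih =>
    have hstep : ∀ n, multiplicative G v₀ Ap Am v (pt hG v ω (n + 1)) =
        classValue G v₀ Ap Am v *
          multiplicative G v₀ Ap Am (pt hG v ω 1) (pt hG (pt hG v ω 1) ω n) := fun n => by
      rw [multiplicative_of_dist_eq_add_one v₀ Ap Am hG (adj_pt_one hG v ω)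
        (j := pt hG v ω (n + 1)) (by rw [dist_pt, pt_succ hG v ω n, dist_pt]), pt_succ hG v ω n]
    rw [show m + 1 + k = (m + k) + 1 by ring, hstep, hstep, ih, pt_succ hG v ω m,
      pt_succ hG v ω (m + k), mul_assoc]

variable {Ap Am}

theorem quotientKernel_eq (hG : G.IsTree) (hp : Ap ≠ 0) (hm : Am ≠ 0) {v : V} {ω : Boundary G}
    {j : V} (hj : j ∈ geodesic G v ω ∩ geodesic G v₀ ω) :
    quotientKernel G v₀ (multiplicative G v₀ Ap Am) v ω =
      multiplicative G v₀ Ap Am v j / multiplicative G v₀ Ap Am v₀ j := by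
  have : Nonempty V := ⟨v₀⟩
  have hne := multiplicative_ne_zero (G := G) v₀ hp hm
  -- two common vertices of the two rays cut off segments of the same length from both
  have key : ∀ m n k j', pt hG v ω m = pt hG v₀ ω n → pt hG v ω (m + k) = j' →
      j' ∈ geodesic G v₀ ω →
      multiplicative G v₀ Ap Am v j' / multiplicative G v₀ Ap Am v₀ j' =
      multiplicative G v₀ Ap Am v (pt hG v ω m) /
        multiplicative G v₀ Ap Am v₀ (pt hG v ω m) := by
    intro m n k j' hmn hj' hj0
    have h1 : pt hG v₀ ω (n + k) = j' := by rw [pt_add, ← hmn, ← pt_add, hj']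
    have e1 := multiplicative_pt_add v₀ Ap Am hG v ω m k
    have e2 := multiplicative_pt_add v₀ Ap Am hG v₀ ω n k
    rw [h1, ← hmn] at e2
    rw [hj'] at e1
    rw [e1, e2, mul_div_mul_right _ _ (hne _ _)]
  have indep : ∀ j j', j ∈ geodesic G v ω ∩ geodesic G v₀ ω →
      j' ∈ geodesic G v ω ∩ geodesic G v₀ ω →
      multiplicative G v₀ Ap Am v j' / multiplicative G v₀ Ap Am v₀ j' =
      multiplicative G v₀ Ap Am v j / multiplicative G v₀ Ap Am v₀ j := by
    rintro j j' ⟨h1, h2⟩ ⟨h1', h2'⟩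
    obtain ⟨m, hm⟩ := (mem_geodesic_iff hG _ _).1 h1
    obtain ⟨n, hn⟩ := (mem_geodesic_iff hG _ _).1 h2
    obtain ⟨m', hm'⟩ := (mem_geodesic_iff hG _ _).1 h1'
    obtain ⟨n', hn'⟩ := (mem_geodesic_iff hG _ _).1 h2'
    rcases le_total m m' with h | h <;> obtain ⟨k, rfl⟩ := Nat.exists_eq_add_of_le h
    · have := key m n k j' (hm.trans hn.symm) hm' h2'
      rwa [hm] at this
    · have := key m' n' k j (hm'.trans hn'.symm) hm h2
      rw [hm'] at this
      exact this.symm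
  exact indep _ _ hj (Classical.epsilon_spec (p := fun j => j ∈ geodesic G v ω ∩ geodesic G v₀ ω)
    ⟨j, hj⟩)

theorem quotientKernel_base (hG : G.IsTree) (hp : Ap ≠ 0) (hm : Am ≠ 0) (ω : Boundary G) :
    quotientKernel G v₀ (multiplicative G v₀ Ap Am) v₀ ω = 1 := by
  have h : v₀ ∈ geodesic G v₀ ω := (mem_geodesic_iff hG _ _).2 ⟨0, pt_zero hG _ _⟩
  rw [quotientKernel_eq v₀ hG hp hm ⟨h, h⟩, multiplicative_self, div_one]

/-- Along each ray to `ω` the quotient kernel is multiplied by the factor of the class at every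
step. With the value `1` at `v₀` this determines the kernel. -/
theorem quotientKernel_step (hG : G.IsTree) (hp : Ap ≠ 0) (hm : Am ≠ 0) {v w : V}
    {ω : Boundary G} (h : pt hG v ω 1 = w) :
    quotientKernel G v₀ (multiplicative G v₀ Ap Am) v ω =
      classValue G v₀ Ap Am v * quotientKernel G v₀ (multiplicative G v₀ Ap Am) w ω := by
  subst h
  obtain ⟨j, hj, hj0⟩ := geodesic_inter_nonempty hG v₀ (pt hG v ω 1) ω
  obtain ⟨n, hn⟩ := (mem_geodesic_iff hG _ _).1 hj
  have hj' : j ∈ geodesic G v ω := (mem_geodesic_iff hG _ _).2 ⟨n + 1, by rw [pt_succ, hn]⟩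
  rw [quotientKernel_eq v₀ hG hp hm ⟨hj, hj0⟩, quotientKernel_eq v₀ hG hp hm ⟨hj', hj0⟩,
    multiplicative_of_dist_eq_add_one v₀ Ap Am hG (adj_pt_one hG v ω), mul_div_assoc]
  have h1 := dist_pt hG (pt hG v ω 1) ω n
  have h2 := dist_pt hG v ω (n + 1)
  rw [pt_succ, hn] at h2
  rw [hn] at h1
  omega

theorem quotientKernel_of_mem_geodesic (hG : G.IsTree) (hp : Ap ≠ 0) (hm : Am ≠ 0) {v j : V}
    {ω : Boundary G} (h : j ∈ geodesic G v ω) :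
    quotientKernel G v₀ (multiplicative G v₀ Ap Am) v ω =
      multiplicative G v₀ Ap Am v j * quotientKernel G v₀ (multiplicative G v₀ Ap Am) j ω := by
  obtain ⟨n, rfl⟩ := (mem_geodesic_iff hG _ _).1 h
  clear h
  induction n generalizing v with
  | zero => rw [pt_zero, multiplicative_self, one_mul]
  | succ n ih =>
    rw [quotientKernel_step v₀ hG hp hm rfl, ih, ← pt_succ, ← mul_assoc,
      ← multiplicative_of_dist_eq_add_one v₀ Ap Am hG (adj_pt_one hG v ω)]
    rw [dist_pt, pt_succ hG v ω n, dist_pt]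

theorem quotientKernel_ne_zero (hG : G.IsTree) (hp : Ap ≠ 0) (hm : Am ≠ 0) (v : V)
    (ω : Boundary G) : quotientKernel G v₀ (multiplicative G v₀ Ap Am) v ω ≠ 0 := by
  obtain ⟨j, hj⟩ := geodesic_inter_nonempty hG v₀ v ω
  rw [quotientKernel_eq v₀ hG hp hm hj]
  exact div_ne_zero (multiplicative_ne_zero v₀ hp hm _ _) (multiplicative_ne_zero v₀ hp hm _ _)

theorem quotientKernel_eq_comp_pt (hG : G.IsTree) (hp : Ap ≠ 0) (hm : Am ≠ 0) {v : V} {n : ℕ}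
    (hn : G.dist v₀ v ≤ n) (ω : Boundary G) :
    quotientKernel G v₀ (multiplicative G v₀ Ap Am) v ω =
      multiplicative G v₀ Ap Am v (pt hG v₀ ω n) /
        multiplicative G v₀ Ap Am v₀ (pt hG v₀ ω n) := by
  obtain ⟨m, hm'⟩ := pt_meet hG v₀ v ω hn
  exact quotientKernel_eq v₀ hG hp hm ⟨hm' ▸ pt_mem_geodesic hG v ω m, pt_mem_geodesic hG v₀ ω n⟩

theorem isWellDefinedKernel_quotientKernel [G.LocallyFinite] (hG : G.IsTree) (hp : Ap ≠ 0)
    (hm : Am ≠ 0) :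
    IsWellDefinedKernel G v₀ (multiplicative G v₀ Ap Am)
      (quotientKernel G v₀ (multiplicative G v₀ Ap Am)) where
  meet v ω := geodesic_inter_nonempty hG v₀ v ω
  quotient v ω j hj := ⟨multiplicative_ne_zero v₀ hp hm _ _, quotientKernel_eq v₀ hG hp hm hj⟩
  locallyConstant v := by
    rw [funext (quotientKernel_eq_comp_pt v₀ hG hp hm (v := v) le_rfl)]
    exact (isLocallyConstant_pt hG v₀ (G.dist v₀ v)).comp
      fun j => multiplicative G v₀ Ap Am v j / multiplicative G v₀ Ap Am v₀ j
  finite_range v := by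
    rw [funext (quotientKernel_eq_comp_pt v₀ hG hp hm (v := v) le_rfl)]
    exact (((finite_range_pt hG v₀ (G.dist v₀ v))).image
      fun j => multiplicative G v₀ Ap Am v j / multiplicative G v₀ Ap Am v₀ j).subset
      (by rintro _ ⟨ω, rfl⟩; exact ⟨_, ⟨ω, rfl⟩, rfl⟩)

end multiplicative

/-! ### Eigenfunctions -/

section eigen

variable [G.LocallyFinite] {v₀ : V} {qp qm : ℕ}

theorem IsSemihomogeneous.degree_eq (hT : IsSemihomogeneous G v₀ qp qm) (v : V) :
    G.degree v = classValue G v₀ qp qm v + 1 := by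
  unfold classValue
  split_ifs with h
  · exact hT.degree_even v h
  · exact hT.degree_odd v h

/-- The average of a function that takes the same value at all neighbours of `v` but one. -/
theorem IsSemihomogeneous.laplacian_eq (hT : IsSemihomogeneous G v₀ qp qm) {v w : V}
    (h : G.Adj v w) {f : V → ℂ} {y : ℂ} (hy : ∀ w', G.Adj v w' → w' ≠ w → f w' = y) :
    laplacian G f v = (((classValue G v₀ qp qm v : ℕ) : ℂ) + 1)⁻¹ *
      (f w + ((classValue G v₀ qp qm v : ℕ) : ℂ) * y) := by
  classical
  have hw : w ∈ G.neighborFinset v := by simpa using h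
  have hsum : ∑ u ∈ (G.neighborFinset v).erase w, f u
      = ((classValue G v₀ qp qm v : ℕ) : ℂ) * y := by
    rw [Finset.sum_congr rfl fun u hu => hy u (by simpa using (Finset.mem_erase.1 hu).2)
      (Finset.mem_erase.1 hu).1, Finset.sum_const, Finset.card_erase_of_mem hw,
      G.card_neighborFinset_eq_degree, hT.degree_eq, nsmul_eq_mul, Nat.add_sub_cancel]
  rw [laplacian, ← Finset.add_sum_erase _ _ hw, hsum, hT.degree_eq]
  push_cast
  rfl

/-- The relations obtained by conditioning the first visit to a neighbour on the first step of
the walk. -/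
structure IsHittingPair (qp qm : ℕ) (γ Ap Am : ℂ) : Prop where
  plus : γ * (qp + 1) * Ap = 1 + qp * (Ap * Am)
  minus : γ * (qm + 1) * Am = 1 + qm * (Ap * Am)

omit [G.LocallyFinite] in
theorem IsHittingPair.classValue {γ Ap Am : ℂ} (h : IsHittingPair qp qm γ Ap Am) (v : V) :
    γ * (((classValue G v₀ qp qm v : ℕ) : ℂ) + 1) * classValue G v₀ Ap Am v
      = 1 + ((classValue G v₀ qp qm v : ℕ) : ℂ) * (Ap * Am) := by
  unfold SemihomTree.classValue
  split_ifs
  · exact h.plus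
  · exact h.minus

/-- The common form of the eigenvalue equation for `A(·, j)` and for the quotient kernel: `w` is
the next vertex on the way from `v`, and `v` the next one on the way from its other neighbours. -/
theorem laplacian_of_step (hT : IsSemihomogeneous G v₀ qp qm) {γ Ap Am : ℂ}
    (h : IsHittingPair qp qm γ Ap Am) (hp : Ap ≠ 0) (hm : Am ≠ 0) {f : V → ℂ} {v w : V}
    (hvw : G.Adj v w) (hw : f v = classValue G v₀ Ap Am v * f w)
    (hy : ∀ w', G.Adj v w' → w' ≠ w → f w' = classValue G v₀ Ap Am w' * f v) :
    laplacian G f v = γ * f v := by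
  rw [hT.laplacian_eq hvw (y := classValue G v₀ Ap Am w * f v)]
  · have h1 := h.classValue (G := G) (v₀ := v₀) v
    have h2 := classValue_mul_adj hT.isTree (v₀ := v₀) hvw Ap Am
    have h3 : classValue G v₀ Ap Am v ≠ 0 := classValue_cases (p := (· ≠ 0)) hp hm v₀ v
    have h4 : ((classValue G v₀ qp qm v : ℕ) : ℂ) + 1 ≠ 0 := Nat.cast_add_one_ne_zero _
    rw [inv_mul_eq_iff_eq_mul₀ h4]
    rw [hw]
    linear_combination (-f w) * h1 +
      (((classValue G v₀ qp qm v : ℕ) : ℂ) * f w) * h2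
  · intro w' h' hne
    rw [hy w' h' hne, classValue_adj hT.isTree h', classValue_adj hT.isTree hvw]

theorem laplacian_multiplicative (hT : IsSemihomogeneous G v₀ qp qm) {γ Ap Am : ℂ}
    (h : IsHittingPair qp qm γ Ap Am) (hp : Ap ≠ 0) (hm : Am ≠ 0) {v j : V} (hne : v ≠ j) :
    laplacian G (fun u => multiplicative G v₀ Ap Am u j) v
      = γ * multiplicative G v₀ Ap Am v j := by
  obtain ⟨w, hvw, hd⟩ := exists_adj_dist_eq_add_one hT.isTree hne
  refine laplacian_of_step hT h hp hm (f := fun u => multiplicative G v₀ Ap Am u j) hvw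
    (multiplicative_of_dist_eq_add_one v₀ Ap Am hT.isTree hvw hd) fun w' h' hw' => ?_
  refine multiplicative_of_dist_eq_add_one v₀ Ap Am hT.isTree h'.symm ?_
  rcases dist_adj_cases hT.isTree h' j with h1 | h1
  · exact absurd (eq_of_adj_of_dist_eq_add_one hT.isTree h' hvw h1 hd) hw'
  · exact h1

theorem isEigenfunction_quotientKernel (hT : IsSemihomogeneous G v₀ qp qm) {γ Ap Am : ℂ}
    (h : IsHittingPair qp qm γ Ap Am) (hp : Ap ≠ 0) (hm : Am ≠ 0) (ω : Boundary G) :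
    IsEigenfunction G γ fun v => quotientKernel G v₀ (multiplicative G v₀ Ap Am) v ω := by
  intro v
  refine laplacian_of_step hT h hp hm
    (f := fun v => quotientKernel G v₀ (multiplicative G v₀ Ap Am) v ω)
    (adj_pt_one hT.isTree v ω) (quotientKernel_step v₀ hT.isTree hp hm rfl) fun w h' hw => ?_
  rcases pt_one_of_adj hT.isTree ω h' with h1 | h1
  · exact absurd h1.symm hw
  · exact quotientKernel_step v₀ hT.isTree hp hm h1

/-- Conversely, a quotient kernel consisting of eigenfunctions comes from a hitting pair. -/
theorem isHittingPair_of_isEigenfunction (hT : IsSemihomogeneous G v₀ qp qm) {γ Ap Am : ℂ}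
    (hp : Ap ≠ 0) (hm : Am ≠ 0) (ω : Boundary G)
    (h : IsEigenfunction G γ fun v => quotientKernel G v₀ (multiplicative G v₀ Ap Am) v ω) :
    IsHittingPair qp qm γ Ap Am := by
  have hG := hT.isTree
  have key : ∀ v, γ * (((classValue G v₀ qp qm v : ℕ) : ℂ) + 1) * classValue G v₀ Ap Am v
      = 1 + ((classValue G v₀ qp qm v : ℕ) : ℂ) * (Ap * Am) := by
    intro v
    have hv := h v
    have hw := adj_pt_one hG v ω
    rw [hT.laplacian_eq hw (y := classValue G v₀ Ap Am (pt hG v ω 1) *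
      quotientKernel G v₀ (multiplicative G v₀ Ap Am) v ω)] at hv
    · have h4 : ((classValue G v₀ qp qm v : ℕ) : ℂ) + 1 ≠ 0 := Nat.cast_add_one_ne_zero _
      rw [inv_mul_eq_iff_eq_mul₀ h4] at hv
      have h5 := quotientKernel_step v₀ hG hp hm (v := v) (ω := ω) rfl
      simp only [h5] at hv
      have h2 := classValue_mul_adj hG (v₀ := v₀) hw Ap Am
      refine mul_right_cancel₀
        (quotientKernel_ne_zero v₀ hG hp hm (pt hG v ω 1) ω) ?_
      linear_combination (-1 : ℂ) * hv + (((classValue G v₀ qp qm v : ℕ) : ℂ) *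
        quotientKernel G v₀ (multiplicative G v₀ Ap Am) (pt hG v ω 1) ω) * h2
    · intro w' h' hne
      rcases pt_one_of_adj hG ω h' with h1 | h1
      · exact absurd h1.symm hne
      · rw [quotientKernel_step v₀ hG hp hm h1, classValue_adj hG h', classValue_adj hG hw]
  constructor
  · simpa [classValue] using key v₀
  · have h1 := key (pt hG v₀ ω 1)
    have h2 := dist_pt hG v₀ ω 1
    simpa [classValue, h2] using h1

end eigen

/-! ### Integration against distributions -/

section distribution

theorem Distribution.toFun_bot (μ : Distribution G) : μ.toFun ⊥ = 0 := by
  have := μ.add ⊥ ⊥ disjoint_bot_left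
  simpa using this

/-- The preimage of a set under a locally constant function, as a clopen set. -/
def fiber {X Y : Type*} [TopologicalSpace X] {π : X → Y} (hπ : IsLocallyConstant π) (S : Set Y) :
    TopologicalSpace.Clopens X := ⟨π ⁻¹' S, ⟨⟨hπ Sᶜ⟩, hπ S⟩⟩

@[simp]
theorem mem_fiber {X Y : Type*} [TopologicalSpace X] {π : X → Y} (hπ : IsLocallyConstant π)
    (S : Set Y) (x : X) : x ∈ fiber hπ S ↔ π x ∈ S := Iff.rfl

theorem Distribution.toFun_fiber_finset {Y : Type*} (μ : Distribution G) {π : Boundary G → Y}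
    (hπ : IsLocallyConstant π) (T : Finset Y) :
    μ.toFun (fiber hπ T) = ∑ w ∈ T, μ.toFun (fiber hπ {w}) := by
  classical
  induction T using Finset.induction_on with
  | empty =>
    rw [Finset.sum_empty, ← μ.toFun_bot]
    congr 1
    ext; simp [fiber]
  | insert a T ha ih =>
    rw [Finset.sum_insert ha, ← ih, ← μ.add]
    · congr 1
      ext ω
      simp only [Finset.coe_insert, SetLike.mem_coe, mem_fiber, Set.mem_insert_iff,
        TopologicalSpace.Clopens.coe_sup, Set.mem_union, Set.mem_singleton_iff]
    · rw [disjoint_iff]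
      ext ω
      simp only [TopologicalSpace.Clopens.coe_inf, Set.mem_inter_iff, SetLike.mem_coe, mem_fiber,
        Set.mem_singleton_iff, TopologicalSpace.Clopens.coe_bot, Set.mem_empty_iff_false,
        iff_false, not_and]
      rintro rfl
      exact ha

/-- The integral of a function that factors through a locally constant map `π` is a sum over the
values of `π`, not only over those of the function itself. -/
theorem Distribution.integral_comp {Y : Type*} (μ : Distribution G) {π : Boundary G → Y}
    (hπ : IsLocallyConstant π) (s : Finset Y) (hs : ∀ ω, π ω ∈ s) (g : Y → ℂ) :
    μ.integral (fun ω => g (π ω)) = ∑ w ∈ s, g w * μ.toFun (fiber hπ {w}) := by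
  classical
  have hpre : ∀ c : ℂ, IsClopen ((fun ω => g (π ω)) ⁻¹' {c}) := fun c => (fiber hπ (g ⁻¹' {c})).2
  have hval : ∀ c : ℂ, μ.toFun ⟨_, hpre c⟩ = ∑ w ∈ s with g w = c, μ.toFun (fiber hπ {w}) := by
    intro c
    rw [← μ.toFun_fiber_finset]
    congr 1
    ext ω
    simp [fiber, hs]
  simp only [Distribution.integral, hpre, dite_true, hval]
  rw [finsum_eq_sum_of_support_subset (s := s.image g)]
  · rw [Finset.sum_image' (fun w => g w * μ.toFun (fiber hπ {w}))]
    intro w _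
    rw [Finset.mul_sum]
    refine Finset.sum_congr rfl fun u hu => ?_
    rw [(Finset.mem_filter.1 hu).2]
  · intro c hc
    by_contra hcs
    refine hc ?_
    change c * _ = 0
    rw [Finset.filter_false_of_mem, Finset.sum_empty, mul_zero]
    rintro w hw rfl
    exact hcs (by simpa using ⟨w, hw, rfl⟩)

theorem isEigenfunction_integral [G.LocallyFinite] (hG : G.IsTree) {v₀ : V} {Ap Am γ : ℂ}
    (hp : Ap ≠ 0) (hm : Am ≠ 0)
    (h : ∀ ω, IsEigenfunction G γ
      fun v => quotientKernel G v₀ (multiplicative G v₀ Ap Am) v ω) (μ : Distribution G) :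
    IsEigenfunction G γ
      fun v => μ.integral (quotientKernel G v₀ (multiplicative G v₀ Ap Am) v) := by
  classical
  intro v
  -- all kernels in the eigenvalue equation at `v` factor through the same vertex of the ray
  set n := G.dist v₀ v + 1
  have hn : ∀ w, w ∈ insert v (G.neighborFinset v) → G.dist v₀ w ≤ n := by
    intro w hw
    rcases Finset.mem_insert.1 hw with rfl | hw
    · omega
    · have h1 := hG.connected.dist_triangle (u := v₀) (v := v) (w := w)
      rw [SimpleGraph.dist_eq_one_iff_adj.2 (show G.Adj v w by simpa using hw)] at h1
      exact h1
  set s := (finite_sphere hG v₀ n).toFinset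
  have hs : ∀ ω, pt hG v₀ ω n ∈ s := fun ω => by simpa [s] using dist_pt hG v₀ ω n
  set g : V → V → ℂ := fun w x => multiplicative G v₀ Ap Am w x / multiplicative G v₀ Ap Am v₀ x
  have hint : ∀ w, w ∈ insert v (G.neighborFinset v) →
      μ.integral (quotientKernel G v₀ (multiplicative G v₀ Ap Am) w) =
        ∑ x ∈ s, g w x * μ.toFun (fiber (isLocallyConstant_pt hG v₀ n) {x}) := by
    intro w hw
    rw [← μ.integral_comp _ s hs,
      funext (quotientKernel_eq_comp_pt v₀ hG hp hm (v := w) (hn w hw))]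
  change _ = γ * μ.integral (quotientKernel G v₀ (multiplicative G v₀ Ap Am) v)
  rw [laplacian, Finset.sum_congr rfl fun w hw => hint w (Finset.mem_insert_of_mem hw),
    hint v (Finset.mem_insert_self _ _), Finset.sum_comm, Finset.mul_sum, Finset.mul_sum]
  refine Finset.sum_congr rfl fun x _ => ?_
  rw [← Finset.sum_mul, ← mul_assoc, ← mul_assoc]
  by_cases hx : ∃ ω, pt hG v₀ ω n = x
  · obtain ⟨ω, rfl⟩ := hx
    congr 1
    have : laplacian G (fun v => quotientKernel G v₀ (multiplicative G v₀ Ap Am) v ω) v =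
      γ * quotientKernel G v₀ (multiplicative G v₀ Ap Am) v ω := h ω v
    rw [laplacian, Finset.sum_congr rfl fun w hw => quotientKernel_eq_comp_pt v₀ hG hp hm
      (hn w (Finset.mem_insert_of_mem hw)) ω, quotientKernel_eq_comp_pt v₀ hG hp hm
      (hn v (Finset.mem_insert_self _ _)) ω] at this
    exact this
  · have : fiber (isLocallyConstant_pt hG v₀ n) {x} = ⊥ := by
      ext ω
      simp only [SetLike.mem_coe, mem_fiber, Set.mem_singleton_iff,
        TopologicalSpace.Clopens.coe_bot, Set.mem_empty_iff_false, iff_false]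
      exact fun h => hx ⟨ω, h⟩
    rw [this, μ.toFun_bot, mul_zero, mul_zero]

end distribution

end SemihomTree

/-! ### The two solutions of the hitting relations -/

namespace SemihomTree

variable {qp qm : ℕ} {γ : ℂ}

theorem bigGamma_comm (qp qm : ℕ) (γ : ℂ) : bigGamma qm qp γ = bigGamma qp qm γ := by
  unfold bigGamma; ring

theorem sub_mul_sub_eq (qp qm : ℕ) (x : ℂ) :
    (x - (((√qp - √qm) ^ 2 : ℝ) : ℂ)) * (x - (((√qp + √qm) ^ 2 : ℝ) : ℂ))
      = x ^ 2 - 2 * (qp + qm) * x + (qp - qm) ^ 2 := by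
  have h1 : ((√qp : ℝ) : ℂ) ^ 2 = qp := by
    rw [← Complex.ofReal_pow, Real.sq_sqrt (Nat.cast_nonneg _)]; simp
  have h2 : ((√qm : ℝ) : ℂ) ^ 2 = qm := by
    rw [← Complex.ofReal_pow, Real.sq_sqrt (Nat.cast_nonneg _)]; simp
  rw [← h1, ← h2]
  push_cast
  ring

theorem rootR_sq (qp qm : ℕ) (γ : ℂ) :
    rootR qp qm γ ^ 2 = bigGamma qp qm γ ^ 2 - 2 * (qp + qm) * bigGamma qp qm γ
      + (qp - qm) ^ 2 := by
  rw [← sub_mul_sub_eq, rootR]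
  set a := bigGamma qp qm γ - (((√qp - √qm) ^ 2 : ℝ) : ℂ)
  set b := bigGamma qp qm γ - (((√qp + √qm) ^ 2 : ℝ) : ℂ)
  by_cases ha : a = 0
  · simp [ha]
  · rw [mul_pow, one_div, ← Complex.cpow_nat_mul]
    norm_num
    field_simp

section pair

variable (hp : qp ≠ 0) (hm : qm ≠ 0) (hγ : γ ≠ 0)
include hp hm hγ

theorem nearestValue_mul {r : ℂ}
    (hr : r ^ 2 = bigGamma qp qm γ ^ 2 - 2 * (qp + qm) * bigGamma qp qm γ + (qp - qm) ^ 2) :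
    nearestValue qp qm γ r * nearestValue qm qp γ r
      = (bigGamma qp qm γ - (qp + qm) - r) / (2 * qp * qm) := by
  have hp' : (qp : ℂ) ≠ 0 := by exact_mod_cast hp
  have hm' : (qm : ℂ) ≠ 0 := by exact_mod_cast hm
  have hp1 : (qp : ℂ) + 1 ≠ 0 := Nat.cast_add_one_ne_zero _
  have hm1 : (qm : ℂ) + 1 ≠ 0 := Nat.cast_add_one_ne_zero _
  have hd : (bigGamma qp qm γ - (qp - qm) - r) * (bigGamma qp qm γ - (qm - qp) - r)
      = 2 * bigGamma qp qm γ * (bigGamma qp qm γ - (qp + qm) - r) := by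
    linear_combination hr
  unfold nearestValue
  rw [bigGamma_comm qp qm, div_mul_div_comm, hd, div_eq_div_iff (by simp [*]) (by simp [*])]
  unfold bigGamma
  ring

theorem isHittingPair_nearestValue {r : ℂ}
    (hr : r ^ 2 = bigGamma qp qm γ ^ 2 - 2 * (qp + qm) * bigGamma qp qm γ + (qp - qm) ^ 2) :
    IsHittingPair qp qm γ (nearestValue qp qm γ r) (nearestValue qm qp γ r) := by
  have hp' : (qp : ℂ) ≠ 0 := by exact_mod_cast hp
  have hm' : (qm : ℂ) ≠ 0 := by exact_mod_cast hm
  have hp1 : (qp : ℂ) + 1 ≠ 0 := Nat.cast_add_one_ne_zero _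
  have hm1 : (qm : ℂ) + 1 ≠ 0 := Nat.cast_add_one_ne_zero _
  constructor
  · rw [nearestValue_mul hp hm hγ hr, nearestValue]
    field_simp
    ring
  · rw [nearestValue_mul hp hm hγ hr, nearestValue, bigGamma_comm qp qm]
    field_simp
    ring

theorem isHittingPair_F : IsHittingPair qp qm γ (Fplus qp qm γ) (Fminus qp qm γ) :=
  isHittingPair_nearestValue hp hm hγ (rootR_sq qp qm γ)

theorem isHittingPair_Ftilde :
    IsHittingPair qp qm γ (FtildePlus qp qm γ) (FtildeMinus qp qm γ) :=
  isHittingPair_nearestValue hp hm hγ (by rw [neg_sq, rootR_sq])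

theorem Fplus_mul_Fminus : Fplus qp qm γ * Fminus qp qm γ
    = (bigGamma qp qm γ - (qp + qm) - rootR qp qm γ) / (2 * qp * qm) :=
  nearestValue_mul hp hm hγ (rootR_sq qp qm γ)

theorem FtildePlus_mul_FtildeMinus : FtildePlus qp qm γ * FtildeMinus qp qm γ
    = (bigGamma qp qm γ - (qp + qm) + rootR qp qm γ) / (2 * qp * qm) := by
  rw [FtildePlus, FtildeMinus, nearestValue_mul hp hm hγ (by rw [neg_sq, rootR_sq]), sub_neg_eq_add]

theorem mul_FF_mul_FtildeFtilde : (qp * qm : ℂ) * ((Fplus qp qm γ * Fminus qp qm γ) *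
    (FtildePlus qp qm γ * FtildeMinus qp qm γ)) = 1 := by
  have hp' : (qp : ℂ) ≠ 0 := by exact_mod_cast hp
  have hm' : (qm : ℂ) ≠ 0 := by exact_mod_cast hm
  rw [Fplus_mul_Fminus hp hm hγ, FtildePlus_mul_FtildeMinus hp hm hγ]
  field_simp
  linear_combination (-1 : ℂ) * rootR_sq qp qm γ

theorem IsHittingPair.eq_or_eq {Ap Am : ℂ} (h : IsHittingPair qp qm γ Ap Am) :
    (Ap = Fplus qp qm γ ∧ Am = Fminus qp qm γ) ∨
      (Ap = FtildePlus qp qm γ ∧ Am = FtildeMinus qp qm γ) := by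
  have hp' : (qp : ℂ) ≠ 0 := by exact_mod_cast hp
  have hm' : (qm : ℂ) ≠ 0 := by exact_mod_cast hm
  have hp1 : (qp : ℂ) + 1 ≠ 0 := Nat.cast_add_one_ne_zero _
  have hm1 : (qm : ℂ) + 1 ≠ 0 := Nat.cast_add_one_ne_zero _
  -- the pair is determined by its product, which solves a quadratic equation
  have hdet : ∀ {Bp Bm : ℂ}, IsHittingPair qp qm γ Bp Bm → Ap * Am = Bp * Bm →
      Ap = Bp ∧ Am = Bm := by
    intro Bp Bm h' he
    constructor
    · refine mul_left_cancel₀ (mul_ne_zero hγ hp1) ?_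
      rw [h.plus, h'.plus, he]
    · refine mul_left_cancel₀ (mul_ne_zero hγ hm1) ?_
      rw [h.minus, h'.minus, he]
  have hquad : (2 * qp * qm * (Ap * Am) - (bigGamma qp qm γ - (qp + qm))) ^ 2
      = rootR qp qm γ ^ 2 := by
    rw [rootR_sq]
    have e : bigGamma qp qm γ * (Ap * Am) = (1 + qp * (Ap * Am)) * (1 + qm * (Ap * Am)) := by
      rw [← h.plus, ← h.minus, bigGamma]; ring
    linear_combination (-4 * qp * qm : ℂ) * e
  rcases sq_eq_sq_iff_eq_or_eq_neg.1 hquad with hx | hx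
  · right
    refine hdet (isHittingPair_Ftilde hp hm hγ) ?_
    rw [FtildePlus_mul_FtildeMinus hp hm hγ]
    field_simp
    linear_combination hx
  · left
    refine hdet (isHittingPair_F hp hm hγ) ?_
    rw [Fplus_mul_Fminus hp hm hγ]
    field_simp
    linear_combination hx

/-- The chosen square root makes `F⁺F⁻` the solution of smaller modulus: with
`s² = (Γ - β) / (Γ - α)` one has `Γ - (q₊ + q₋) ∓ R = (Γ - α) (1 ∓ s)² / 2`, where `0 ≤ Re s`. -/
theorem norm_FF_le_norm_FtildeFtilde : ‖Fplus qp qm γ * Fminus qp qm γ‖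
    ≤ ‖FtildePlus qp qm γ * FtildeMinus qp qm γ‖ := by
  rw [Fplus_mul_Fminus hp hm hγ, FtildePlus_mul_FtildeMinus hp hm hγ, norm_div, norm_div]
  gcongr
  have hsum : bigGamma qp qm γ - (qp + qm) = ((bigGamma qp qm γ - (((√qp - √qm) ^ 2 : ℝ) : ℂ)) +
      (bigGamma qp qm γ - (((√qp + √qm) ^ 2 : ℝ) : ℂ))) / 2 := by
    have h1 : ((√qp : ℝ) : ℂ) ^ 2 = qp := by
      rw [← Complex.ofReal_pow, Real.sq_sqrt (Nat.cast_nonneg _)]; simp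
    have h2 : ((√qm : ℝ) : ℂ) ^ 2 = qm := by
      rw [← Complex.ofReal_pow, Real.sq_sqrt (Nat.cast_nonneg _)]; simp
    rw [← h1, ← h2]
    push_cast
    ring
  rw [hsum, rootR]
  set a := bigGamma qp qm γ - (((√qp - √qm) ^ 2 : ℝ) : ℂ)
  set b := bigGamma qp qm γ - (((√qp + √qm) ^ 2 : ℝ) : ℂ)
  by_cases ha : a = 0
  · simp [ha]
  set s : ℂ := (b / a) ^ (1 / 2 : ℂ) with hs
  have hb : b = a * s ^ 2 := by
    rw [hs, one_div, ← Complex.cpow_nat_mul]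
    norm_num
    field_simp
  have hre : 0 ≤ s.re := by
    rw [hs, one_div, Complex.cpow_inv_two_re]
    positivity
  have e1 : (a + b) / 2 - a * s = a / 2 * (1 - s) ^ 2 := by rw [hb]; ring
  have e2 : (a + b) / 2 + a * s = a / 2 * (1 + s) ^ 2 := by rw [hb]; ring
  rw [e1, e2, norm_mul, norm_mul, norm_pow, norm_pow]
  have : ‖1 - s‖ ≤ ‖1 + s‖ := by
    rw [← sq_le_sq₀ (norm_nonneg _) (norm_nonneg _), Complex.sq_norm, Complex.sq_norm,
      Complex.normSq_apply, Complex.normSq_apply]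
    simp
    nlinarith
  gcongr

theorem norm_FF_sq_le_one : (qp * qm : ℝ) * ‖Fplus qp qm γ * Fminus qp qm γ‖ ^ 2 ≤ 1 := by
  have h1 := congrArg norm (mul_FF_mul_FtildeFtilde hp hm hγ)
  have h2 := norm_FF_le_norm_FtildeFtilde hp hm hγ
  rw [norm_mul, norm_mul, norm_mul, Complex.norm_natCast, Complex.norm_natCast, norm_one] at h1
  rw [← h1, sq]
  gcongr

theorem norm_FF_sq_eq_one_of_rootR_eq_zero (hR : rootR qp qm γ = 0) :
    (qp * qm : ℝ) * ‖Fplus qp qm γ * Fminus qp qm γ‖ ^ 2 = 1 := by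
  have h1 := congrArg norm (mul_FF_mul_FtildeFtilde hp hm hγ)
  have h2 : FtildePlus qp qm γ * FtildeMinus qp qm γ = Fplus qp qm γ * Fminus qp qm γ := by
    rw [Fplus_mul_Fminus hp hm hγ, FtildePlus_mul_FtildeMinus hp hm hγ, hR, sub_zero, add_zero]
  rw [h2, norm_mul, norm_mul (_ * _), norm_mul (qp : ℂ), Complex.norm_natCast,
    Complex.norm_natCast, norm_one] at h1
  rw [← h1, sq]

end pair

theorem IsHittingPair.plus_ne_zero {Ap Am : ℂ} (h : IsHittingPair qp qm γ Ap Am) : Ap ≠ 0 := by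
  rintro rfl
  simpa using h.plus

theorem IsHittingPair.minus_ne_zero {Ap Am : ℂ} (h : IsHittingPair qp qm γ Ap Am) : Am ≠ 0 := by
  rintro rfl
  simpa using h.minus

/-- For real `γ` with `Γ > (√q₊ + √q₋)²` both solutions are positive, and moving one step with
the smaller and back with the larger factor contracts. -/
theorem exists_real_values (hp : 1 < qp) (hm : 1 < qm) {γ : ℝ} (hγ : 0 < γ)
    (hΓ : (√qp + √qm) ^ 2 < ((qp : ℝ) + 1) * (qm + 1) * γ ^ 2) :
    ∃ fp fm gp gm : ℝ, Fplus qp qm γ = fp ∧ Fminus qp qm γ = fm ∧ FtildePlus qp qm γ = gp ∧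
      FtildeMinus qp qm γ = gm ∧ 0 < fp ∧ 0 < fm ∧ fp < gp ∧ fm < gm ∧ fp * gm < 1 ∧
      fm * gp < 1 := by
  obtain ⟨Γ, hΓdef⟩ : ∃ Γ : ℝ, Γ = ((qp : ℝ) + 1) * (qm + 1) * γ ^ 2 := ⟨_, rfl⟩
  rw [← hΓdef] at hΓ
  have hΓc : bigGamma qp qm (γ : ℂ) = (Γ : ℂ) := by simp [bigGamma, hΓdef]
  have hP : (2 : ℝ) ≤ qp := by exact_mod_cast hp
  have hM : (2 : ℝ) ≤ qm := by exact_mod_cast hm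
  have hab : (√qp - √qm) ^ 2 ≤ (√qp + √qm) ^ 2 := by
    nlinarith [Real.sqrt_nonneg qp, Real.sqrt_nonneg qm,
      mul_nonneg (Real.sqrt_nonneg qp) (Real.sqrt_nonneg qm)]
  obtain ⟨r, hr0, hr⟩ : ∃ r : ℝ, 0 < r ∧ rootR qp qm (γ : ℂ) = r := by
    refine ⟨(Γ - (√qp - √qm) ^ 2) *
      ((Γ - (√qp + √qm) ^ 2) / (Γ - (√qp - √qm) ^ 2)) ^ (1 / 2 : ℝ), ?_, ?_⟩
    · have h1 : 0 < Γ - (√qp - √qm) ^ 2 := by linarith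
      have h2 : 0 < Γ - (√qp + √qm) ^ 2 := by linarith
      positivity
    · have h1 : 0 ≤ (Γ - (√qp + √qm) ^ 2) / (Γ - (√qp - √qm) ^ 2) :=
        div_nonneg (by linarith) (by linarith)
      rw [rootR, hΓc, Complex.ofReal_mul, Complex.ofReal_cpow h1]
      push_cast
      rfl
  have hr2 : r ^ 2 = Γ ^ 2 - 2 * (qp + qm) * Γ + (qp - qm) ^ 2 := by
    have := rootR_sq qp qm (γ : ℂ)
    rw [hr, hΓc] at this
    exact_mod_cast this
  have hw : 0 < Γ - (qp + qm) := by
    have h1 := Real.sq_sqrt (Nat.cast_nonneg (α := ℝ) qp)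
    have h2 := Real.sq_sqrt (Nat.cast_nonneg (α := ℝ) qm)
    nlinarith [mul_nonneg (Real.sqrt_nonneg qp) (Real.sqrt_nonneg qm)]
  have hrw : r < Γ - (qp + qm) := by
    refine lt_of_pow_lt_pow_left₀ 2 hw.le ?_
    nlinarith
  have hval : ∀ (a b : ℕ) (t : ℝ), a = qp ∧ b = qm ∨ a = qm ∧ b = qp →
      nearestValue a b (γ : ℂ) (t : ℂ) = ((Γ - (a - b) - t) / (2 * b * (a + 1) * γ) : ℝ) := by
    rintro a b t (⟨rfl, rfl⟩ | ⟨rfl, rfl⟩)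
    · rw [nearestValue, hΓc]; push_cast; rfl
    · rw [nearestValue, bigGamma_comm b a, hΓc]; push_cast; rfl
  have hcontr : ∀ P M : ℝ, 2 ≤ P → 2 ≤ M → Γ = (P + 1) * (M + 1) * γ ^ 2 → r < Γ - (P + M) →
      r ^ 2 = Γ ^ 2 - 2 * (P + M) * Γ + (P - M) ^ 2 →
      (Γ - (P - M) - r) / (2 * M * (P + 1) * γ) * ((Γ - (M - P) + r) / (2 * P * (M + 1) * γ))
        < 1 := by
    intro P M hP hM hΓ' hrw hr2
    rw [div_mul_div_comm, div_lt_one (by positivity)]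
    have e : 2 * M * (P + 1) * γ * (2 * P * (M + 1) * γ) = 4 * P * M * Γ := by rw [hΓ']; ring
    rw [e]
    have hΓ0 : 0 < Γ := by linarith
    have h1 : 2 * P * Γ ≤ M * P * Γ := by nlinarith [mul_pos (by linarith : 0 < P) hΓ0]
    have h2 : 2 * M * Γ ≤ M * P * Γ := by nlinarith [mul_pos (by linarith : 0 < M) hΓ0]
    have e2 : (Γ - (P - M) - r) * (Γ - (M - P) + r)
        = 2 * (P * Γ) + 2 * (M * Γ) - 2 * (P - M) ^ 2 - 2 * ((P - M) * r) := by
      linear_combination (-1 : ℝ) * hr2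
    have h3 := sq_nonneg (P - M)
    have h4 : 0 < M * P * Γ := by positivity
    rcases le_total M P with h | h
    · have h5 : 0 ≤ (P - M) * r := mul_nonneg (sub_nonneg.2 h) hr0.le
      linarith
    · have h5 : 0 ≤ (M - P) * (Γ - r) := mul_nonneg (sub_nonneg.2 h) (by linarith)
      linarith
  refine ⟨(Γ - (qp - qm) - r) / (2 * qm * (qp + 1) * γ),
    (Γ - (qm - qp) - r) / (2 * qp * (qm + 1) * γ),
    (Γ - (qp - qm) + r) / (2 * qm * (qp + 1) * γ),
    (Γ - (qm - qp) + r) / (2 * qp * (qm + 1) * γ), ?_, ?_, ?_, ?_, ?_, ?_, ?_, ?_, ?_, ?_⟩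
  · rw [Fplus, hr, hval _ _ _ (Or.inl ⟨rfl, rfl⟩)]
  · rw [Fminus, hr, hval _ _ _ (Or.inr ⟨rfl, rfl⟩)]
  · rw [FtildePlus, hr, ← Complex.ofReal_neg, hval _ _ _ (Or.inl ⟨rfl, rfl⟩), sub_neg_eq_add]
  · rw [FtildeMinus, hr, ← Complex.ofReal_neg, hval _ _ _ (Or.inr ⟨rfl, rfl⟩), sub_neg_eq_add]
  · exact div_pos (by linarith) (by positivity)
  · exact div_pos (by linarith) (by positivity)
  · gcongr
    linarith
  · gcongr
    linarith
  · exact hcontr qp qm hP hM hΓdef hrw hr2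
  · exact hcontr qm qp hM hP (by rw [hΓdef]; ring) (by linarith) (by rw [hr2]; ring)

end SemihomTree

/-! ### Spheres and square-summable radial functions -/

namespace SemihomTree

variable {V : Type*} {G : SimpleGraph V}

theorem even_dist_iff (hG : G.IsTree) (u v w : V) :
    Even (G.dist v w) ↔ (Even (G.dist u v) ↔ Even (G.dist u w)) := by
  obtain ⟨p⟩ := hG.connected.preconnected v w
  induction p with
  | nil => simp
  | @cons v v' w h p ih =>
    have h1 := even_dist_adj hG h w
    rw [G.dist_comm, G.dist_comm (u := w)] at h1
    have h2 := even_dist_adj hG h u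
    tauto

variable [G.LocallyFinite] {v₀ : V} {qp qm : ℕ}

/-- A semi-homogeneous tree may be based at any vertex, with the homogeneity degrees exchanged
if this vertex belongs to the other class. -/
theorem IsSemihomogeneous.rebase (hT : IsSemihomogeneous G v₀ qp qm) (v : V) :
    IsSemihomogeneous G v (classValue G v₀ qp qm v) (classValue G v₀ qm qp v) where
  isTree := hT.isTree
  one_lt_plus := classValue_cases (p := (1 < ·)) hT.one_lt_plus hT.one_lt_minus v₀ v
  one_lt_minus := classValue_cases (p := (1 < ·)) hT.one_lt_minus hT.one_lt_plus v₀ v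
  degree_even w h := by
    rw [even_dist_iff hT.isTree v₀] at h
    rw [hT.degree_eq]
    unfold classValue
    split_ifs <;> tauto
  degree_odd w h := by
    rw [even_dist_iff hT.isTree v₀] at h
    rw [hT.degree_eq]
    unfold classValue
    split_ifs <;> tauto

/-- The neighbours of `v` that are farther than `v` from the base vertex. -/
noncomputable def children (G : SimpleGraph V) [G.LocallyFinite] (v₀ v : V) : Finset V :=
  {w ∈ G.neighborFinset v | G.dist v₀ w = G.dist v₀ v + 1}

theorem mem_children {v w : V} :
    w ∈ children G v₀ v ↔ G.Adj v w ∧ G.dist v₀ w = G.dist v₀ v + 1 := by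
  simp [children]

/-- The number of children of the vertices at level `n`. -/
def branching (qp qm n : ℕ) : ℕ := if n = 0 then qp + 1 else if Even n then qp else qm

theorem card_children (hT : IsSemihomogeneous G v₀ qp qm) (v : V) :
    (children G v₀ v).card = branching qp qm (G.dist v₀ v) := by
  classical
  have hG := hT.isTree
  by_cases hv : v = v₀
  · subst hv
    have : children G v v = G.neighborFinset v := by
      ext w
      simp [mem_children]
    rw [this, G.card_neighborFinset_eq_degree, hT.degree_eq]
    simp [branching, classValue]
  · obtain ⟨w, hw, hd⟩ := exists_adj_dist_eq_add_one hG hv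
    have hd' : G.dist v₀ v = G.dist v₀ w + 1 := by simpa [G.dist_comm] using hd
    have : children G v₀ v = (G.neighborFinset v).erase w := by
      ext u
      simp only [mem_children, Finset.mem_erase, SimpleGraph.mem_neighborFinset]
      constructor
      · rintro ⟨h1, h2⟩
        exact ⟨by rintro rfl; omega, h1⟩
      · rintro ⟨h1, h2⟩
        refine ⟨h2, ?_⟩
        rcases dist_adj_cases hG h2 v₀ with h3 | h3
        · exact absurd (eq_of_adj_of_dist_eq_add_one hG h2 hw h3 hd) h1
        · simpa [G.dist_comm] using h3
    have hne : G.dist v₀ v ≠ 0 := by omega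
    rw [this, Finset.card_erase_of_mem (by simpa using hw), G.card_neighborFinset_eq_degree,
      hT.degree_eq, branching, if_neg hne]
    simp [classValue]

/-- The number of vertices at level `n`. -/
noncomputable def sphereCard (G : SimpleGraph V) (v₀ : V) (n : ℕ) : ℕ :=
  Set.ncard {w | G.dist v₀ w = n}

omit [G.LocallyFinite] in
theorem sphereCard_zero (hG : G.IsTree) (v₀ : V) : sphereCard G v₀ 0 = 1 := by
  have : {w | G.dist v₀ w = 0} = {v₀} := by
    ext w
    simp only [Set.mem_ofPred_eq, Set.mem_singleton_iff, hG.connected.dist_eq_zero_iff]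
    exact eq_comm
  rw [sphereCard, this, Set.ncard_singleton]

theorem sphereCard_succ (hT : IsSemihomogeneous G v₀ qp qm) (n : ℕ) :
    sphereCard G v₀ (n + 1) = sphereCard G v₀ n * branching qp qm n := by
  classical
  have hG := hT.isTree
  have key : (finite_sphere hG v₀ (n + 1)).toFinset
      = (finite_sphere hG v₀ n).toFinset.biUnion (children G v₀) := by
    ext w
    simp only [Set.Finite.mem_toFinset, Set.mem_ofPred_eq, Finset.mem_biUnion, mem_children]
    constructor
    · intro hw
      have hne : w ≠ v₀ := by rintro rfl; simp at hw
      obtain ⟨v, hv, hd⟩ := exists_adj_dist_eq_add_one hG hne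
      rw [G.dist_comm, G.dist_comm (u := v)] at hd
      exact ⟨v, by omega, hv.symm, hd⟩
    · rintro ⟨v, hv, -, hd⟩
      omega
  rw [sphereCard, sphereCard, Set.ncard_eq_toFinset_card _ (finite_sphere hG v₀ (n + 1)),
    Set.ncard_eq_toFinset_card _ (finite_sphere hG v₀ n), key, Finset.card_biUnion,
    Finset.sum_const_nat]
  · intro v hv
    rw [card_children hT, show G.dist v₀ v = n by simpa using hv]
  · intro v hv v' hv' hne
    rw [Function.onFun, Finset.disjoint_left]
    intro w hw hw'
    rw [mem_children] at hw hw'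
    refine hne (eq_of_adj_of_dist_eq_add_one hG hw.1.symm hw'.1.symm (j := v₀) ?_ ?_)
    · rw [G.dist_comm, hw.2, G.dist_comm]
    · rw [G.dist_comm, hw'.2, G.dist_comm]

theorem sphereCard_odd (hT : IsSemihomogeneous G v₀ qp qm) (j : ℕ) :
    sphereCard G v₀ (2 * j + 1) = (qp + 1) * (qp * qm) ^ j := by
  induction j with
  | zero => rw [sphereCard_succ hT, sphereCard_zero hT.isTree]; simp [branching]
  | succ j ih =>
    rw [show 2 * (j + 1) + 1 = 2 * j + 1 + 1 + 1 by ring, sphereCard_succ hT, sphereCard_succ hT,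
      ih]
    have h1 : branching qp qm (2 * j + 1) = qm := by simp [branching]
    have h2 : branching qp qm (2 * j + 1 + 1) = qp := by
      simp [branching, Nat.even_add_one]
    rw [h1, h2]
    ring

theorem sphereCard_even (hT : IsSemihomogeneous G v₀ qp qm) (j : ℕ) :
    qp * sphereCard G v₀ (2 * j) = (qp + if j = 0 then 0 else 1) * (qp * qm) ^ j := by
  cases j with
  | zero => simp [sphereCard_zero hT.isTree]
  | succ j =>
    rw [show 2 * (j + 1) = 2 * j + 1 + 1 by ring, sphereCard_succ hT, sphereCard_odd hT]
    have h1 : branching qp qm (2 * j + 1) = qm := by simp [branching]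
    rw [h1]
    simp
    ring

theorem le_sphereCard_even (hT : IsSemihomogeneous G v₀ qp qm) (j : ℕ) :
    (qp * qm) ^ j ≤ sphereCard G v₀ (2 * j) := by
  have h := sphereCard_even hT j
  have hq : 0 < qp := by have := hT.one_lt_plus; omega
  refine Nat.le_of_mul_le_mul_left ?_ hq
  rw [h]
  gcongr
  omega

theorem sphereCard_le (hT : IsSemihomogeneous G v₀ qp qm) (n : ℕ) :
    sphereCard G v₀ n ≤ (qp + 1) * (qp * qm) ^ (n / 2) := by
  have hq : 1 < qp := hT.one_lt_plus
  rcases Nat.even_or_odd' n with ⟨j, rfl | rfl⟩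
  · have h := sphereCard_even hT j
    rw [show 2 * j / 2 = j by omega]
    refine Nat.le_of_mul_le_mul_left (c := qp) ?_ (by omega)
    rw [h, ← mul_assoc]
    gcongr
    split_ifs <;> nlinarith
  · rw [sphereCard_odd hT, show (2 * j + 1) / 2 = j by omega]

/-- Sums of radial functions are computed sphere by sphere. -/
theorem hasSum_radial (hG : G.IsTree) {g : ℕ → ℝ} (hg : ∀ n, 0 ≤ g n) {s : ℝ}
    (h : HasSum (fun n => (sphereCard G v₀ n : ℝ) * g n) s) :
    HasSum (fun v => g (G.dist v₀ v)) s := by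
  lift g to ℕ → NNReal using hg
  have hs : 0 ≤ s := h.nonneg fun n => by positivity
  lift s to NNReal using hs
  have h' : HasSum (fun n => (sphereCard G v₀ n : NNReal) * g n) s := by
    rw [← NNReal.hasSum_coe]; simpa using h
  rw [NNReal.hasSum_coe, ← ENNReal.hasSum_coe, ENNReal.summable.hasSum_iff,
    ← ENNReal.tsum_fiberwise _ (fun v => G.dist v₀ v)]
  rw [← ENNReal.hasSum_coe, ENNReal.summable.hasSum_iff] at h'
  rw [← h']
  refine tsum_congr fun n => ?_
  have h1 : ∀ b : (fun v => G.dist v₀ v) ⁻¹' {n}, ((g (G.dist v₀ b.1) : NNReal) : ℝ≥0∞) = g n :=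
    fun b => by rw [show G.dist v₀ b.1 = n from b.2]
  rw [tsum_congr h1, ENNReal.tsum_const]
  have h2 : ENat.card ((fun v => G.dist v₀ v) ⁻¹' {n}) = sphereCard G v₀ n :=
    ((finite_sphere hG v₀ n).cast_ncard_eq).symm
  rw [h2]
  simp

/-- A square-summable function as an element of `ℓ²(V)`. -/
def toLp {V : Type*} (f : V → ℂ) (h : Summable fun v => ‖f v‖ ^ 2) : lp (fun _ : V => ℂ) 2 :=
  ⟨f, memℓp_gen (by simpa using h)⟩

omit [G.LocallyFinite] in
theorem multiplicative_norm_sq_le (v₀ : V) (Ap Am : ℂ) (u v : V) :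
    ‖multiplicative G v₀ Ap Am u v‖ ^ 2
      ≤ (1 + ‖Ap‖ ^ 2 + ‖Am‖ ^ 2) * ‖Ap * Am‖ ^ (2 * (G.dist v u / 2)) := by
  have h1 : ∀ a b : ℂ, ∀ n : ℕ, ‖a ^ ((n + 1) / 2) * b ^ (n / 2)‖ ^ 2
      ≤ (1 + ‖a‖ ^ 2) * ‖a * b‖ ^ (2 * (n / 2)) := by
    intro a b n
    rcases Nat.even_or_odd' n with ⟨j, rfl | rfl⟩
    · rw [show (2 * j + 1) / 2 = j by omega, show 2 * j / 2 = j by omega, ← mul_pow, norm_pow,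
        ← pow_mul, mul_comm j 2]
      exact le_mul_of_one_le_left (by positivity) (by nlinarith [sq_nonneg ‖a‖])
    · rw [show (2 * j + 1 + 1) / 2 = j + 1 by omega, show (2 * j + 1) / 2 = j by omega, pow_succ a,
        mul_right_comm, ← mul_pow, norm_mul, mul_pow, norm_pow, ← pow_mul, mul_comm j 2,
        mul_comm]
      gcongr
      linarith
  rw [G.dist_comm]
  unfold multiplicative
  split_ifs
  · refine (h1 _ _ _).trans (mul_le_mul_of_nonneg_right ?_ (by positivity))
    linarith [sq_nonneg ‖Am‖]
  · rw [mul_comm Ap Am]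
    refine (h1 _ _ _).trans (mul_le_mul_of_nonneg_right ?_ (by positivity))
    linarith [sq_nonneg ‖Ap‖]

/-- The function `u ↦ A(u, v)` is square-summable if `q₊ q₋ |A⁺ A⁻|² < 1`, as the sphere of
radius `n` around `v` has about `(q₊ q₋)^(n / 2)` elements. -/
theorem summable_multiplicative (hT : IsSemihomogeneous G v₀ qp qm) {Ap Am : ℂ}
    (h : (qp * qm : ℝ) * ‖Ap * Am‖ ^ 2 < 1) (v : V) :
    Summable fun u => ‖multiplicative G v₀ Ap Am u v‖ ^ 2 := by
  have hG := hT.isTree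
  have hT' := hT.rebase v
  set r := (qp * qm : ℝ) * ‖Ap * Am‖ ^ 2 with hr
  have hprod : classValue G v₀ qp qm v * classValue G v₀ qm qp v = qp * qm := by
    unfold classValue; split_ifs <;> ring
  have hr0 : 0 ≤ r := by positivity
  have hgeom : Summable fun n : ℕ => r ^ (n / 2) := by
    -- sort the indices by parity
    rw [← (Equiv.boolProdNatEquivNat).summable_iff]
    have : ((fun n : ℕ => r ^ (n / 2)) ∘ Equiv.boolProdNatEquivNat) = fun x => r ^ x.2 := by
      funext ⟨b, n⟩
      cases b
      · simp [Nat.bit]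
      · have : (2 * n + 1) / 2 = n := by omega
        simp [Nat.bit, this]
    rw [this, summable_prod_of_nonneg (fun _ => by positivity)]
    exact ⟨fun _ => summable_geometric_of_lt_one hr0 h, Summable.of_finite⟩
  set C := (classValue G v₀ qp qm v + 1 : ℝ) * (1 + ‖Ap‖ ^ 2 + ‖Am‖ ^ 2)
  have hsum : Summable fun n : ℕ => (sphereCard G v n : ℝ) *
      ((1 + ‖Ap‖ ^ 2 + ‖Am‖ ^ 2) * ‖Ap * Am‖ ^ (2 * (n / 2))) := by
    refine Summable.of_nonneg_of_le (fun n => by positivity) (fun n => ?_) (hgeom.mul_left C)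
    have h1 : (sphereCard G v n : ℝ) ≤ (classValue G v₀ qp qm v + 1 : ℝ) * (qp * qm) ^ (n / 2) := by
      have := sphereCard_le hT' n
      rw [hprod] at this
      exact_mod_cast this
    calc _ ≤ ((classValue G v₀ qp qm v + 1 : ℝ) * (qp * qm) ^ (n / 2)) *
          ((1 + ‖Ap‖ ^ 2 + ‖Am‖ ^ 2) * ‖Ap * Am‖ ^ (2 * (n / 2))) := by gcongr
      _ = _ := by rw [hr, mul_pow (_ * _) (_ ^ 2), ← pow_mul]; ring
  exact Summable.of_nonneg_of_le (fun u => by positivity)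
    (fun u => multiplicative_norm_sq_le v₀ Ap Am u v)
    (hasSum_radial hG (fun n => by positivity) hsum.hasSum).summable

/-! ### Points of the spectrum -/

theorem spectrumL2_eq {v₁ : V} {qp' qm' : ℕ} (hT : IsSemihomogeneous G v₀ qp qm)
    (hT' : IsSemihomogeneous G v₁ qp' qm') : spectrumL2 hT = spectrumL2 hT' := rfl

theorem exists_norm_le_of_notMem_spectrum (hT : IsSemihomogeneous G v₀ qp qm) {γ : ℂ}
    (hγ : γ ∉ spectrumL2 hT) :
    ∃ C : ℝ, 0 ≤ C ∧ ∀ f : lp (fun _ : V => ℂ) 2, ‖f‖ ≤ C * ‖γ • f - laplacianL2 hT f‖ := by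
  rw [spectrumL2, spectrum.notMem_iff] at hγ
  obtain ⟨U, hU⟩ := hγ
  refine ⟨‖(↑U⁻¹ : lp (fun _ : V => ℂ) 2 →L[ℂ] lp (fun _ : V => ℂ) 2)‖, norm_nonneg _,
    fun f => ?_⟩
  have h1 : γ • f - laplacianL2 hT f
      = (U : lp (fun _ : V => ℂ) 2 →L[ℂ] lp (fun _ : V => ℂ) 2) f := by
    rw [hU]; simp [Algebra.algebraMap_eq_smul_one]
  have h2 : f = (↑U⁻¹ : lp (fun _ : V => ℂ) 2 →L[ℂ] lp (fun _ : V => ℂ) 2)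
      ((U : lp (fun _ : V => ℂ) 2 →L[ℂ] lp (fun _ : V => ℂ) 2) f) := by
    rw [← mul_apply_eq_comp, Units.inv_mul]; rfl
  rw [h1]
  conv_lhs => rw [h2]
  exact ContinuousLinearMap.le_opNorm _ _

/-- Truncating a radial function that is an eigenfunction off the base vertex only leaves an
error at the base vertex and at the boundary of the truncation. -/
theorem exists_truncation_bound (hT : IsSemihomogeneous G v₀ qp qm) {γ : ℂ}
    (hγ : γ ∉ spectrumL2 hT) {a : ℕ → ℂ}
    (ha : ∀ n, γ * (((if Even (n + 1) then qp else qm : ℕ) : ℂ) + 1) * a (n + 1)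
      = a n + ((if Even (n + 1) then qp else qm : ℕ) : ℂ) * a (n + 2)) :
    ∃ C : ℝ, 0 ≤ C ∧ ∀ N, 0 < N →
      ∑ k ∈ Finset.range (N + 1), (sphereCard G v₀ k : ℝ) * ‖a k‖ ^ 2 ≤
        C * (‖γ * a 0 - a 1‖ ^ 2 + sphereCard G v₀ N * ‖a (N + 1)‖ ^ 2
          + sphereCard G v₀ (N + 1) * ‖a N‖ ^ 2) := by
  have hG := hT.isTree
  obtain ⟨C, hC, hbound⟩ := exists_norm_le_of_notMem_spectrum hT hγ
  refine ⟨C ^ 2, by positivity, fun N hN => ?_⟩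
  set b : ℕ → ℂ := fun n => if n ≤ N then a n else 0 with hb
  set e : ℕ → ℝ := fun n => if n = 0 then ‖γ * a 0 - a 1‖ ^ 2 else
    if n = N then ‖a (N + 1)‖ ^ 2 else if n = N + 1 then ‖a N‖ ^ 2 else 0 with he
  have hsb : HasSum (fun v => ‖b (G.dist v₀ v)‖ ^ 2)
      (∑ k ∈ Finset.range (N + 1), (sphereCard G v₀ k : ℝ) * ‖a k‖ ^ 2) := by
    refine hasSum_radial (v₀ := v₀) hG (g := fun n => ‖b n‖ ^ 2) (fun n => by positivity) ?_
    have h1 : ∑ k ∈ Finset.range (N + 1), (sphereCard G v₀ k : ℝ) * ‖a k‖ ^ 2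
        = ∑ k ∈ Finset.range (N + 1), (sphereCard G v₀ k : ℝ) * ‖b k‖ ^ 2 := by
      refine Finset.sum_congr rfl fun k hk => ?_
      rw [hb]
      simp only
      rw [if_pos (by simpa [Nat.lt_succ_iff] using hk)]
    rw [h1]
    refine hasSum_sum_of_ne_finset_zero fun k hk => ?_
    have : ¬ k ≤ N := by simpa [Nat.lt_succ_iff] using hk
    simp [hb, this]
  have hse : HasSum (fun v => e (G.dist v₀ v))
      (‖γ * a 0 - a 1‖ ^ 2 + sphereCard G v₀ N * ‖a (N + 1)‖ ^ 2
          + sphereCard G v₀ (N + 1) * ‖a N‖ ^ 2) := by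
    refine hasSum_radial (v₀ := v₀) hG (g := e)
      (fun n => by simp only [he]; split_ifs <;> positivity) ?_
    have h1 : ‖γ * a 0 - a 1‖ ^ 2 + sphereCard G v₀ N * ‖a (N + 1)‖ ^ 2
          + sphereCard G v₀ (N + 1) * ‖a N‖ ^ 2
        = ∑ k ∈ {0, N, N + 1}, (sphereCard G v₀ k : ℝ) * e k := by
      rw [Finset.sum_insert (by simp; omega), Finset.sum_pair (by omega), sphereCard_zero hG]
      have : N ≠ 0 := by omega
      simp [he, this]
      ring
    rw [h1]
    refine hasSum_sum_of_ne_finset_zero fun k hk => ?_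
    simp only [Finset.mem_insert, Finset.mem_singleton, not_or] at hk
    simp [he, hk]
  set f := toLp _ hsb.summable
  have hpt : ∀ v, ‖(γ • f - laplacianL2 hT f) v‖ ^ 2 ≤ e (G.dist v₀ v) := by
    intro v
    change ‖γ * b (G.dist v₀ v) - laplacian G (fun w => b (G.dist v₀ w)) v‖ ^ 2 ≤ _
    by_cases hv : v = v₀
    · subst hv
      have hpos : 0 < G.degree v := by rw [hT.degree_eq]; omega
      obtain ⟨w, hw⟩ := (G.degree_pos_iff_exists_adj v).1 hpos
      have h1 : ∀ w', G.Adj v w' → b (G.dist v w') = a 1 := fun w' h' => by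
        rw [SimpleGraph.dist_eq_one_iff_adj.2 h']
        simp [hb, Nat.one_le_iff_ne_zero.2 hN.ne']
      rw [hT.laplacian_eq hw (y := a 1) (fun w' h' _ => h1 w' h'), h1 w hw]
      have h4 : ((classValue G v qp qm v : ℕ) : ℂ) + 1 ≠ 0 := Nat.cast_add_one_ne_zero _
      have h5 : (((classValue G v qp qm v : ℕ) : ℂ) + 1)⁻¹ *
          (a 1 + ((classValue G v qp qm v : ℕ) : ℂ) * a 1) = a 1 := by
        field_simp
        ring
      rw [h5]
      simp [hb, he]
    · obtain ⟨w, hw, hd⟩ := exists_adj_dist_eq_add_one hG hv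
      rw [G.dist_comm, G.dist_comm (u := w)] at hd
      have hch : ∀ w', G.Adj v w' → w' ≠ w → b (G.dist v₀ w') = b (G.dist v₀ v + 1) := by
        intro w' h' hne
        rcases dist_adj_cases hG h' v₀ with h3 | h3
        · refine absurd (eq_of_adj_of_dist_eq_add_one hG h' hw h3 ?_) hne
          rw [G.dist_comm, hd, G.dist_comm]
        · rw [G.dist_comm, G.dist_comm (u := v)] at h3
          rw [h3]
      rw [hT.laplacian_eq hw hch]
      generalize G.dist v₀ w = n at hd
      have hQ : classValue G v₀ qp qm v = if Even (n + 1) then qp else qm := by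
        rw [classValue, hd]
      rw [hd, hQ]
      have han := ha n
      set Q := if Even (n + 1) then qp else qm
      have h4 : (Q : ℂ) + 1 ≠ 0 := Nat.cast_add_one_ne_zero _
      have hQ1 : ‖((Q : ℂ) + 1)⁻¹‖ ≤ 1 := by
        have : ((Q : ℂ) + 1) = ((Q + 1 : ℕ) : ℂ) := by push_cast; rfl
        rw [this, norm_inv, Complex.norm_natCast]
        exact inv_le_one_of_one_le₀ (by exact_mod_cast Nat.succ_le_succ (Nat.zero_le Q))
      have hQ2 : ‖((Q : ℂ) + 1)⁻¹ * Q‖ ≤ 1 := by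
        have : ((Q : ℂ) + 1) = ((Q + 1 : ℕ) : ℂ) := by push_cast; rfl
        rw [this, norm_mul, norm_inv, Complex.norm_natCast, Complex.norm_natCast,
          inv_mul_le_one₀ (by positivity)]
        exact_mod_cast Nat.le_succ Q
      rcases lt_trichotomy (n + 1) N with h | h | h
      · have e1 : γ * a (n + 1) - ((Q : ℂ) + 1)⁻¹ * (a n + Q * a (n + 1 + 1)) = 0 := by
          rw [← han]
          field_simp
          ring
        have h6 : n ≤ N := by omega
        have h7 : n + 1 ≤ N := by omega
        have h8 : n + 1 + 1 ≤ N := by omega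
        simp only [hb, h6, h7, h8, if_true]
        rw [e1]
        simp only [he]
        split_ifs <;> simp
      · have e1 : γ * a (n + 1) - ((Q : ℂ) + 1)⁻¹ * (a n + Q * 0)
            = ((Q : ℂ) + 1)⁻¹ * Q * a (n + 2) := by
          field_simp
          linear_combination han
        have h6 : n ≤ N := by omega
        have h7 : n + 1 ≤ N := by omega
        have h8 : ¬ n + 1 + 1 ≤ N := by omega
        simp only [hb, h6, h7, h8, if_true, if_false]
        rw [e1]
        subst h
        simp only [he, Nat.succ_ne_zero, if_false, if_true]
        gcongr
        rw [norm_mul]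
        exact mul_le_of_le_one_left (norm_nonneg _) hQ2
      · have h7 : ¬ n + 1 ≤ N := by omega
        have h8 : ¬ n + 1 + 1 ≤ N := by omega
        simp only [hb, h7, h8, if_false]
        by_cases h9 : n = N
        · subst h9
          simp only [he, le_refl, if_true, Nat.succ_ne_zero, if_false,
            Nat.succ_ne_self, mul_zero, add_zero, zero_sub, norm_neg]
          gcongr
          rw [norm_mul]
          exact mul_le_of_le_one_left (norm_nonneg _) hQ1
        · have h6 : ¬ n ≤ N := by omega
          simp [he, h6, h9, h.ne']
  have h1 := hbound f
  have h2 : ‖f‖ ^ 2 ≤ C ^ 2 * ‖γ • f - laplacianL2 hT f‖ ^ 2 := by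
    rw [← mul_pow]; gcongr
  rw [norm_sq_lp, norm_sq_lp] at h2
  have h3 : ∑' v, ‖f v‖ ^ 2 = ∑ k ∈ Finset.range (N + 1), (sphereCard G v₀ k : ℝ) * ‖a k‖ ^ 2 :=
    hsb.tsum_eq
  rw [h3] at h2
  refine h2.trans ?_
  gcongr
  rw [← hse.tsum_eq]
  exact Summable.tsum_le_tsum hpt (summable_sq_of_lp _) hse.summable

/-- Let `t = q₊ q₋ |X|² ≤ 1`. The radial function with the values `X^j` at level `2 j` and `c X^j`
at level `2 j + 1` satisfies the eigenvalue equation off the base vertex, the error there being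
`|γ - c|`. Truncated at level `2 j` it has a squared norm of at least `j t^j`, whereas the error at
the boundary is of the order of `t^j`; under the condition `hK` the error at the base vertex is not
larger, so that the truncations are approximate eigenfunctions. The condition holds for `t = 1` and
for `γ = c`. -/
theorem mem_spectrumL2_of_radial (hT : IsSemihomogeneous G v₀ qp qm) {γ c X : ℂ} {K : ℝ}
    (h1 : γ * (qp + 1) * X = c * (1 + qp * X)) (h2 : γ * (qm + 1) * c = 1 + qm * X)
    (hX : X ≠ 0) (ht : (qp * qm : ℝ) * ‖X‖ ^ 2 ≤ 1)
    (hK : ∀ j : ℕ, ‖γ - c‖ ^ 2 ≤ K * ((qp * qm : ℝ) * ‖X‖ ^ 2) ^ j) : γ ∈ spectrumL2 hT := by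
  by_contra hγ
  have hqp := hT.one_lt_plus
  have hqm := hT.one_lt_minus
  obtain ⟨C, hC, hbound⟩ := exists_truncation_bound hT hγ
    (a := fun n => (if Even n then 1 else c) * X ^ (n / 2)) (by
      intro n
      rcases Nat.even_or_odd' n with ⟨j, rfl | rfl⟩
      · rw [show (2 * j + 1) / 2 = j by omega, show (2 * j + 2) / 2 = j + 1 by omega,
          show 2 * j / 2 = j by omega]
        simp only [Nat.even_add_one, even_two_mul, not_true, if_false, if_true, not_false_iff]
        linear_combination X ^ j * h2
      · rw [show (2 * j + 1 + 1) / 2 = j + 1 by omega, show (2 * j + 1 + 2) / 2 = j + 1 by omega,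
          show (2 * j + 1) / 2 = j by omega]
        simp only [Nat.even_add_one, even_two_mul, not_true, if_false, if_true, not_false_iff]
        linear_combination X ^ j * h1)
  set t := (qp * qm : ℝ) * ‖X‖ ^ 2 with htdef
  have hqpos : (0 : ℝ) < qp * qm := by
    have : 0 < qp * qm := Nat.mul_pos (by omega) (by omega)
    exact_mod_cast this
  have ht0 : 0 < t := by have := norm_pos_iff.2 hX; positivity
  set D : ℝ := C * (K + (qp + 1) * ‖c‖ ^ 2 + (qp + 1)) with hD
  obtain ⟨j, hj⟩ := exists_nat_gt D
  have hb := hbound (2 * (j + 1)) (by omega)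
  rw [show (2 * (j + 1) + 1) / 2 = j + 1 by omega, show 2 * (j + 1) / 2 = j + 1 by omega] at hb
  have hpow : ∀ i, (‖X‖ ^ i) ^ 2 = (‖X‖ ^ 2) ^ i := fun i => by rw [← pow_mul, ← pow_mul, mul_comm]
  have heven : ∀ i : ℕ, i ≤ j + 1 →
      t ^ (j + 1) ≤ (sphereCard G v₀ (2 * i) : ℝ) * ‖X ^ i‖ ^ 2 := by
    intro i hi
    calc t ^ (j + 1) ≤ t ^ i := pow_le_pow_of_le_one ht0.le ht hi
      _ = ((qp * qm : ℕ) ^ i : ℕ) * ‖X ^ i‖ ^ 2 := by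
          rw [htdef, mul_pow, norm_pow, hpow]; push_cast; ring
      _ ≤ _ := by
          gcongr
          exact_mod_cast le_sphereCard_even hT i
  have hlow : ((j : ℝ) + 1) * t ^ (j + 1) ≤ ∑ k ∈ Finset.range (2 * (j + 1) + 1),
      (sphereCard G v₀ k : ℝ) * ‖(if Even k then 1 else c) * X ^ (k / 2)‖ ^ 2 := by
    have hsub : (Finset.range (j + 1)).image (2 * ·) ⊆ Finset.range (2 * (j + 1) + 1) := by
      intro k hk
      simp only [Finset.mem_image, Finset.mem_range] at hk ⊢
      omega
    refine le_trans ?_ (Finset.sum_le_sum_of_subset_of_nonneg hsub fun _ _ _ => by positivity)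
    rw [Finset.sum_image (by intro x _ y _ h; simpa using h)]
    calc ((j : ℝ) + 1) * t ^ (j + 1) = ∑ _i ∈ Finset.range (j + 1), t ^ (j + 1) := by simp
      _ ≤ _ := by
        refine Finset.sum_le_sum fun i hi => ?_
        have := heven i (by have := Finset.mem_range.1 hi; omega)
        simpa using this
  have hup : ∀ n, n / 2 = j + 1 → (sphereCard G v₀ n : ℝ) * ‖X ^ (j + 1)‖ ^ 2
      ≤ (qp + 1) * t ^ (j + 1) := by
    intro n hn
    have := sphereCard_le hT n
    rw [hn] at this
    calc _ ≤ (((qp + 1) * (qp * qm) ^ (j + 1) : ℕ) : ℝ) * ‖X ^ (j + 1)‖ ^ 2 := by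
          gcongr
      _ = _ := by rw [htdef, mul_pow, norm_pow, hpow]; push_cast; ring
  have hfin : ((j : ℝ) + 1) * t ^ (j + 1) ≤ D * t ^ (j + 1) := by
    refine hlow.trans (hb.trans ?_)
    rw [hD, mul_assoc C]
    gcongr
    have e1 := hup (2 * (j + 1)) (by omega)
    have e2 := hup (2 * (j + 1) + 1) (by omega)
    have e3 := hK (j + 1)
    simp only [Nat.even_add_one, even_two_mul, not_true, if_false, if_true, Even.zero, one_mul,
      Nat.zero_div, pow_zero, mul_one, norm_mul, mul_pow, Nat.reduceDiv] at e1 e2 ⊢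
    have e4 := mul_le_mul_of_nonneg_left e1 (sq_nonneg ‖c‖)
    linarith
  have := le_of_mul_le_mul_right hfin (by positivity)
  linarith

/-- Around a vertex whose homogeneity degree `a` does not exceed that of the other class, `b`, the
radial solution of `μ₁ f = 0` that vanishes at odd levels has the value `X^j` at level `2 j`, where
`X = -1 / b`, so that `q₊ q₋ |X|² = a / b ≤ 1`. -/
theorem zero_mem_spectrumL2 (hT : IsSemihomogeneous G v₀ qp qm) : (0 : ℂ) ∈ spectrumL2 hT := by
  -- around a vertex of the class with the smaller homogeneity degree
  have key : ∀ {v : V} {a b : ℕ} (hT' : IsSemihomogeneous G v a b), a ≤ b →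
      (0 : ℂ) ∈ spectrumL2 hT' := by
    intro v a b hT' hab
    have hb0 : (b : ℂ) ≠ 0 := by have := hT'.one_lt_minus; exact_mod_cast (by omega : b ≠ 0)
    have hb : (0 : ℝ) < b := by have := hT'.one_lt_minus; exact_mod_cast (by omega : 0 < b)
    refine mem_spectrumL2_of_radial hT' (c := 0) (X := -(b : ℂ)⁻¹) (K := 0) (by simp)
      (by simp [hb0]) (by simpa using hb0) ?_ (by simp)
    rw [norm_neg, norm_inv, Complex.norm_natCast]
    have : (a : ℝ) ≤ b := by exact_mod_cast hab
    field_simp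
    exact this
  rcases le_total qp qm with h | h
  · exact key hT h
  · have hpos : 0 < G.degree v₀ := by rw [hT.degree_eq]; omega
    obtain ⟨w, hw⟩ := (G.degree_pos_iff_exists_adj v₀).1 hpos
    rw [spectrumL2_eq hT (hT.rebase w)]
    refine key _ ?_
    rw [classValue_adj hT.isTree hw, classValue_adj hT.isTree hw, classValue_base, classValue_base]
    exact h

theorem norm_FF_sq_lt_one_of_notMem (hT : IsSemihomogeneous G v₀ qp qm) {γ : ℂ}
    (hγ : γ ∉ spectrumL2 hT) :
    γ ≠ 0 ∧ (qp * qm : ℝ) * ‖Fplus qp qm γ * Fminus qp qm γ‖ ^ 2 < 1 := by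
  have hγ0 : γ ≠ 0 := by rintro rfl; exact hγ (zero_mem_spectrumL2 hT)
  have hqp : qp ≠ 0 := by have := hT.one_lt_plus; omega
  have hqm : qm ≠ 0 := by have := hT.one_lt_minus; omega
  refine ⟨hγ0, lt_of_le_of_ne (norm_FF_sq_le_one hqp hqm hγ0) fun h => hγ ?_⟩
  have hF := isHittingPair_F hqp hqm hγ0
  refine mem_spectrumL2_of_radial hT (c := Fminus qp qm γ)
    (X := Fplus qp qm γ * Fminus qp qm γ) (K := ‖γ - Fminus qp qm γ‖ ^ 2) ?_ hF.minus
    (mul_ne_zero hF.plus_ne_zero hF.minus_ne_zero) h.le (by rw [h]; simp)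
  linear_combination Fminus qp qm γ * hF.plus

end SemihomTree

/-! ### The Green kernel and the first-visit generating function -/

namespace SemihomTree

variable {V : Type*} {G : SimpleGraph V} [G.LocallyFinite] {v₀ : V} {qp qm : ℕ}

theorem resolvent_apply_sub (hT : IsSemihomogeneous G v₀ qp qm) {γ : ℂ}
    (hγ : γ ∉ spectrumL2 hT) (f : lp (fun _ : V => ℂ) 2) :
    resolvent (laplacianL2 hT) γ (γ • f - laplacianL2 hT f) = f := by
  rw [spectrumL2, spectrum.notMem_iff] at hγ
  have h1 : γ • f - laplacianL2 hT f
      = (algebraMap ℂ (lp (fun _ : V => ℂ) 2 →L[ℂ] lp (fun _ : V => ℂ) 2) γ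
        - laplacianL2 hT) f := by
    simp [Algebra.algebraMap_eq_smul_one]
  rw [h1, resolvent, ← mul_apply_eq_comp, Ring.inverse_mul_cancel _ hγ]
  rfl

open Classical in
theorem sub_laplacianL2_eq_smul_single (hT : IsSemihomogeneous G v₀ qp qm) {γ : ℂ}
    {f : V → ℂ} (hf : Summable fun u => ‖f u‖ ^ 2) {v : V}
    (h : ∀ u, u ≠ v → laplacian G f u = γ * f u) :
    γ • toLp f hf - laplacianL2 hT (toLp f hf)
      = (γ * f v - laplacian G f v) • lp.single 2 v (1 : ℂ) := by
  ext u
  change γ * f u - laplacian G f u = (γ * f v - laplacian G f v) *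
    (lp.single 2 v (1 : ℂ) : lp (fun _ : V => ℂ) 2) u
  by_cases hu : u = v
  · subst hu; simp [lp.single_apply]
  · simp [lp.single_apply, hu, h u hu]

theorem mul_green_eq (hT : IsSemihomogeneous G v₀ qp qm) {γ : ℂ} (hγ : γ ∉ spectrumL2 hT)
    {f : V → ℂ} (hf : Summable fun u => ‖f u‖ ^ 2) {v : V}
    (h : ∀ u, u ≠ v → laplacian G f u = γ * f u) (u : V) :
    (γ * f v - laplacian G f v) * green hT γ u v = f u := by
  classical
  have h1 := resolvent_apply_sub hT hγ (toLp f hf)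
  rw [sub_laplacianL2_eq_smul_single hT hf h, map_smul] at h1
  exact congrArg (fun g : lp (fun _ : V => ℂ) 2 => g u) h1

/-- Outside the spectrum the Green kernel `G(·, v)` is a multiple of the square-summable function
`F(·, v)`. -/
theorem green_eq (hT : IsSemihomogeneous G v₀ qp qm) {γ : ℂ} (hγ : γ ∉ spectrumL2 hT) (v : V) :
    green hT γ v v ≠ 0 ∧ ∀ u, green hT γ u v = F G v₀ qp qm γ u v * green hT γ v v := by
  obtain ⟨hγ0, hlt⟩ := norm_FF_sq_lt_one_of_notMem hT hγ
  have hqp : qp ≠ 0 := by have := hT.one_lt_plus; omega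
  have hqm : qm ≠ 0 := by have := hT.one_lt_minus; omega
  have hF := isHittingPair_F hqp hqm hγ0
  have key := mul_green_eq hT hγ (summable_multiplicative hT hlt v)
    (fun u hu => laplacian_multiplicative hT hF hF.plus_ne_zero hF.minus_ne_zero hu)
  have hv := key v
  simp only [multiplicative_self] at hv key
  set c := γ * 1 - laplacian G (fun u => multiplicative G v₀ (Fplus qp qm γ) (Fminus qp qm γ) u v) v
  have hc : c ≠ 0 := left_ne_zero_of_mul_eq_one hv
  refine ⟨right_ne_zero_of_mul_eq_one hv, fun u => ?_⟩
  rw [F, ← key u, mul_right_comm, hv, one_mul]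

theorem eq_zero_of_laplacian_eq (hT : IsSemihomogeneous G v₀ qp qm) {γ : ℂ}
    (hγ : γ ∉ spectrumL2 hT) {f : V → ℂ} (hf : Summable fun u => ‖f u‖ ^ 2) {v : V}
    (h0 : f v = 0) (h : ∀ u, u ≠ v → laplacian G f u = γ * f u) (u : V) : f u = 0 := by
  have key := mul_green_eq hT hγ hf h
  have hv := key v
  rw [h0] at hv
  rw [← key u, h0]
  rcases mul_eq_zero.1 hv with h1 | h1
  · rw [h1, zero_mul]
  · exact absurd h1 (green_eq hT hγ v).1

theorem notMem_spectrumL2_of_rho_lt (hT : IsSemihomogeneous G v₀ qp qm) {γ : ℂ}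
    (h : rho hT < ENNReal.ofReal ‖γ‖) : γ ∉ spectrumL2 hT := by
  rw [ofReal_norm] at h
  exact fun hmem => hmem (spectrum.mem_resolventSet_of_spectralRadius_lt h)

theorem summable_pow_of_rho_lt (hT : IsSemihomogeneous G v₀ qp qm) {r : ℝ} (hr : 0 < r)
    (h : rho hT < ENNReal.ofReal r) :
    Summable fun n : ℕ => ‖laplacianL2 hT ^ n‖ * (r ^ n)⁻¹ := by
  obtain ⟨t, ht1, ht2⟩ := exists_between h
  have htop : t ≠ ∞ := ne_top_of_lt ht2
  lift t to NNReal using htop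
  have ht2' : (t : ℝ) < r := by
    rw [← ENNReal.ofReal_coe_nnreal, ENNReal.ofReal_lt_ofReal_iff hr] at ht2
    exact ht2
  have hev := (spectrum.pow_nnnorm_pow_one_div_tendsto_nhds_spectralRadius
    (laplacianL2 hT)).eventually_lt_const ht1
  have hgeo : Summable fun n : ℕ => ((t : ℝ) / r) ^ n :=
    summable_geometric_of_lt_one (by positivity) ((div_lt_one hr).2 ht2')
  refine hgeo.of_norm_bounded_eventually_nat ?_
  filter_upwards [hev, Filter.eventually_gt_atTop 0] with n hn hn0
  have h1 : ‖laplacianL2 hT ^ n‖₊ ≤ t ^ n := by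
    have h2 := ENNReal.rpow_le_rpow hn.le (z := (n : ℝ)) (by positivity)
    rw [← ENNReal.rpow_mul, one_div, inv_mul_cancel₀ (by positivity), ENNReal.rpow_one,
      ENNReal.rpow_natCast] at h2
    exact_mod_cast h2
  have h3 : ‖laplacianL2 hT ^ n‖ ≤ (t : ℝ) ^ n := by exact_mod_cast h1
  rw [Real.norm_of_nonneg (by positivity), div_pow, div_eq_mul_inv]
  gcongr

open Classical in
/-- The first-visit probabilities are dominated by the transition probabilities
`⟨μ₁ⁿ δ_v, δ_u⟩`. -/
theorem firstVisit_le (hT : IsSemihomogeneous G v₀ qp qm) (n : ℕ) (u v : V) :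
    0 ≤ firstVisit G n u v ∧
      ∃ r : ℝ, firstVisit G n u v ≤ r ∧ ((laplacianL2 hT ^ n) (lp.single 2 v (1 : ℂ))) u = r := by
  induction n generalizing u with
  | zero =>
    refine ⟨by unfold firstVisit; split_ifs <;> norm_num, firstVisit G 0 u v, le_rfl, ?_⟩
    by_cases h : u = v
    · subst h; simp [firstVisit]
    · simp [firstVisit, h, lp.single_apply]
  | succ n ih =>
    choose h0 r hr hr' using ih
    have hd : 0 ≤ (G.degree u : ℝ)⁻¹ := by positivity
    refine ⟨?_, (G.degree u : ℝ)⁻¹ * ∑ w ∈ G.neighborFinset u, r w, ?_, ?_⟩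
    · unfold firstVisit
      split_ifs
      · rfl
      · exact mul_nonneg hd (Finset.sum_nonneg fun w _ => h0 w)
    · have : 0 ≤ (G.degree u : ℝ)⁻¹ * ∑ w ∈ G.neighborFinset u, r w :=
        mul_nonneg hd (Finset.sum_nonneg fun w _ => (h0 w).trans (hr w))
      rw [firstVisit]
      split_ifs
      · exact this
      · exact mul_le_mul_of_nonneg_left (Finset.sum_le_sum fun w _ => hr w) hd
    · rw [pow_succ', mul_apply_eq_comp, laplacianL2_apply, laplacian]
      simp only [hr']
      push_cast
      rfl

/-- The first-visit generating function is square-summable in its first variable and solves the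
same equations as `F(·, v)`, so the two coincide. -/
theorem hasSum_firstVisit (hT : IsSemihomogeneous G v₀ qp qm) {γ : ℂ}
    (h : rho hT < ENNReal.ofReal ‖γ‖) (u v : V) :
    HasSum (fun n : ℕ => (firstVisit G n u v : ℂ) * (γ ^ n)⁻¹) (F G v₀ qp qm γ u v) := by
  classical
  have hγ := notMem_spectrumL2_of_rho_lt hT h
  obtain ⟨hγ0, hlt⟩ := norm_FF_sq_lt_one_of_notMem hT hγ
  have hqp : qp ≠ 0 := by have := hT.one_lt_plus; omega
  have hqm : qm ≠ 0 := by have := hT.one_lt_minus; omega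
  have hF := isHittingPair_F hqp hqm hγ0
  have hr : 0 < ‖γ‖ := norm_pos_iff.2 hγ0
  -- the Neumann series at `|γ|` dominates the generating function
  set δ : lp (fun _ : V => ℂ) 2 := lp.single 2 v (1 : ℂ)
  have hsum : Summable fun n : ℕ => (((‖γ‖ ^ n)⁻¹ : ℝ) : ℂ) • (laplacianL2 hT ^ n) δ := by
    refine Summable.of_norm_bounded ((summable_pow_of_rho_lt hT hr h).mul_right ‖δ‖) fun n => ?_
    rw [norm_smul, Complex.norm_real, Real.norm_of_nonneg (by positivity), mul_comm, mul_right_comm]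
    gcongr
    exact ContinuousLinearMap.le_opNorm _ _
  obtain ⟨g, hg⟩ := hsum
  have hgu : ∀ u,
      HasSum (fun n : ℕ => (((‖γ‖ ^ n)⁻¹ : ℝ) : ℂ) * ((laplacianL2 hT ^ n) δ) u) (g u) :=
    fun u => (lp.evalCLM ℂ (fun _ : V => ℂ) 2 u).hasSum hg
  have hdom : ∀ u n, ‖(firstVisit G n u v : ℂ) * (γ ^ n)⁻¹‖
      ≤ ((((‖γ‖ ^ n)⁻¹ : ℝ) : ℂ) * ((laplacianL2 hT ^ n) δ) u).re := by
    intro u n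
    obtain ⟨h0, r, hr1, hr2⟩ := firstVisit_le hT n u v
    rw [hr2, ← Complex.ofReal_mul, Complex.ofReal_re, norm_mul, norm_inv, norm_pow,
      Complex.norm_real, Real.norm_of_nonneg h0, mul_comm]
    gcongr
  have hre : ∀ u, HasSum (fun n : ℕ => ((((‖γ‖ ^ n)⁻¹ : ℝ) : ℂ) *
      ((laplacianL2 hT ^ n) δ) u).re) (g u).re := fun u => Complex.hasSum_re (hgu u)
  have hs : ∀ u, Summable fun n : ℕ => (firstVisit G n u v : ℂ) * (γ ^ n)⁻¹ :=
    fun u => Summable.of_norm_bounded (hre u).summable (hdom u)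
  set H : V → ℂ := fun u => ∑' n, (firstVisit G n u v : ℂ) * (γ ^ n)⁻¹ with hH
  have hHsq : Summable fun u => ‖H u‖ ^ 2 := by
    refine Summable.of_nonneg_of_le (fun u => by positivity) (fun u => ?_) (summable_sq_of_lp g)
    have : ‖H u‖ ≤ ‖g u‖ :=
      (tsum_of_norm_bounded (hre u) (hdom u)).trans (Complex.re_le_norm _)
    gcongr
  have hHv : H v = 1 := by
    have : ∀ n : ℕ, n ≠ 0 → (firstVisit G n v v : ℂ) * (γ ^ n)⁻¹ = 0 := by
      intro n hn
      obtain ⟨m, rfl⟩ := Nat.exists_eq_succ_of_ne_zero hn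
      simp [firstVisit]
    rw [hH]
    simp only
    rw [tsum_eq_single 0 this]
    simp [firstVisit]
  have hHlap : ∀ u, u ≠ v → laplacian G H u = γ * H u := by
    intro u hu
    have h1 : H u = ∑' n, (firstVisit G (n + 1) u v : ℂ) * (γ ^ (n + 1))⁻¹ := by
      rw [hH]
      simp only
      rw [(hs u).tsum_eq_zero_add]
      simp [firstVisit, hu]
    rw [h1, ← tsum_mul_left, laplacian, hH, ← Summable.tsum_finsetSum fun w _ => hs w,
      ← tsum_mul_left]
    refine tsum_congr fun n => ?_
    rw [firstVisit, if_neg hu, ← Finset.sum_mul]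
    push_cast
    field_simp
    ring
  have hFlap := fun u (hu : u ≠ v) =>
    laplacian_multiplicative hT hF hF.plus_ne_zero hF.minus_ne_zero hu
  have hFsq := summable_multiplicative hT hlt v
  have hDsq : Summable fun u => ‖H u - F G v₀ qp qm γ u v‖ ^ 2 := by
    refine Summable.of_nonneg_of_le (fun u => by positivity) (fun u => ?_)
      ((hHsq.mul_left 2).add (hFsq.mul_left 2))
    have h1 := norm_sub_le (H u) (F G v₀ qp qm γ u v)
    have h2 := pow_le_pow_left₀ (norm_nonneg _) h1 2
    refine h2.trans ?_
    unfold F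
    nlinarith [sq_nonneg (‖H u‖ - ‖multiplicative G v₀ (Fplus qp qm γ) (Fminus qp qm γ) u v‖)]
  have hD := eq_zero_of_laplacian_eq hT hγ hDsq (v := v)
    (by rw [hHv, F, multiplicative_self, sub_self]) (fun w hw => by
      have h1 := hHlap w hw
      have h2 := hFlap w hw
      rw [laplacian] at h1 h2 ⊢
      rw [Finset.sum_sub_distrib, mul_sub, h1, mul_sub]
      congr 1) u
  rw [← sub_eq_zero.1 hD]
  exact (hs u).hasSum

end SemihomTree

/-! ### The equidistributed boundary measure -/

namespace SemihomTree

open MeasureTheory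

variable {V : Type*} {G : SimpleGraph V} [G.LocallyFinite] {v₀ : V} {qp qm : ℕ}

theorem borel_boundary_eq (hG : G.IsTree) (v₀ : V) :
    borel (Boundary G) = MeasurableSpace.generateFrom (Set.range (arc G v₀)) := by
  have := countable_vertices hG
  apply le_antisymm
  · have hc : {A : Set (Boundary G) | ∃ u v, A = arc G u v}.Countable :=
      (Set.countable_range fun p : V × V => arc G p.1 p.2).mono
        (by rintro _ ⟨u, v, rfl⟩; exact ⟨(u, v), rfl⟩)
    have hsc : SecondCountableTopology (Boundary G) := ⟨⟨_, hc, rfl⟩⟩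
    rw [borel_eq_generateFrom_of_subbasis (s := {A | ∃ u v, A = arc G u v}) rfl]
    refine MeasurableSpace.generateFrom_le ?_
    rintro _ ⟨u, v, rfl⟩
    -- an arc is a union of fibres of the map to a sufficiently distant vertex on the ray from `v₀`
    set n := G.dist v₀ u + G.dist u v
    have : arc G u v = ⋃ w ∈ (fun ω => pt hG v₀ ω n) '' arc G u v,
        (fun ω => pt hG v₀ ω n) ⁻¹' {w} := by
      ext ω
      simp only [Set.mem_image, Set.mem_iUnion, Set.mem_preimage, Set.mem_singleton_iff,
        exists_prop, exists_eq_right']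
      constructor
      · intro h
        exact ⟨ω, h, rfl⟩
      · rintro ⟨ω', h, h'⟩
        exact mem_arc_of_pt_eq hG h' h
    rw [this]
    refine @MeasurableSet.biUnion _ _ (MeasurableSpace.generateFrom (Set.range (arc G v₀))) _ _
      (Set.to_countable _) fun w _ => ?_
    rw [preimage_pt_singleton]
    split_ifs
    · exact MeasurableSpace.measurableSet_generateFrom ⟨w, rfl⟩
    · exact @MeasurableSet.empty _ (MeasurableSpace.generateFrom (Set.range (arc G v₀)))
  · refine MeasurableSpace.generateFrom_le ?_
    rintro _ ⟨v, rfl⟩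
    exact MeasurableSpace.measurableSet_generateFrom
      (TopologicalSpace.isOpen_generateFrom_of_mem ⟨_, _, rfl⟩)

omit [G.LocallyFinite] in
theorem isPiSystem_arcs (hG : G.IsTree) (v₀ : V) : IsPiSystem (Set.range (arc G v₀)) := by
  have key : ∀ v w ω, ω ∈ arc G v₀ v → ω ∈ arc G v₀ w → G.dist v₀ v ≤ G.dist v₀ w →
      arc G v₀ w ⊆ arc G v₀ v := by
    intro v w ω hv hw hle ω' hw'
    change _ ∈ geodesic G v₀ _ at hv hw hw' ⊢
    rw [mem_geodesic_iff_pt_dist hG] at hv hw hw' ⊢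
    rw [pt_eq_of_le hG (hw'.trans hw.symm) _ hle, hv]
  rintro _ ⟨v, rfl⟩ _ ⟨w, rfl⟩ ⟨ω, hv, hw⟩
  rcases le_total (G.dist v₀ v) (G.dist v₀ w) with h | h
  · exact ⟨w, (Set.inter_eq_right.2 (key v w ω hv hw h)).symm⟩
  · exact ⟨v, (Set.inter_eq_left.2 (key w v ω hw hv h)).symm⟩

omit [G.LocallyFinite] in
theorem isEquidistributed_iff {ν : Measure (Boundary G)} :
    IsEquidistributed G v₀ ν ↔
      ∀ v, ν (arc G v₀ v) = ((sphereCard G v₀ (G.dist v₀ v) : ℕ) : ℝ≥0∞)⁻¹ := Iff.rfl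

omit [G.LocallyFinite] in
theorem arc_self (hG : G.IsTree) (v : V) : arc G v v = Set.univ :=
  Set.eq_univ_of_forall fun ω => (mem_geodesic_iff hG v ω).2 ⟨0, pt_zero hG v ω⟩

omit [G.LocallyFinite] in
theorem IsEquidistributed.isProbabilityMeasure (hG : G.IsTree) {ν : Measure (Boundary G)}
    (h : IsEquidistributed G v₀ ν) : IsProbabilityMeasure ν := by
  refine ⟨?_⟩
  rw [← arc_self hG v₀, isEquidistributed_iff.1 h v₀, SimpleGraph.dist_self, sphereCard_zero hG]
  simp

theorem IsEquidistributed.unique (hG : G.IsTree) {ν ν' : Measure (Boundary G)}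
    (h : IsEquidistributed G v₀ ν) (h' : IsEquidistributed G v₀ ν') : ν' = ν := by
  have := h.isProbabilityMeasure hG
  have := h'.isProbabilityMeasure hG
  refine ext_of_generate_finite _ (borel_boundary_eq hG v₀) (isPiSystem_arcs hG v₀) ?_ (by simp)
  rintro _ ⟨v, rfl⟩
  rw [h v, h' v]

section construction

/-- A choice of a child for each vertex. -/
abbrev ChildChoice (G : SimpleGraph V) [G.LocallyFinite] (v₀ : V) : Type _ :=
  ∀ v : V, {w // w ∈ children G v₀ v}

/-- The descending path from `v₀` that follows the chosen children. -/
def descend (c : ChildChoice G v₀) : ℕ → V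
  | 0 => v₀
  | n + 1 => (c (descend c n)).1

theorem dist_descend (c : ChildChoice G v₀) (n : ℕ) : G.dist v₀ (descend c n) = n := by
  induction n with
  | zero => simp [descend]
  | succ n ih =>
    rw [descend, (mem_children.1 (c (descend c n)).2).2, ih]

/-- The ray from `v₀` that follows the chosen children. -/
def descendRay (c : ChildChoice G v₀) : Ray G where
  toFun := descend c
  adj n := (mem_children.1 (c (descend c n)).2).1
  no_backtrack n h := by
    have h1 := dist_descend c n
    rw [h, dist_descend] at h1
    omega

/-- The end of the ray that follows the chosen children. -/
def descendEnd (c : ChildChoice G v₀) : Boundary G := Quotient.mk (raySetoid G) (descendRay c)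

theorem descendEnd_mem_arc (hG : G.IsTree) (c : ChildChoice G v₀) (w : V) :
    descendEnd c ∈ arc G v₀ w ↔ descend c (G.dist v₀ w) = w := by
  change w ∈ geodesic G v₀ _ ↔ _
  rw [mem_geodesic_iff_pt_dist hG]
  exact (congrFun (pt_eq_of_ray hG (descendEnd c) (x := descendRay c) rfl) (G.dist v₀ w)).congr_left

omit [G.LocallyFinite] in
theorem exists_descending_path (hG : G.IsTree) (w : V) :
    ∃ y : ℕ → V, y (G.dist v₀ w) = w ∧ (∀ i ≤ G.dist v₀ w, G.dist v₀ (y i) = i) ∧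
      ∀ i < G.dist v₀ w, G.Adj (y i) (y (i + 1)) := by
  generalize hn : G.dist v₀ w = n
  induction n generalizing w with
  | zero => exact ⟨fun _ => w, rfl, fun i hi => by rw [hn]; omega, fun i hi => by omega⟩
  | succ n ih =>
    have hne : w ≠ v₀ := by rintro rfl; simp at hn
    obtain ⟨v, hv, hd⟩ := exists_adj_dist_eq_add_one hG hne
    rw [G.dist_comm, G.dist_comm (u := v)] at hd
    obtain ⟨y, h1, h2, h3⟩ := ih v (by omega)
    refine ⟨fun i => if i ≤ n then y i else w, by simp, fun i hi => ?_, fun i hi => ?_⟩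
    · by_cases h : i ≤ n
      · simp [h, h2 i h]
      · simp only [h, if_false, hn]
        omega
    · by_cases h : i + 1 ≤ n
      · simp only [h, (by omega : i ≤ n), if_true]
        exact h3 i h
      · obtain rfl : i = n := by omega
        simpa [h1] using hv.symm

theorem descend_eq_iff (hG : G.IsTree) (c : ChildChoice G v₀) {n : ℕ} {y : ℕ → V}
    (hy : ∀ i ≤ n, G.dist v₀ (y i) = i) (hadj : ∀ i < n, G.Adj (y i) (y (i + 1))) :
    descend c n = y n ↔ ∀ i < n, (c (y i)).1 = y (i + 1) := by
  have h0 : y 0 = v₀ := by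
    have := hy 0 (Nat.zero_le n)
    exact (hG.connected.dist_eq_zero_iff.1 this).symm
  constructor
  · intro h
    have hall : ∀ k ≤ n, descend c (n - k) = y (n - k) := by
      intro k
      induction k with
      | zero => intro _; exact h
      | succ k ih =>
        intro hk
        have h1 := ih (by omega)
        obtain ⟨m, hm⟩ : ∃ m, n - k = m + 1 := ⟨n - k - 1, by omega⟩
        have hm' : n - (k + 1) = m := by omega
        rw [hm] at h1
        rw [hm']
        refine eq_of_adj_of_dist_eq_add_one hG ((descendRay c).adj m).symm
          (w' := y m) (j := v₀) ?_ ?_ ?_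
        · change G.Adj (descend c (m + 1)) (y m)
          rw [h1]; exact (hadj m (by omega)).symm
        · change G.dist (descend c (m + 1)) v₀ = G.dist (descend c m) v₀ + 1
          rw [G.dist_comm, dist_descend, G.dist_comm, dist_descend]
        · change G.dist (descend c (m + 1)) v₀ = G.dist (y m) v₀ + 1
          rw [G.dist_comm, dist_descend, G.dist_comm, hy m (by omega)]
    intro i hi
    have h1 := hall (n - i) (by omega)
    have h2 := hall (n - (i + 1)) (by omega)
    rw [show n - (n - i) = i by omega] at h1
    rw [show n - (n - (i + 1)) = i + 1 by omega] at h2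
    rw [← h2, descend, h1]
  · intro h
    have hall : ∀ k ≤ n, descend c k = y k := by
      intro k
      induction k with
      | zero => intro _; exact h0.symm
      | succ k ih =>
        intro hk
        rw [descend, ih (by omega), h k (by omega)]
    exact hall n le_rfl

theorem inv_sphereCard_eq_prod (hT : IsSemihomogeneous G v₀ qp qm) (n : ℕ) :
    ((sphereCard G v₀ n : ℕ) : ℝ≥0∞)⁻¹
      = ∏ i ∈ Finset.range n, ((branching qp qm i : ℕ) : ℝ≥0∞)⁻¹ := by
  induction n with
  | zero => simp [sphereCard_zero hT.isTree]
  | succ n ih =>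
    rw [Finset.prod_range_succ, ← ih, sphereCard_succ hT, Nat.cast_mul, ENNReal.mul_inv]
    · exact Or.inr (ENNReal.natCast_ne_top _)
    · exact Or.inl (ENNReal.natCast_ne_top _)

/-- Choosing a child of each vertex independently and uniformly yields a random ray from `v₀`
whose end is equidistributed. -/
theorem exists_isEquidistributed (hT : IsSemihomogeneous G v₀ qp qm) :
    ∃ ν : Measure (Boundary G), IsEquidistributed G v₀ ν := by
  classical
  have hG := hT.isTree
  have hqp := hT.one_lt_plus
  have hqm := hT.one_lt_minus
  have hne : ∀ v, Nonempty {w // w ∈ children G v₀ v} := by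
    intro v
    have : 0 < (children G v₀ v).card := by
      rw [card_children hT, branching]
      split_ifs <;> omega
    obtain ⟨w, hw⟩ := Finset.card_pos.1 this
    exact ⟨⟨w, hw⟩⟩
  let _ : ∀ v, MeasurableSpace {w // w ∈ children G v₀ v} := fun _ => ⊤
  have : ∀ v, DiscreteMeasurableSpace {w // w ∈ children G v₀ v} := fun _ => ⟨fun _ => trivial⟩
  set μ : ∀ v, Measure {w // w ∈ children G v₀ v} :=
    fun v => (PMF.uniformOfFintype {w // w ∈ children G v₀ v}).toMeasure
  -- the event that the random ray passes through `w` is a box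
  have hbox : ∀ w, MeasurableSet {c : ChildChoice G v₀ | descendEnd c ∈ arc G v₀ w} ∧
      Measure.infinitePi μ {c : ChildChoice G v₀ | descendEnd c ∈ arc G v₀ w}
        = ((sphereCard G v₀ (G.dist v₀ w) : ℕ) : ℝ≥0∞)⁻¹ := by
    intro w
    obtain ⟨y, hyn, hyd, hadj⟩ := exists_descending_path (v₀ := v₀) hG w
    set n := G.dist v₀ w
    have hset : {c : ChildChoice G v₀ | descendEnd c ∈ arc G v₀ w} =
        Set.pi ((Finset.range n).image y : Finset V)
          (fun v => {x : {w // w ∈ children G v₀ v} | x.1 = y (G.dist v₀ v + 1)}) := by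
      ext c
      have h1 := descendEnd_mem_arc hG c w
      have h2 := descend_eq_iff hG c hyd hadj
      rw [hyn] at h2
      rw [Set.mem_ofPred_eq, h1, h2]
      simp only [Set.mem_pi, Finset.coe_image, Set.mem_image, Finset.mem_coe, Finset.mem_range,
        forall_exists_index, and_imp, forall_apply_eq_imp_iff₂, Set.mem_ofPred_eq]
      refine forall₂_congr fun i hi => ?_
      rw [hyd i hi.le]
    constructor
    · rw [hset]
      exact MeasurableSet.pi (Finset.countable_toSet _) fun v _ => MeasurableSet.of_discrete
    · rw [hset, Measure.infinitePi_pi _ (fun v _ => MeasurableSet.of_discrete),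
        Finset.prod_image, inv_sphereCard_eq_prod hT]
      · refine Finset.prod_congr rfl fun i hi => ?_
        have hi' := Finset.mem_range.1 hi
        have hmem : y (i + 1) ∈ children G v₀ (y i) :=
          mem_children.2 ⟨hadj i hi', by rw [hyd i hi'.le, hyd (i + 1) hi']⟩
        have hsing : {x : {w // w ∈ children G v₀ (y i)} | x.1 = y (G.dist v₀ (y i) + 1)}
            = {⟨y (i + 1), hmem⟩} := by
          ext x
          rw [hyd i hi'.le]
          simp [Subtype.ext_iff]
        rw [hsing, PMF.toMeasure_apply_singleton _ _ (MeasurableSet.of_discrete),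
          PMF.uniformOfFintype_apply, Fintype.card_coe, card_children hT, hyd i hi'.le]
      · intro i hi j hj hij
        have h1 := hyd i (Finset.mem_range.1 hi).le
        have h2 := hyd j (Finset.mem_range.1 hj).le
        rw [← h1, hij, h2]
  have hmeas : Measurable (descendEnd : ChildChoice G v₀ → Boundary G) := by
    have h1 : Measurable[_, MeasurableSpace.generateFrom (Set.range (arc G v₀))]
        (descendEnd : ChildChoice G v₀ → Boundary G) := by
      refine measurable_generateFrom ?_
      rintro _ ⟨w, rfl⟩
      exact (hbox w).1
    rw [← borel_boundary_eq hG v₀] at h1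
    exact h1
  refine ⟨(Measure.infinitePi μ).map descendEnd, fun w => ?_⟩
  rw [Measure.map_apply hmeas]
  · exact (hbox w).2
  · exact (TopologicalSpace.isOpen_generateFrom_of_mem ⟨_, _, rfl⟩ :
      IsOpen (arc G v₀ w)).measurableSet

end construction

/-! ### Spherical functions -/

/-- A radial eigenfunction is determined by its value at the base vertex, since its values on
the spheres satisfy a recurrence of second order. -/
theorem IsSphericalFunction.unique (hT : IsSemihomogeneous G v₀ qp qm) {γ : ℂ} {f f' : V → ℂ}
    (hf : IsSphericalFunction G v₀ γ f) (hf' : IsSphericalFunction G v₀ γ f') : f = f' := by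
  have hG := hT.isTree
  have key : ∀ n v, G.dist v₀ v = n → f v = f' v := by
    intro n
    induction n using Nat.strong_induction_on with
    | _ n ih =>
    intro v hv
    match n, ih, hv with
    | 0, _, hv =>
      obtain rfl := hG.connected.dist_eq_zero_iff.1 hv
      rw [hf.normalized, hf'.normalized]
    | 1, _, hv =>
      have hadj := SimpleGraph.dist_eq_one_iff_adj.1 hv
      have hval : ∀ {g : V → ℂ}, IsSphericalFunction G v₀ γ g → g v = γ := by
        intro g hg
        have h1 := hg.eigenfunction v₀
        rw [hT.laplacian_eq hadj (y := g v) (fun w h _ => hg.radial _ _ (by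
          rw [SimpleGraph.dist_eq_one_iff_adj.2 h, hv])), hg.normalized, mul_one,
          inv_mul_eq_iff_eq_mul₀ (Nat.cast_add_one_ne_zero _)] at h1
        refine mul_left_cancel₀
          (Nat.cast_add_one_ne_zero (R := ℂ) (classValue G v₀ qp qm v₀)) ?_
        linear_combination h1
      rw [hval hf, hval hf']
    | n + 2, ih, hv =>
      obtain ⟨v', h1, hd1⟩ := exists_adj_dist_eq_add_one hG (v := v) (j := v₀)
        (by rintro rfl; simp at hv)
      rw [G.dist_comm, G.dist_comm (u := v')] at hd1
      obtain ⟨v'', h2, hd2⟩ := exists_adj_dist_eq_add_one hG (v := v') (j := v₀)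
        (by rintro rfl; rw [SimpleGraph.dist_self] at hd1; omega)
      have hd2' : G.dist v₀ v' = G.dist v₀ v'' + 1 := by
        rwa [G.dist_comm, G.dist_comm (u := v'')] at hd2
      have hQ : ((classValue G v₀ qp qm v' : ℕ) : ℂ) ≠ 0 := by
        have : classValue G v₀ qp qm v' ≠ 0 := by
          have := hT.one_lt_plus
          have := hT.one_lt_minus
          exact classValue_cases (p := (· ≠ 0)) (by omega) (by omega) v₀ v'
        exact_mod_cast this
      have hval : ∀ {g : V → ℂ}, IsSphericalFunction G v₀ γ g →
          g v'' + ((classValue G v₀ qp qm v' : ℕ) : ℂ) * g v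
            = (((classValue G v₀ qp qm v' : ℕ) : ℂ) + 1) * (γ * g v') := by
        intro g hg
        have h3 := hg.eigenfunction v'
        rwa [hT.laplacian_eq h2 (y := g v) (fun w h hne => hg.radial _ _ (by
          rcases dist_adj_cases hG h v₀ with h4 | h4
          · exact absurd (eq_of_adj_of_dist_eq_add_one hG h h2 h4 hd2) hne
          · rw [G.dist_comm, h4, G.dist_comm]; omega)),
          inv_mul_eq_iff_eq_mul₀ (Nat.cast_add_one_ne_zero _)] at h3
      refine mul_left_cancel₀ hQ ?_
      have e1 := hval hf
      have e2 := hval hf'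
      rw [ih (n + 1) (by omega) v' (by omega), ih n (by omega) v'' (by omega)] at e1
      linear_combination e1 - e2
  exact funext fun v => key _ v rfl

section integral

variable {Ap Am : ℂ}

theorem integrable_quotientKernel (hG : G.IsTree) (hp : Ap ≠ 0) (hm : Am ≠ 0)
    (ν : Measure (Boundary G)) [IsFiniteMeasure ν] (v : V) :
    Integrable (quotientKernel G v₀ (multiplicative G v₀ Ap Am) v) ν := by
  have h := isWellDefinedKernel_quotientKernel v₀ hG hp hm
  obtain ⟨C, hC⟩ := ((h.finite_range v).image (‖·‖)).bddAbove
  refine Integrable.of_bound (h.locallyConstant v).continuous.aestronglyMeasurable C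
    (Filter.Eventually.of_forall fun ω => hC ⟨_, ⟨ω, rfl⟩, rfl⟩)

theorem isEigenfunction_integral_measure (hT : IsSemihomogeneous G v₀ qp qm) {γ : ℂ}
    (h : IsHittingPair qp qm γ Ap Am) (ν : Measure (Boundary G)) [IsFiniteMeasure ν] :
    IsEigenfunction G γ
      fun v => ∫ ω, quotientKernel G v₀ (multiplicative G v₀ Ap Am) v ω ∂ν := by
  intro v
  have hint := integrable_quotientKernel (v₀ := v₀) hT.isTree h.plus_ne_zero h.minus_ne_zero ν
  rw [laplacian, ← integral_finsetSum _ fun w _ => hint w, ← integral_const_mul,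
    ← integral_const_mul]
  exact integral_congr_ae (Filter.Eventually.of_forall fun ω =>
    isEigenfunction_quotientKernel hT h h.plus_ne_zero h.minus_ne_zero ω v)

omit [G.LocallyFinite] in
/-- A ray to `ω` that passes from `v'` to a vertex `v` farther from `v₀` continues the ray from
`v₀` to `ω`. -/
theorem mem_geodesic_of_pt_one (hG : G.IsTree) {v v' : V} {ω : Boundary G}
    (h : pt hG v' ω 1 = v) (hd : G.dist v₀ v = G.dist v₀ v' + 1) : v ∈ geodesic G v₀ ω := by
  generalize hn : G.dist v₀ v' = n
  induction n generalizing v v' with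
  | zero =>
    obtain rfl := hG.connected.dist_eq_zero_iff.1 hn
    exact h ▸ pt_mem_geodesic hG _ ω 1
  | succ n ih =>
    have hne : v' ≠ v₀ := by rintro rfl; simp at hn
    obtain ⟨v'', h1, h2⟩ := exists_adj_dist_eq_add_one hG hne
    rw [G.dist_comm, G.dist_comm (u := v'')] at h2
    rcases pt_one_of_adj hG ω h1 with h3 | h3
    · have : v = v'' := h.symm.trans h3
      subst this
      omega
    · obtain ⟨m, hm⟩ := (mem_geodesic_iff hG v₀ ω).1 (ih h3 h2 (by omega))
      exact (mem_geodesic_iff hG v₀ ω).2 ⟨m + 1, by rw [pt_add, hm, h]⟩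

omit [G.LocallyFinite] in
theorem quotientKernel_eq_indicator (hG : G.IsTree) (hp : Ap ≠ 0) (hm : Am ≠ 0) {v v' : V}
    (hadj : G.Adj v v') (hd : G.dist v₀ v = G.dist v₀ v' + 1) (ω : Boundary G) :
    quotientKernel G v₀ (multiplicative G v₀ Ap Am) v ω =
      (arc G v₀ v).indicator (fun _ => (multiplicative G v₀ Ap Am v₀ v)⁻¹ -
        classValue G v₀ Ap Am v * (multiplicative G v₀ Ap Am v₀ v')⁻¹) ω +
      classValue G v₀ Ap Am v * quotientKernel G v₀ (multiplicative G v₀ Ap Am) v' ω := by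
  have hself : ∀ u, u ∈ geodesic G u ω :=
    fun u => (mem_geodesic_iff hG u ω).2 ⟨0, pt_zero hG u ω⟩
  by_cases hω : ω ∈ arc G v₀ v
  · rw [Set.indicator_of_mem hω]
    have hv : v ∈ geodesic G v₀ ω := hω
    have hv' : v' ∈ geodesic G v₀ ω := by
      rw [mem_geodesic_iff_pt_dist hG] at hv
      rw [hd] at hv
      have h1 := pt_adj hG v₀ ω (G.dist v₀ v')
      rw [hv] at h1
      have h2 := dist_pt hG v₀ ω (G.dist v₀ v')
      refine (mem_geodesic_iff hG v₀ ω).2 ⟨G.dist v₀ v', ?_⟩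
      refine eq_of_adj_of_dist_eq_add_one hG h1.symm hadj (j := v₀) ?_ ?_
      · rw [G.dist_comm, hd, G.dist_comm (v := v₀), h2]
      · rw [G.dist_comm, hd, G.dist_comm]
    rw [quotientKernel_eq v₀ hG hp hm ⟨hself v, hv⟩, quotientKernel_eq v₀ hG hp hm ⟨hself v', hv'⟩,
      multiplicative_self, multiplicative_self]
    ring
  · rw [Set.indicator_of_notMem hω, zero_add]
    refine quotientKernel_step v₀ hG hp hm ?_
    rcases pt_one_of_adj hG ω hadj with h | h
    · exact h
    · exact absurd (mem_geodesic_of_pt_one hG h hd) hω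

theorem isSphericalFunction_integral (hT : IsSemihomogeneous G v₀ qp qm) {γ : ℂ}
    (h : IsHittingPair qp qm γ Ap Am) {ν : Measure (Boundary G)}
    (hν : IsEquidistributed G v₀ ν) :
    IsSphericalFunction G v₀ γ
      fun v => ∫ ω, quotientKernel G v₀ (multiplicative G v₀ Ap Am) v ω ∂ν := by
  have hG := hT.isTree
  have hp := h.plus_ne_zero
  have hm := h.minus_ne_zero
  have := hν.isProbabilityMeasure hG
  have hstep : ∀ v v', G.Adj v v' → G.dist v₀ v = G.dist v₀ v' + 1 →
      ∫ ω, quotientKernel G v₀ (multiplicative G v₀ Ap Am) v ω ∂ν =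
        ν.real (arc G v₀ v) • ((multiplicative G v₀ Ap Am v₀ v)⁻¹ -
          classValue G v₀ Ap Am v * (multiplicative G v₀ Ap Am v₀ v')⁻¹) +
        classValue G v₀ Ap Am v *
          ∫ ω, quotientKernel G v₀ (multiplicative G v₀ Ap Am) v' ω ∂ν := by
    intro v v' hadj hd
    have hmeas : MeasurableSet (arc G v₀ v) :=
      (TopologicalSpace.isOpen_generateFrom_of_mem ⟨_, _, rfl⟩ : IsOpen (arc G v₀ v)).measurableSet
    rw [funext (quotientKernel_eq_indicator hG hp hm hadj hd), integral_add, integral_const_mul,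
      integral_indicator_const _ hmeas]
    · exact (integrable_const _).indicator hmeas
    · exact (integrable_quotientKernel hG hp hm ν v').const_mul _
  refine ⟨fun v w hvw => ?_, ?_, isEigenfunction_integral_measure hT h ν⟩
  · generalize hn : G.dist v₀ v = n at hvw
    induction n generalizing v w with
    | zero =>
      obtain rfl := hG.connected.dist_eq_zero_iff.1 hn
      rw [hG.connected.dist_eq_zero_iff.1 hvw.symm]
    | succ n ih =>
      obtain ⟨v', hv1, hv2⟩ := exists_adj_dist_eq_add_one hG (v := v) (j := v₀)
        (by rintro rfl; simp at hn)
      obtain ⟨w', hw1, hw2⟩ := exists_adj_dist_eq_add_one hG (v := w) (j := v₀)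
        (by rintro rfl; simp at hvw)
      rw [G.dist_comm, G.dist_comm (u := v')] at hv2
      rw [G.dist_comm, G.dist_comm (u := w')] at hw2
      have hrad : ∀ u u', G.dist v₀ u = G.dist v₀ u' →
          multiplicative G v₀ Ap Am v₀ u = multiplicative G v₀ Ap Am v₀ u' := by
        intro u u' huu
        simp only [multiplicative, huu]
      have hc : classValue G v₀ Ap Am v = classValue G v₀ Ap Am w := by
        simp only [classValue, hn, ← hvw]
      have hνr : ν.real (arc G v₀ v) = ν.real (arc G v₀ w) := by
        rw [measureReal_def, measureReal_def, hν v, hν w, hn, ← hvw]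
      rw [hstep v v' hv1 hv2, hstep w w' hw1 hw2, hc, hνr, hrad v w (by omega),
        hrad v' w' (by omega)]
      have := ih v' w' (by omega) (by omega)
      rw [this]
  · simp only [quotientKernel_base v₀ hG hp hm]
    simp

end integral

end SemihomTree

/-! ### Positive and minimal eigenfunctions -/

namespace SemihomTree

variable {V : Type*} {G : SimpleGraph V} {v₀ : V} {qp qm : ℕ}

theorem exists_real_multiplicative (G : SimpleGraph V) (v₀ : V) {fp fm gp gm : ℝ} (hp : 0 < fp)
    (hm : 0 < fm) (hpg : fp ≤ gp) (hmg : fm ≤ gm) (u v : V) :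
    ∃ r r' : ℝ, multiplicative G v₀ fp fm u v = r ∧ multiplicative G v₀ gp gm u v = r' ∧
      0 < r ∧ r ≤ r' := by
  have hgp := hp.le.trans hpg
  have hgm := hm.le.trans hmg
  unfold multiplicative
  split_ifs
  · exact ⟨fp ^ ((G.dist u v + 1) / 2) * fm ^ (G.dist u v / 2),
      gp ^ ((G.dist u v + 1) / 2) * gm ^ (G.dist u v / 2), by push_cast; rfl, by push_cast; rfl,
      by positivity, by gcongr⟩
  · exact ⟨fm ^ ((G.dist u v + 1) / 2) * fp ^ (G.dist u v / 2),
      gm ^ ((G.dist u v + 1) / 2) * gp ^ (G.dist u v / 2), by push_cast; rfl, by push_cast; rfl,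
      by positivity, by gcongr⟩

theorem exists_real_quotientKernel (hG : G.IsTree) (v₀ : V) {fp fm : ℝ} (hp : 0 < fp)
    (hm : 0 < fm) (ω : Boundary G) :
    ∃ k : V → ℝ, (∀ v, 0 < k v) ∧
      ∀ v, quotientKernel G v₀ (multiplicative G v₀ fp fm) v ω = k v := by
  choose r r' hr _ hr0 _ using exists_real_multiplicative G v₀ hp hm le_rfl le_rfl
  choose j hj using fun v => geodesic_inter_nonempty hG v₀ v ω
  refine ⟨fun v => r v (j v) / r v₀ (j v), fun v => div_pos (hr0 _ _) (hr0 _ _), fun v => ?_⟩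
  rw [quotientKernel_eq v₀ hG (by exact_mod_cast hp.ne') (by exact_mod_cast hm.ne') (hj v), hr, hr]
  push_cast
  rfl

variable [G.LocallyFinite]

/-- Above the spectral radius `Γ` exceeds `(√q₊ + √q₋)²`: the value of `γ` at which the two are
equal is in the spectrum. -/
theorem lt_of_rho_lt (hT : IsSemihomogeneous G v₀ qp qm) {γ : ℝ}
    (h : rho hT < ENNReal.ofReal γ) :
    0 < γ ∧ (√qp + √qm) ^ 2 < ((qp : ℝ) + 1) * (qm + 1) * γ ^ 2 := by
  have hγ : 0 < γ := by
    by_contra hγ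
    rw [ENNReal.ofReal_of_nonpos (not_lt.1 hγ)] at h
    exact not_lt_bot h
  refine ⟨hγ, ?_⟩
  have hqp : qp ≠ 0 := by have := hT.one_lt_plus; omega
  have hqm : qm ≠ 0 := by have := hT.one_lt_minus; omega
  have hqp' : (0 : ℝ) < qp := by positivity
  by_contra hlt
  set D : ℝ := ((qp : ℝ) + 1) * (qm + 1) with hD
  have hDpos : 0 < D := by positivity
  set δ : ℝ := √((√qp + √qm) ^ 2 / D)
  have hδsq : D * δ ^ 2 = (√qp + √qm) ^ 2 := by
    rw [Real.sq_sqrt (by positivity)]; field_simp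
  have hδ : 0 < δ := Real.sqrt_pos.2 (by positivity)
  have hle : γ ≤ δ := by
    rw [← abs_of_pos hγ]
    refine Real.abs_le_sqrt ?_
    rw [le_div_iff₀ hDpos]
    linarith
  have hmem : (δ : ℂ) ∉ spectrumL2 hT := by
    refine notMem_spectrumL2_of_rho_lt hT (h.trans_le ?_)
    rw [Complex.norm_real, Real.norm_of_nonneg hδ.le]
    exact ENNReal.ofReal_le_ofReal hle
  obtain ⟨h0, h1⟩ := norm_FF_sq_lt_one_of_notMem hT hmem
  refine h1.ne (norm_FF_sq_eq_one_of_rootR_eq_zero hqp hqm h0 ?_)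
  rw [← pow_eq_zero_iff (two_ne_zero), rootR_sq, ← sub_mul_sub_eq]
  have : bigGamma qp qm (δ : ℂ) = (((√qp + √qm) ^ 2 : ℝ) : ℂ) := by
    rw [← hδsq, bigGamma, hD]; push_cast; rfl
  rw [this, sub_self, mul_zero]

/-- In the branch of a vertex `j` away from `ω`, an eigenfunction dominated by a multiple of the
square-summable function `F(·, j)` is a multiple of it. Hence an eigenfunction dominated by
`P(·, ω)` is a multiple of `P(·, ω)`. -/
theorem eq_mul_of_le_quotientKernel (hT : IsSemihomogeneous G v₀ qp qm) {γ Ap Am : ℂ}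
    (hγ : γ ∉ spectrumL2 hT) (hA : IsHittingPair qp qm γ Ap Am)
    (hlt : (qp * qm : ℝ) * ‖Ap * Am‖ ^ 2 < 1) {ω : Boundary G} {h : V → ℂ}
    (hh : IsEigenfunction G γ h)
    (hle : ∀ v, ‖h v‖ ≤ ‖quotientKernel G v₀ (multiplicative G v₀ Ap Am) v ω‖) (v : V) :
    h v = h v₀ * quotientKernel G v₀ (multiplicative G v₀ Ap Am) v ω := by
  classical
  have hG := hT.isTree
  have hp := hA.plus_ne_zero
  have hm := hA.minus_ne_zero
  have key : ∀ j v, j ∈ geodesic G v ω → h v = multiplicative G v₀ Ap Am v j * h j := by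
    intro j
    set D : V → ℂ := fun u =>
      if j ∈ geodesic G u ω then h u - multiplicative G v₀ Ap Am u j * h j else 0 with hD
    have hj : j ∈ geodesic G j ω := (mem_geodesic_iff hG j ω).2 ⟨0, pt_zero hG j ω⟩
    have hDj : D j = 0 := by simp [hD, hj, multiplicative_self]
    have hDsum : Summable fun u => ‖D u‖ ^ 2 := by
      refine Summable.of_nonneg_of_le (fun u => by positivity) (fun u => ?_)
        ((summable_multiplicative hT hlt j).mul_left
          ((‖quotientKernel G v₀ (multiplicative G v₀ Ap Am) j ω‖ + ‖h j‖) ^ 2))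
      rw [← mul_pow]
      gcongr
      by_cases hu : j ∈ geodesic G u ω
      · simp only [hD, hu, if_true]
        have h1 := hle u
        rw [quotientKernel_of_mem_geodesic v₀ hG hp hm hu, norm_mul] at h1
        calc _ ≤ ‖h u‖ + ‖multiplicative G v₀ Ap Am u j * h j‖ := norm_sub_le _ _
          _ ≤ _ := by rw [norm_mul]; linarith
      · simp only [hD, hu, if_false, norm_zero]
        positivity
    have hDlap : ∀ u, u ≠ j → laplacian G D u = γ * D u := by
      intro u hu
      by_cases hB : j ∈ geodesic G u ω
      · have h1 := hh u
        have h2 := laplacian_multiplicative hT hA hp hm hu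
        rw [laplacian] at h1 h2 ⊢
        have h3 : ∀ w ∈ G.neighborFinset u,
            D w = h w - multiplicative G v₀ Ap Am w j * h j := by
          intro w hw
          have := mem_geodesic_of_adj hG (show G.Adj u w by simpa using hw) hB hu
          simp [hD, this]
        rw [Finset.sum_congr rfl h3, Finset.sum_sub_distrib, ← Finset.sum_mul]
        simp only [hD, hB, if_true]
        linear_combination h1 - h j * h2
      · have h3 : ∀ w ∈ G.neighborFinset u, D w = 0 := by
          intro w hw
          by_cases hwB : j ∈ geodesic G w ω
          · by_cases hwj : w = j
            · rw [hwj, hDj]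
            · exact absurd (mem_geodesic_of_adj hG
                (show G.Adj w u by simpa [G.adj_comm] using hw) hwB hwj) hB
          · simp [hD, hwB]
        rw [laplacian, Finset.sum_eq_zero h3]
        simp [hD, hB]
    intro v hv
    have := eq_zero_of_laplacian_eq hT hγ hDsum hDj hDlap v
    simp only [hD, hv, if_true] at this
    exact sub_eq_zero.1 this
  obtain ⟨j, hj, hj0⟩ := geodesic_inter_nonempty hG v₀ v ω
  have hne := multiplicative_ne_zero (G := G) v₀ hp hm v₀ j
  rw [quotientKernel_eq v₀ hG hp hm ⟨hj, hj0⟩, key j v hj, key j v₀ hj0]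
  field_simp

theorem isPositiveEigenfunction_quotientKernel (hT : IsSemihomogeneous G v₀ qp qm) {γ fp fm : ℝ}
    (hp : 0 < fp) (hm : 0 < fm) (h : IsHittingPair qp qm (γ : ℂ) fp fm) (ω : Boundary G) :
    IsPositiveEigenfunction G γ
      fun v => quotientKernel G v₀ (multiplicative G v₀ fp fm) v ω := by
  obtain ⟨k, hk, hk'⟩ := exists_real_quotientKernel hT.isTree v₀ hp hm ω
  exact ⟨isEigenfunction_quotientKernel hT h h.plus_ne_zero h.minus_ne_zero ω, k, hk, hk'⟩

theorem isMinimalEigenfunction_quotientKernel (hT : IsSemihomogeneous G v₀ qp qm) {γ fp fm : ℝ}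
    (hγ : (γ : ℂ) ∉ spectrumL2 hT) (hp : 0 < fp) (hm : 0 < fm)
    (h : IsHittingPair qp qm (γ : ℂ) fp fm)
    (hlt : (qp * qm : ℝ) * ‖(fp * fm : ℂ)‖ ^ 2 < 1) (ω : Boundary G) :
    IsMinimalEigenfunction G γ
      fun v => quotientKernel G v₀ (multiplicative G v₀ fp fm) v ω := by
  refine ⟨isPositiveEigenfunction_quotientKernel hT hp hm h ω, fun u hu hue hle => ?_⟩
  refine ⟨u v₀, fun v => eq_mul_of_le_quotientKernel hT hγ h hlt hue (fun w => ?_) v⟩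
  rw [Complex.norm_real, Real.norm_of_nonneg (hu w)]
  exact (hle w).trans (Complex.re_le_norm _)

/-- The kernel with the larger factors is not minimal. For a neighbour `b` of `v₀` off the ray to
`ω`, the eigenfunction that equals a multiple of `F(·, b)` off the branch of `b` and
`P̃(·, ω) - t F(·, v₀)` on it lies below `P̃(·, ω)`, but is not a multiple of it: in the first step
from `v₀` to `ω` it is multiplied by `F⁻`, and `P̃(·, ω)` by `1 / F̃⁺ > F⁻`. -/
theorem not_isMinimalEigenfunction_quotientKernel (hT : IsSemihomogeneous G v₀ qp qm)
    {γ fp fm gp gm : ℝ} (hp : 0 < fp) (hm : 0 < fm) (hpg : fp < gp) (hmg : fm < gm)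
    (hpm : fp * gm < 1) (hmp : fm * gp < 1) (hf : IsHittingPair qp qm (γ : ℂ) fp fm)
    (hg : IsHittingPair qp qm (γ : ℂ) gp gm) (ω : Boundary G) :
    ¬ IsMinimalEigenfunction G γ
      fun v => quotientKernel G v₀ (multiplicative G v₀ gp gm) v ω := by
  classical
  rintro ⟨-, hmin⟩
  have hG := hT.isTree
  have hgp0 := hg.plus_ne_zero
  have hgm0 := hg.minus_ne_zero
  have hfp0 := hf.plus_ne_zero
  have hfm0 := hf.minus_ne_zero
  obtain ⟨k, hk, hk'⟩ := exists_real_quotientKernel hG v₀ (hp.trans hpg) (hm.trans hmg) ω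
  choose r r' hr hr' hr0 hrr using exists_real_multiplicative G v₀ hp hm hpg.le hmg.le
  obtain ⟨b, hb, hbne⟩ : ∃ b, G.Adj v₀ b ∧ b ≠ pt hG v₀ ω 1 := by
    have hcard : 1 < (G.neighborFinset v₀).card := by
      rw [G.card_neighborFinset_eq_degree, hT.degree_eq, classValue_base]
      have := hT.one_lt_plus
      omega
    obtain ⟨b, hb, hne⟩ := Finset.exists_mem_ne hcard (pt hG v₀ ω 1)
    exact ⟨b, by simpa using hb, hne⟩
  have hbnext : pt hG b ω 1 = v₀ :=
    (pt_one_of_adj hG ω hb).resolve_left (Ne.symm hbne)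
  set B : Set V := {v | b ∈ geodesic G v ω} with hBdef
  have hbB : b ∈ B := (mem_geodesic_iff hG b ω).2 ⟨0, pt_zero hG b ω⟩
  have hv₀B : v₀ ∉ B := by
    intro h
    have h1 := (mem_geodesic_iff_pt_dist hG v₀ ω).1 h
    rw [SimpleGraph.dist_eq_one_iff_adj.2 hb] at h1
    exact hbne h1.symm
  -- the only edge leaving the branch of `b` joins `b` to `v₀`
  have hexit : ∀ v w, G.Adj v w → v ∈ B → w ∉ B → v = b ∧ w = v₀ := by
    intro v w hvw hv hw
    have h1 : v = b := by
      by_contra h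
      exact hw (mem_geodesic_of_adj hG hvw hv h)
    subst h1
    refine ⟨rfl, ?_⟩
    rcases pt_one_of_adj hG ω hvw with h | h
    · rw [← h, hbnext]
    · exact absurd ((mem_geodesic_iff hG w ω).2 ⟨1, h⟩) hw
  have hdistB : ∀ n v, G.dist v b = n → n < G.dist v v₀ → v ∈ B := by
    intro n
    induction n with
    | zero =>
      intro v h _
      rw [hG.connected.dist_eq_zero_iff.1 h]
      exact hbB
    | succ n ih =>
      intro v hv hlt
      obtain ⟨u, hvu, hd⟩ := exists_adj_dist_eq_add_one hG (v := v) (j := b)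
        (by rintro rfl; rw [SimpleGraph.dist_self] at hv; omega)
      have hu : u ∈ B := ih u (by omega)
        (by rcases dist_adj_cases hG hvu v₀ with h | h <;> omega)
      by_contra hvB
      obtain ⟨-, rfl⟩ := hexit u v hvu.symm hu hvB
      rw [SimpleGraph.dist_self] at hlt
      omega
  have hdist : ∀ v, v ∉ B → G.dist v b = G.dist v v₀ + 1 := by
    intro v hv
    rcases dist_adj_cases hG hb.symm v with h | h
    · rwa [G.dist_comm, G.dist_comm (u := v₀)] at h
    · rw [G.dist_comm, G.dist_comm (u := b)] at h
      exact absurd (hdistB _ v rfl (by omega)) hv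
  -- values of the hitting functions on the two sides of the edge
  have hrb : r b v₀ = fm := by
    have := hr b v₀
    rw [multiplicative_adj v₀ _ _ hG hb.symm, classValue_adj hG hb, classValue_base] at this
    exact_mod_cast this.symm
  have hrb' : r v₀ b = fp := by
    have := hr v₀ b
    rw [multiplicative_adj v₀ _ _ hG hb, classValue_base] at this
    exact_mod_cast this.symm
  have hrself : ∀ v, r v v = 1 := fun v => by
    have := hr v v
    rw [multiplicative_self] at this
    exact_mod_cast this.symm
  have hkv₀ : k v₀ = 1 := by
    have := hk' v₀
    rw [quotientKernel_base v₀ hG hgp0 hgm0] at this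
    exact_mod_cast this.symm
  have hkstep : ∀ v w, pt hG v ω 1 = w → k v = classValue G v₀ gp gm v * k w := by
    intro v w h
    have h1 := quotientKernel_step v₀ hG hgp0 hgm0 h
    rw [hk', hk'] at h1
    have h2 : classValue G v₀ (gp : ℂ) (gm : ℂ) v = ((classValue G v₀ gp gm v : ℝ) : ℂ) := by
      unfold classValue; split_ifs <;> rfl
    rw [h2] at h1
    exact_mod_cast h1
  have hkb : k b = gm := by
    rw [hkstep b v₀ hbnext, hkv₀, classValue_adj hG hb, classValue_base, mul_one]
  have hkB : ∀ v ∈ B, k v = r' v b * gm := by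
    intro v hv
    have h1 := quotientKernel_of_mem_geodesic v₀ hG hgp0 hgm0 hv
    rw [hk', hk', hr', hkb] at h1
    exact_mod_cast h1
  have hrB : ∀ v ∈ B, r v v₀ = r v b * fm := by
    intro v hv
    obtain ⟨m, hm'⟩ := (mem_geodesic_iff hG v ω).1 hv
    have h1 : pt hG v ω (m + 1) = v₀ := by rw [pt_add, hm', hbnext]
    have h2 := multiplicative_pt_add v₀ (fp : ℂ) fm hG v ω m 1
    rw [h1, hm', hr, hr, hr, hrb] at h2
    exact_mod_cast h2
  have hrstep : ∀ v w j, G.Adj v w → G.dist v j = G.dist w j + 1 →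
      r v j = classValue G v₀ fp fm v * r w j := by
    intro v w j hvw hd
    have h1 := multiplicative_of_dist_eq_add_one v₀ (fp : ℂ) fm hG hvw hd
    have h2 : classValue G v₀ (fp : ℂ) (fm : ℂ) v = ((classValue G v₀ fp fm v : ℝ) : ℂ) := by
      unfold classValue; split_ifs <;> rfl
    rw [hr, hr, h2] at h1
    exact_mod_cast h1
  have hrC : ∀ n v, G.dist v v₀ = n → v ∉ B → r v b = r v v₀ * fp := by
    intro n
    induction n with
    | zero =>
      intro v h _
      rw [hG.connected.dist_eq_zero_iff.1 h, hrself, hrb', one_mul]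
    | succ n ih =>
      intro v hn hv
      obtain ⟨w, hvw, hd⟩ := exists_adj_dist_eq_add_one hG (v := v) (j := v₀)
        (by rintro rfl; simp at hn)
      have hw : w ∉ B := by
        intro hw
        obtain ⟨-, rfl⟩ := hexit w v hvw.symm hw hv
        simp at hn
      have h1 := hdist v hv
      have h2 := hdist w hw
      rw [hrstep v w b hvw (by omega), hrstep v w v₀ hvw hd, ih w (by omega) hw, mul_assoc]
  -- the kernel dominates the hitting function of `v₀`
  have hdom : ∀ n v, G.dist v v₀ = n → r v v₀ ≤ k v := by
    intro n
    induction n with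
    | zero =>
      intro v h
      rw [hG.connected.dist_eq_zero_iff.1 h, hrself, hkv₀]
    | succ n ih =>
      intro v hn
      obtain ⟨w, hvw, hd⟩ := exists_adj_dist_eq_add_one hG (v := v) (j := v₀)
        (by rintro rfl; simp at hn)
      have hw := ih w (by omega)
      rw [hrstep v w v₀ hvw hd]
      have hcl : 0 < classValue G v₀ fp fm v := classValue_cases (p := (0 < ·)) hp hm v₀ v
      rcases pt_one_of_adj hG ω hvw with h | h
      · rw [hkstep v w h]
        have hle : classValue G v₀ fp fm v ≤ classValue G v₀ gp gm v := by
          unfold classValue; split_ifs <;> linarith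
        exact mul_le_mul hle hw (hr0 _ _).le (hcl.le.trans hle)
      · have hlt : classValue G v₀ fp fm v * classValue G v₀ gp gm w ≤ 1 := by
          rw [classValue_adj hG hvw]
          unfold classValue; split_ifs <;> linarith
        calc _ ≤ classValue G v₀ fp fm v * k w := by gcongr
          _ = (classValue G v₀ fp fm v * classValue G v₀ gp gm w) * k v := by
            rw [hkstep w v h]; ring
          _ ≤ _ := mul_le_of_le_one_left (hk v).le hlt
  -- the coefficients that make the two definitions agree across the edge
  have hX : fp * fm < 1 := lt_of_le_of_lt (mul_le_mul_of_nonneg_left hmg.le hp.le) hpm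
  set s : ℝ := (gm - fm) / (1 - fp * fm) with hs
  have hX0 : 1 - fp * fm ≠ 0 := by linarith
  have hspos : 0 < s := div_pos (by linarith) (by linarith)
  have hseq : s * (1 - fp * fm) = gm - fm := by rw [hs, div_mul_cancel₀ _ hX0]
  set t : ℝ := 1 - s * fp with ht
  have htpos : 0 < t := by
    have : t * (1 - fp * fm) = 1 - fp * gm := by rw [ht]; linear_combination (-fp) * hseq
    have h1 : 0 < t * (1 - fp * fm) := by linarith
    exact pos_of_mul_pos_left h1 (by linarith)
  have hst : gm - t * fm = s := by rw [ht]; linear_combination (-1 : ℝ) * hseq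
  set h : V → ℝ := fun v => if v ∈ B then k v - t * r v v₀ else s * r v b with hh
  have hh0 : ∀ v, 0 ≤ h v := by
    intro v
    by_cases hv : v ∈ B
    · simp only [hh, hv, if_true]
      rw [hkB v hv, hrB v hv]
      have h1 : r v b * gm ≤ r' v b * gm := by gcongr; exacts [(hm.trans hmg).le, hrr _ _]
      have h2 : 0 ≤ r v b * s := mul_nonneg (hr0 _ _).le hspos.le
      rw [← hst] at h2
      linarith
    · simp only [hh, hv, if_false]
      exact mul_nonneg hspos.le (hr0 _ _).le
  have hhk : ∀ v, h v ≤ k v := by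
    intro v
    by_cases hv : v ∈ B
    · simp only [hh, hv, if_true]
      have := mul_pos htpos (hr0 v v₀)
      linarith
    · simp only [hh, hv, if_false]
      rw [hrC _ v rfl hv]
      have h1 := hdom _ v rfl
      have h2 := mul_pos htpos (hr0 v v₀)
      rw [ht] at h2
      linarith
  have hheig : IsEigenfunction G (γ : ℂ) fun v => (h v : ℂ) := by
    intro v
    by_cases hv : v ∈ B
    · have h3 : ∀ w ∈ G.neighborFinset v, (h w : ℂ) =
          quotientKernel G v₀ (multiplicative G v₀ gp gm) w ω
            - t * multiplicative G v₀ fp fm w v₀ := by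
        intro w hw
        rw [hk', hr]
        by_cases hwB : w ∈ B
        · simp [hh, hwB]
        · obtain ⟨-, rfl⟩ := hexit v w (by simpa using hw) hv hwB
          simp only [hh, hwB, if_false, hrb', hkv₀, hrself, ht]
          push_cast
          ring
      have h1 := isEigenfunction_quotientKernel hT hg hgp0 hgm0 ω v
      have h2 := laplacian_multiplicative hT hf hfp0 hfm0 (v := v) (j := v₀)
        (by rintro rfl; exact hv₀B hv)
      rw [laplacian] at h1 h2 ⊢
      rw [Finset.sum_congr rfl h3, Finset.sum_sub_distrib, ← Finset.mul_sum]
      simp only [hh, hv, if_true]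
      push_cast
      rw [← hk', ← hr]
      linear_combination h1 - t * h2
    · have h3 : ∀ w ∈ G.neighborFinset v, (h w : ℂ) = s * multiplicative G v₀ fp fm w b := by
        intro w hw
        rw [hr]
        by_cases hwB : w ∈ B
        · obtain ⟨rfl, -⟩ := hexit w v (by simpa [G.adj_comm] using hw) hwB hv
          simp only [hh, hwB, if_true, hkb, hrb, hst, hrself]
          push_cast
          ring
        · simp [hh, hwB]
      have h2 := laplacian_multiplicative hT hf hfp0 hfm0 (v := v) (j := b)
        (by rintro rfl; exact hv hbB)
      rw [laplacian] at h2 ⊢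
      rw [Finset.sum_congr rfl h3, ← Finset.mul_sum]
      simp only [hh, hv, if_false]
      push_cast
      rw [← hr]
      linear_combination (s : ℂ) * h2
  obtain ⟨c, hc⟩ := hmin h hh0 hheig (fun v => by
    change h v ≤ (quotientKernel G v₀ (multiplicative G v₀ gp gm) v ω).re
    rw [hk' v, Complex.ofReal_re]
    exact hhk v)
  have hcr : ∀ v, h v = c * k v := fun v => by
    have : (h v : ℂ) = c * quotientKernel G v₀ (multiplicative G v₀ gp gm) v ω := hc v
    rw [hk'] at this
    exact_mod_cast this
  -- compare the values at `v₀` and at the next vertex of the ray to `ω`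
  set x := pt hG v₀ ω 1 with hx
  have hxadj : G.Adj v₀ x := adj_pt_one hG v₀ ω
  have hxB : x ∉ B := by
    intro hxB
    exact hbne.symm (hexit x v₀ hxadj.symm hxB hv₀B).1
  have e1 := hcr v₀
  have e2 := hcr x
  simp only [hh, hv₀B, hxB, if_false] at e1 e2
  have hrx : r x v₀ = fm := by
    have := hr x v₀
    rw [multiplicative_adj v₀ _ _ hG hxadj.symm, classValue_adj hG hxadj, classValue_base] at this
    exact_mod_cast this.symm
  have hkx : 1 = gp * k x := by
    rw [← hkv₀, hkstep v₀ x rfl, classValue_base]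
  rw [hrb', hkv₀, mul_one] at e1
  rw [hrC _ x rfl hxB, hrx, ← e1] at e2
  have hsf : s * fp ≠ 0 := (mul_pos hspos hp).ne'
  have e3 : fm = k x := by
    refine mul_left_cancel₀ hsf ?_
    linear_combination e2
  rw [e3, mul_comm, ← hkx] at hmp
  exact lt_irrefl _ hmp

end SemihomTree

/-! ### Homogeneous trees: complex powers of the harmonic kernel -/

namespace SemihomTree

variable {V : Type*} {G : SimpleGraph V} {v₀ : V} {q : ℕ}

theorem Fplus_one_self (hq : 1 < q) : Fplus q q 1 = (q : ℂ)⁻¹ ∧ Fminus q q 1 = (q : ℂ)⁻¹ := by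
  have hq0 : (q : ℂ) ≠ 0 := by exact_mod_cast (by omega : q ≠ 0)
  have hqr : (1 : ℝ) < q := by exact_mod_cast hq
  have h1 : (√q + √q) ^ 2 < ((q : ℝ) + 1) * (q + 1) * 1 ^ 2 := by
    have := Real.sq_sqrt (Nat.cast_nonneg (α := ℝ) q)
    nlinarith [mul_pos (sub_pos.2 hqr) (sub_pos.2 hqr)]
  obtain ⟨fp, fm, gp, gm, h1, h2, h3, h4, h5, h6, h7, h8, -, -⟩ :=
    exists_real_values hq hq one_pos h1
  rw [Complex.ofReal_one] at h1 h2 h3 h4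
  have hpair : IsHittingPair q q (1 : ℂ) (q : ℂ)⁻¹ (q : ℂ)⁻¹ := by
    constructor <;> field_simp
  rcases hpair.eq_or_eq (by omega) (by omega) one_ne_zero with h | h
  · exact ⟨h.1.symm, h.2.symm⟩
  · -- the larger solution is `1`
    exfalso
    have hone : IsHittingPair q q (1 : ℂ) 1 1 := by constructor <;> ring
    have hne : (q : ℝ)⁻¹ < 1 := inv_lt_one_of_one_lt₀ hqr
    rcases hone.eq_or_eq (by omega) (by omega) one_ne_zero with h' | h'
    · have e1 : (fp : ℂ) = ((1 : ℝ) : ℂ) := by rw [← h1, ← h'.1]; simp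
      have e2 : (gp : ℂ) = (((q : ℝ)⁻¹ : ℝ) : ℂ) := by rw [← h3, ← h.1]; simp
      rw [Complex.ofReal_inj] at e1 e2
      linarith
    · have e1 : ((q : ℝ) : ℂ)⁻¹ = ((1 : ℝ) : ℂ) := by
        rw [Complex.ofReal_natCast, h.1, ← h'.1]; simp
      rw [← Complex.ofReal_inv, Complex.ofReal_inj] at e1
      linarith

theorem Fminus_self (q : ℕ) (γ : ℂ) : Fminus q q γ = Fplus q q γ := rfl

theorem FtildeMinus_self (q : ℕ) (γ : ℂ) : FtildeMinus q q γ = FtildePlus q q γ := rfl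

theorem multiplicative_const (G : SimpleGraph V) (v₀ : V) (a : ℂ) (u v : V) :
    multiplicative G v₀ a a u v = a ^ G.dist u v := by
  have : (G.dist u v + 1) / 2 + G.dist u v / 2 = G.dist u v := by omega
  unfold multiplicative
  split_ifs <;> rw [← pow_add, this]

/-- If both factors are the power `q^{-z}`, the quotient kernel is the `z`-th power of the kernel
with factors `q⁻¹`. -/
theorem quotientKernel_cpow (hG : G.IsTree) (hq : 1 < q) {a z : ℂ} (ha : a = (q : ℂ) ^ (-z))
    (v : V) (ω : Boundary G) :
    quotientKernel G v₀ (multiplicative G v₀ a a) v ω =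
      quotientKernel G v₀ (multiplicative G v₀ (q : ℂ)⁻¹ (q : ℂ)⁻¹) v ω ^ z := by
  have hq0 : (q : ℂ) ≠ 0 := by exact_mod_cast (by omega : q ≠ 0)
  have ha0 : a ≠ 0 := by rw [ha, Complex.cpow_def_of_ne_zero hq0]; exact Complex.exp_ne_zero _
  obtain ⟨j, hj⟩ := geodesic_inter_nonempty hG v₀ v ω
  rw [quotientKernel_eq v₀ hG ha0 ha0 hj,
    quotientKernel_eq v₀ hG (inv_ne_zero hq0) (inv_ne_zero hq0) hj]
  simp only [multiplicative_const]
  have hinv : ((((q : ℝ)⁻¹ : ℝ) : ℂ)) ^ z = a := by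
    rw [ha, Complex.cpow_neg, Complex.ofReal_inv, Complex.ofReal_natCast, Complex.inv_cpow]
    rw [Complex.natCast_arg]
    exact Real.pi_pos.ne
  have hpow : ∀ n : ℕ, (((q : ℝ)⁻¹ ^ n : ℝ) : ℂ) ^ z = a ^ n := by
    intro n
    induction n with
    | zero => simp
    | succ n ih =>
      rw [pow_succ, Complex.ofReal_mul,
        Complex.mul_cpow_ofReal_nonneg (by positivity) (by positivity), ih, hinv, pow_succ]
  have hpow' : ∀ n : ℕ, ((((q : ℝ)⁻¹ ^ n)⁻¹ : ℝ) : ℂ) ^ z = (a ^ n)⁻¹ := by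
    intro n
    rw [Complex.ofReal_inv, Complex.inv_cpow, hpow]
    rw [Complex.arg_ofReal_of_nonneg (by positivity)]
    exact Real.pi_pos.ne
  have e : ((q : ℂ)⁻¹ ^ G.dist v j / (q : ℂ)⁻¹ ^ G.dist v₀ j)
      = (((q : ℝ)⁻¹ ^ G.dist v j : ℝ) : ℂ) * ((((q : ℝ)⁻¹ ^ G.dist v₀ j)⁻¹ : ℝ) : ℂ) := by
    push_cast
    rw [div_eq_mul_inv]
  rw [e, Complex.mul_cpow_ofReal_nonneg (by positivity) (by positivity), hpow, hpow',
    div_eq_mul_inv]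

theorem mul_Fplus_mul_FtildePlus (hq : q ≠ 0) {γ : ℂ} (hγ : γ ≠ 0) :
    (q : ℂ) * (Fplus q q γ * FtildePlus q q γ) = 1 := by
  have hq0 : (q : ℂ) ≠ 0 := by exact_mod_cast hq
  have hq1 : (q : ℂ) + 1 ≠ 0 := Nat.cast_add_one_ne_zero _
  have hR := rootR_sq q q γ
  rw [Fplus, FtildePlus, nearestValue, nearestValue]
  rw [bigGamma] at hR ⊢
  field_simp
  linear_combination (-1 : ℂ) * hR

variable [G.LocallyFinite]

/-- Outside the spectrum `F` is the solution `q^{-z}` of the quadratic equation for the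
hitting probability with `Re z > 1 / 2`, and `F̃` is the other one. -/
theorem exists_cpow_and_forall (hT : IsSemihomogeneous G v₀ q q) {γ : ℂ}
    (hγ : γ ∉ spectrumL2 hT) :
    (∃ z : ℂ, 1 / 2 < z.re ∧ γ = ((q : ℂ) ^ z + (q : ℂ) ^ (1 - z)) / ((q : ℂ) + 1)) ∧
      ∀ z : ℂ, 1 / 2 < z.re → γ = ((q : ℂ) ^ z + (q : ℂ) ^ (1 - z)) / ((q : ℂ) + 1) →
        Fplus q q γ = (q : ℂ) ^ (-z) ∧ FtildePlus q q γ = (q : ℂ) ^ (-(1 - z)) := by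
  have hq := hT.one_lt_plus
  have hqr : (1 : ℝ) < q := by exact_mod_cast hq
  have hq0 : (q : ℂ) ≠ 0 := by exact_mod_cast (by omega : q ≠ 0)
  have hq1 : (q : ℂ) + 1 ≠ 0 := Nat.cast_add_one_ne_zero _
  obtain ⟨hγ0, hlt⟩ := norm_FF_sq_lt_one_of_notMem hT hγ
  have hf := isHittingPair_F (by omega) (by omega) hγ0 (qp := q) (qm := q)
  have hfg := mul_Fplus_mul_FtildePlus (q := q) (by omega) hγ0
  rw [Fminus_self] at hf hlt
  set f := Fplus q q γ
  set g := FtildePlus q q γ with hg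
  have hf0 : f ≠ 0 := hf.plus_ne_zero
  have hfnorm : (q : ℝ) * ‖f‖ ^ 2 < 1 := by
    have h1 : ((q : ℝ) * ‖f‖ ^ 2) ^ 2 < 1 ^ 2 := by
      rw [norm_mul] at hlt
      calc _ = (q * q : ℝ) * (‖f‖ * ‖f‖) ^ 2 := by ring
        _ < 1 := hlt
        _ = 1 ^ 2 := by ring
    exact lt_of_pow_lt_pow_left₀ 2 zero_le_one h1
  -- the two powers of `q` in terms of `q^{-z}`
  have hz : ∀ z : ℂ, (q : ℂ) ^ z = ((q : ℂ) ^ (-z))⁻¹ ∧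
      (q : ℂ) ^ (1 - z) = q * (q : ℂ) ^ (-z) := by
    intro z
    rw [sub_eq_add_neg, Complex.cpow_add _ _ hq0, Complex.cpow_one, Complex.cpow_neg, inv_inv]
    exact ⟨rfl, rfl⟩
  constructor
  · have hlogq : 0 < Real.log q := Real.log_pos hqr
    have hlog : Complex.log q ≠ 0 := by
      rw [← Complex.natCast_log]
      exact_mod_cast hlogq.ne'
    have hpow : (q : ℂ) ^ (-(-Complex.log f / Complex.log q)) = f := by
      rw [Complex.cpow_def_of_ne_zero hq0, neg_div, neg_neg, mul_div_cancel₀ _ hlog,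
        Complex.exp_log hf0]
    refine ⟨-Complex.log f / Complex.log q, ?_, ?_⟩
    · rw [← Complex.natCast_log, Complex.div_ofReal_re, Complex.neg_re, Complex.log_re,
        div_lt_div_iff₀ two_pos hlogq]
      have h1 := Real.log_neg (by have := norm_pos_iff.2 hf0; positivity) hfnorm
      rw [Real.log_mul (by positivity) (pow_ne_zero _ (norm_ne_zero_iff.2 hf0)),
        Real.log_pow] at h1
      push_cast at h1
      linarith
    · rw [(hz _).1, (hz _).2, hpow]
      have := hf.plus
      field_simp
      linear_combination this
  · intro z hzre hzγ
    rw [(hz z).1, (hz z).2] at hzγ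
    set y := (q : ℂ) ^ (-z) with hy
    have hy0 : y ≠ 0 := by
      rw [hy, Complex.cpow_def_of_ne_zero hq0]; exact Complex.exp_ne_zero _
    have hynorm : (q : ℝ) * ‖y‖ ^ 2 < 1 := by
      rw [hy, Complex.norm_natCast_cpow_of_pos (by omega), ← Real.rpow_natCast,
        ← Real.rpow_mul (by positivity)]
      nth_rewrite 1 [← Real.rpow_one (q : ℝ)]
      rw [← Real.rpow_add (by positivity)]
      refine Real.rpow_lt_one_of_one_lt_of_neg hqr ?_
      rw [Complex.neg_re]
      push_cast
      linarith
    have hpair : IsHittingPair q q γ y y := by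
      have : γ * (q + 1) * y = 1 + q * (y * y) := by
        rw [hzγ]
        field_simp
      exact ⟨this, this⟩
    have hyf : y = f := by
      rcases hpair.eq_or_eq (by omega) (by omega) hγ0 with h | h
      · exact h.1
      · exfalso
        rw [← hg] at h
        rw [h.1] at hynorm
        have h1 := congrArg norm hfg
        rw [norm_mul, norm_mul, Complex.norm_natCast, norm_one] at h1
        have h2 : ((q : ℝ) * ‖f‖ ^ 2) * ((q : ℝ) * ‖g‖ ^ 2) = 1 := by
          calc _ = ((q : ℝ) * (‖f‖ * ‖g‖)) ^ 2 := by ring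
            _ = 1 := by rw [h1, one_pow]
        have h3 := mul_lt_one_of_nonneg_of_lt_one_left (by positivity) hfnorm hynorm.le
        linarith
    refine ⟨hyf.symm, ?_⟩
    rw [Complex.cpow_neg, (hz z).2, ← hy, hyf, eq_comm, inv_eq_iff_eq_inv]
    refine eq_inv_of_mul_eq_one_left ?_
    linear_combination hfg

end SemihomTree

theorem mainTheorem10 {V : Type*} (G : SimpleGraph V) [G.LocallyFinite] (v₀ : V) (qp qm : ℕ)
    (hT : SemihomTree.IsSemihomogeneous G v₀ qp qm) :
    -- `F` is the generalized hitting probability: the first-visit generating function in the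
    -- corona, a quotient of Green kernels outside the spectrum
    (∀ γ : ℂ, SemihomTree.rho hT < ENNReal.ofReal ‖γ‖ → ∀ u v,
      HasSum (fun n : ℕ => (SemihomTree.firstVisit G n u v : ℂ) * (γ ^ n)⁻¹)
        (SemihomTree.F G v₀ qp qm γ u v)) ∧
    (∀ γ : ℂ, γ ∉ SemihomTree.spectrumL2 hT → γ ≠ 0 ∧ ∀ u v,
      SemihomTree.green hT γ v v ≠ 0 ∧
      SemihomTree.F G v₀ qp qm γ u v
        = SemihomTree.green hT γ u v / SemihomTree.green hT γ v v) ∧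
    -- the kernels are well defined
    (∀ γ : ℂ, γ ≠ 0 →
      SemihomTree.IsWellDefinedKernel G v₀ (SemihomTree.F G v₀ qp qm γ)
        (SemihomTree.poisson G v₀ qp qm γ) ∧
      SemihomTree.IsWellDefinedKernel G v₀ (SemihomTree.Ftilde G v₀ qp qm γ)
        (SemihomTree.poissonTilde G v₀ qp qm γ)) ∧
    -- both kernels, and their integrals against distributions, are eigenfunctions
    (∀ γ : ℂ, γ ≠ 0 →
      (∀ ω, SemihomTree.IsEigenfunction G γ
        (fun v => SemihomTree.poisson G v₀ qp qm γ v ω)) ∧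
      (∀ ω, SemihomTree.IsEigenfunction G γ
        (fun v => SemihomTree.poissonTilde G v₀ qp qm γ v ω)) ∧
      ∀ μ : SemihomTree.Distribution G,
        SemihomTree.IsEigenfunction G γ
          (fun v => μ.integral (SemihomTree.poisson G v₀ qp qm γ v)) ∧
        SemihomTree.IsEigenfunction G γ
          (fun v => μ.integral (SemihomTree.poissonTilde G v₀ qp qm γ v))) ∧
    -- outside the spectrum the integrals against the equidistributed measure are the spherical
    -- function
    (∃ ν : MeasureTheory.Measure (SemihomTree.Boundary G),
      SemihomTree.IsEquidistributed G v₀ ν ∧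
      (∀ ν' : MeasureTheory.Measure (SemihomTree.Boundary G),
        SemihomTree.IsEquidistributed G v₀ ν' → ν' = ν) ∧
      ∀ γ : ℂ, γ ∉ SemihomTree.spectrumL2 hT →
        (∀ v, MeasureTheory.Integrable (SemihomTree.poisson G v₀ qp qm γ v) ν ∧
          MeasureTheory.Integrable (SemihomTree.poissonTilde G v₀ qp qm γ v) ν) ∧
        ∃ φ : V → ℂ,
          (∀ f : V → ℂ, SemihomTree.IsSphericalFunction G v₀ γ f ↔ f = φ) ∧
          (∀ v, φ v = ∫ ω, SemihomTree.poisson G v₀ qp qm γ v ω ∂ν) ∧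
          (∀ v, φ v = ∫ ω, SemihomTree.poissonTilde G v₀ qp qm γ v ω ∂ν)) ∧
    -- minimality, at the real eigenvalues above the spectral radius
    (∀ γ : ℝ, SemihomTree.rho hT < ENNReal.ofReal γ → ∀ ω,
      SemihomTree.IsMinimalEigenfunction G γ
        (fun v => SemihomTree.poisson G v₀ qp qm (γ : ℂ) v ω) ∧
      SemihomTree.IsPositiveEigenfunction G γ
        (fun v => SemihomTree.poissonTilde G v₀ qp qm (γ : ℂ) v ω) ∧
      ¬ SemihomTree.IsMinimalEigenfunction G γ
        (fun v => SemihomTree.poissonTilde G v₀ qp qm (γ : ℂ) v ω)) ∧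
    -- there are no other kernels of this type
    (∀ γ : ℂ, γ ≠ 0 → ∀ Ap Am : ℂ, Ap ≠ 0 → Am ≠ 0 →
      (∀ ω, SemihomTree.IsEigenfunction G γ (fun v =>
        SemihomTree.quotientKernel G v₀ (SemihomTree.multiplicative G v₀ Ap Am) v ω)) →
      SemihomTree.quotientKernel G v₀ (SemihomTree.multiplicative G v₀ Ap Am)
          = SemihomTree.poisson G v₀ qp qm γ ∨
        SemihomTree.quotientKernel G v₀ (SemihomTree.multiplicative G v₀ Ap Am)
          = SemihomTree.poissonTilde G v₀ qp qm γ) ∧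
    -- the homogeneous case: the kernels are complex powers of the harmonic Poisson kernel
    (qp = qm → ∀ γ : ℂ, γ ∉ SemihomTree.spectrumL2 hT →
      (∃ z : ℂ, 1 / 2 < z.re ∧ γ = ((qp : ℂ) ^ z + (qp : ℂ) ^ (1 - z)) / ((qp : ℂ) + 1)) ∧
      ∀ z : ℂ, 1 / 2 < z.re → γ = ((qp : ℂ) ^ z + (qp : ℂ) ^ (1 - z)) / ((qp : ℂ) + 1) →
        ∀ v ω,
          SemihomTree.poisson G v₀ qp qm γ v ω = SemihomTree.poisson G v₀ qp qm 1 v ω ^ z ∧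
          SemihomTree.poissonTilde G v₀ qp qm γ v ω
            = SemihomTree.poisson G v₀ qp qm 1 v ω ^ (1 - z)) := by
  have hG := hT.isTree
  have hqp : qp ≠ 0 := by have := hT.one_lt_plus; omega
  have hqm : qm ≠ 0 := by have := hT.one_lt_minus; omega
  refine ⟨fun γ hγ u v => SemihomTree.hasSum_firstVisit hT hγ u v, fun γ hγ => ?_, fun γ hγ => ?_,
    fun γ hγ => ?_, ?_, fun γ hγ ω => ?_, fun γ hγ Ap Am hAp hAm hK => ?_, ?_⟩
  · refine ⟨(SemihomTree.norm_FF_sq_lt_one_of_notMem hT hγ).1, fun u v => ?_⟩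
    obtain ⟨h1, h2⟩ := SemihomTree.green_eq hT hγ v
    exact ⟨h1, by rw [h2 u, mul_div_cancel_right₀ _ h1]⟩
  · have hF := SemihomTree.isHittingPair_F hqp hqm hγ
    have hF' := SemihomTree.isHittingPair_Ftilde hqp hqm hγ
    exact ⟨SemihomTree.isWellDefinedKernel_quotientKernel v₀ hG hF.plus_ne_zero hF.minus_ne_zero,
      SemihomTree.isWellDefinedKernel_quotientKernel v₀ hG hF'.plus_ne_zero hF'.minus_ne_zero⟩
  · have hF := SemihomTree.isHittingPair_F hqp hqm hγ
    have hF' := SemihomTree.isHittingPair_Ftilde hqp hqm hγ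
    have h1 := SemihomTree.isEigenfunction_quotientKernel hT hF hF.plus_ne_zero hF.minus_ne_zero
    have h2 := SemihomTree.isEigenfunction_quotientKernel hT hF' hF'.plus_ne_zero
      hF'.minus_ne_zero
    exact ⟨h1, h2, fun μ =>
      ⟨SemihomTree.isEigenfunction_integral hG hF.plus_ne_zero hF.minus_ne_zero h1 μ,
        SemihomTree.isEigenfunction_integral hG hF'.plus_ne_zero hF'.minus_ne_zero h2 μ⟩⟩
  · obtain ⟨ν, hν⟩ := SemihomTree.exists_isEquidistributed hT
    have := hν.isProbabilityMeasure hG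
    refine ⟨ν, hν, fun ν' hν' => hν.unique hG hν', fun γ hγ => ?_⟩
    have hγ0 := (SemihomTree.norm_FF_sq_lt_one_of_notMem hT hγ).1
    have hF := SemihomTree.isHittingPair_F hqp hqm hγ0
    have hF' := SemihomTree.isHittingPair_Ftilde hqp hqm hγ0
    have h1 := SemihomTree.isSphericalFunction_integral hT hF hν
    have h2 := SemihomTree.isSphericalFunction_integral hT hF' hν
    refine ⟨fun v =>
      ⟨SemihomTree.integrable_quotientKernel hG hF.plus_ne_zero hF.minus_ne_zero ν v,
        SemihomTree.integrable_quotientKernel hG hF'.plus_ne_zero hF'.minus_ne_zero ν v⟩,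
      _, fun f => ⟨fun hf => hf.unique hT h1, ?_⟩, fun v => rfl,
      fun v => congrFun (h1.unique hT h2) v⟩
    rintro rfl
    exact h1
  · obtain ⟨hγ0, hΓ⟩ := SemihomTree.lt_of_rho_lt hT hγ
    have hmem : (γ : ℂ) ∉ SemihomTree.spectrumL2 hT :=
      SemihomTree.notMem_spectrumL2_of_rho_lt hT
        (by rwa [Complex.norm_real, Real.norm_of_nonneg hγ0.le])
    obtain ⟨hγ0', hlt⟩ := SemihomTree.norm_FF_sq_lt_one_of_notMem hT hmem
    have hF := SemihomTree.isHittingPair_F hqp hqm hγ0'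
    have hF' := SemihomTree.isHittingPair_Ftilde hqp hqm hγ0'
    obtain ⟨fp, fm, gp, gm, e1, e2, e3, e4, h5, h6, h7, h8, h9, h10⟩ :=
      SemihomTree.exists_real_values hT.one_lt_plus hT.one_lt_minus hγ0 hΓ
    unfold SemihomTree.poisson SemihomTree.poissonTilde SemihomTree.F SemihomTree.Ftilde
    rw [e1, e2] at hF hlt ⊢
    rw [e3, e4] at hF' ⊢
    exact ⟨SemihomTree.isMinimalEigenfunction_quotientKernel hT hmem h5 h6 hF hlt ω,
      SemihomTree.isPositiveEigenfunction_quotientKernel hT (h5.trans h7) (h6.trans h8) hF' ω,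
      SemihomTree.not_isMinimalEigenfunction_quotientKernel hT h5 h6 h7 h8 h9 h10 hF hF' ω⟩
  · rcases isEmpty_or_nonempty (SemihomTree.Boundary G) with hΩ | ⟨⟨ω⟩⟩
    · exact Or.inl (funext fun v => funext fun ω => hΩ.elim ω)
    · rcases (SemihomTree.isHittingPair_of_isEigenfunction hT hAp hAm ω (hK ω)).eq_or_eq hqp hqm hγ
        with ⟨rfl, rfl⟩ | ⟨rfl, rfl⟩
      · exact Or.inl rfl
      · exact Or.inr rfl
  · rintro rfl γ hγ
    obtain ⟨h1, h2⟩ := SemihomTree.exists_cpow_and_forall hT hγ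
    refine ⟨h1, fun z hz hzγ v ω => ?_⟩
    obtain ⟨e1, e2⟩ := h2 z hz hzγ
    obtain ⟨e3, e4⟩ := SemihomTree.Fplus_one_self hT.one_lt_plus
    unfold SemihomTree.poisson SemihomTree.poissonTilde SemihomTree.F SemihomTree.Ftilde
    rw [SemihomTree.Fminus_self, SemihomTree.FtildeMinus_self, SemihomTree.Fminus_self, e3]
    exact ⟨SemihomTree.quotientKernel_cpow hG hT.one_lt_plus e1 v ω,
      SemihomTree.quotientKernel_cpow hG hT.one_lt_plus e2 v ω⟩
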